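/- Metric spaces may take the value $\infty$ as a distance. A *length space* is a metric space $(M,d)$ such that for all $x,y\in M$ with $d(x,y)<\infty$ and every $\varepsilon>0$ there is a path from $x$ to $y$ of length at most $d(x,y)+\varepsilon$. Every graph is regarded as a length space in which each edge is an arc of length one. For sets of points $A,B$ of a length space $M$, $\mathrm{dist}_M(A,B)$ is the infimum of the lengths of the paths in $M$ with one end-point in $A$ and the other in $B$. For a real $K>0$, a *$K$-fat minor model* of a graph $H$ in a length space $M$ consists of non-empty path-connected sets $B_v\subseteq M$ $(v\in V(H))$ and $P_e\subseteq M$ $(e\in E(H))$ such that $B_v\cap P_e\neq\emptyset$ whenever $v$ is an end of $e$, and any two of these sets (with distinct indices) not covered by this condition are at distance at least $K$ in $M$. If such a model exists, $H$ is a *$K$-fat minor* of $M$. For a positive integer $q$, $X$ is *$q$-quasi-isometric* to $Y$ if there is a map $\phi\colon X\to Y$ such that $q^{-1}d_X(x,y)-q\le d_Y(\phi(x),\phi(y))\le q\,d_X(x,y)+q$ for all $x,y\in X$, and every point of $Y$ is at distance at most $q$ from some $\phi(x)$, $x\in X$. **Theorem.** There exists a finite graph $H$ such that, for every integer $q\ge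 1$, there is a graph $G_q$ that does not contain $H$ as a $3$-fat minor and is not $q$-quasi-isometric to any length space with no $(2^{-13q^2})$-fat $H$ minor. -/

import Mathlib

open scoped ENNReal

/-! ### Length spaces, distances between sets, fat minors, quasi-isometries

Metric spaces are allowed to take the value `∞` as a distance (`EMetricSpace`). -/

/-- The length of a path in an extended metric space: the supremum of the lengths of its inscribed
polygons. -/
noncomputable def pathLength {X : Type*} [EMetricSpace X] {x y : X} (γ : Path x y) : ℝ≥0∞ :=
  eVariationOn γ Set.univ

/-- A length space: points at finite distance are joined by paths whose length exceeds their
distance by arbitrarily little. -/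
def IsLengthSpace (X : Type*) [EMetricSpace X] : Prop :=
  ∀ x y : X, edist x y ≠ ∞ → ∀ ε : ℝ≥0∞, 0 < ε → ∃ γ : Path x y, pathLength γ ≤ edist x y + ε

/-- The distance between two sets of points: the infimum of the lengths of the paths with one
end-point in `A` and the other in `B`. -/
noncomputable def setDist {X : Type*} [EMetricSpace X] (A B : Set X) : ℝ≥0∞ :=
  ⨅ (x ∈ A) (y ∈ B) (γ : Path x y), pathLength γ

/-- A `K`-fat minor model of the graph `H` in the space `X`: a branch set `B v` for each vertex `v`
of `H` and a set `P e` for each edge `e` of `H`. -/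
structure FatMinorModel {W : Type*} (H : SimpleGraph W) (K : ℝ) (X : Type*) [EMetricSpace X] where
  B : W → Set X
  P : H.edgeSet → Set X
  isPathConnected_B : ∀ v, IsPathConnected (B v)
  isPathConnected_P : ∀ e, IsPathConnected (P e)
  inter_nonempty : ∀ v e, v ∈ e.1 → (B v ∩ P e).Nonempty
  le_setDist_B_B : ∀ v w, v ≠ w → ENNReal.ofReal K ≤ setDist (B v) (B w)
  le_setDist_P_P : ∀ e f, e ≠ f → ENNReal.ofReal K ≤ setDist (P e) (P f)
  le_setDist_B_P : ∀ v e, v ∉ e.1 → ENNReal.ofReal K ≤ setDist (B v) (P e)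

/-- `H` is a `K`-fat minor of the space `X`. -/
def HasFatMinor {W : Type*} (H : SimpleGraph W) (K : ℝ) (X : Type*) [EMetricSpace X] : Prop :=
  Nonempty (FatMinorModel H K X)

/-- `φ` is a `q`-quasi-isometry of `X` into `Y`. (The subtraction is truncated at `0`, which does
not affect the inequality.) -/
def IsQuasiIsometry {X Y : Type*} [EMetricSpace X] [EMetricSpace Y] (q : ℕ) (φ : X → Y) : Prop :=
  (∀ x y : X, (q : ℝ≥0∞)⁻¹ * edist x y - q ≤ edist (φ x) (φ y) ∧
    edist (φ x) (φ y) ≤ q * edist x y + q) ∧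
  ∀ z : Y, ∃ x : X, edist z (φ x) ≤ q

/-- `X` is `q`-quasi-isometric to `Y`. -/
def QuasiIsometric (q : ℕ) (X Y : Type*) [EMetricSpace X] [EMetricSpace Y] : Prop :=
  ∃ φ : X → Y, IsQuasiIsometry q φ

/-! ### Graphs as length spaces

The points of a graph are those of its geometric realization, in barycentric coordinates: the
vertex `u` is the indicator function of `u`, and an edge `uv` is the segment between its ends.
Every edge has length one, and the distance is that of the path metric. -/

/-- The function `c` lies on the closed edge with ends `u` and `v`, or is the vertex `u = v`. -/
def SimpleGraph.OnEdge {V : Type*} (G : SimpleGraph V) (c : V → ℝ) (u v : V) : Prop :=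
  (u = v ∨ G.Adj u v) ∧
    c ∈ segment ℝ (Set.indicator {u} (fun _ => (1 : ℝ))) (Set.indicator {v} (fun _ => (1 : ℝ)))

/-- A point of the graph `G`, in barycentric coordinates. -/
@[ext]
structure GraphSpace {V : Type*} (G : SimpleGraph V) where
  coord : V → ℝ
  exists_onEdge : ∃ u v, G.OnEdge coord u v

namespace GraphSpace

variable {V : Type*} {G : SimpleGraph V}

/-- The length of the segment between `p` and `q` inside a common closed edge (`∞` if there is no
such edge). -/
noncomputable def localDist (p q : GraphSpace G) : ℝ≥0∞ :=
  ⨅ (u : V) (v : V) (_ : G.OnEdge p.coord u v) (_ : G.OnEdge q.coord u v),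
    ENNReal.ofReal |p.coord u - q.coord u|

/-- The length of a shortest walk from `p` to `q` through vertices: from `p` along its edge to an
end `a`, then through the graph from `a` to a vertex `b`, then along the edge of `q` to `q`. (If
`p.coord a ≠ 0`, then `a` is an end of the edge of `p`, at distance `1 - p.coord a` from `p`.) -/
noncomputable def vertexDist (p q : GraphSpace G) : ℝ≥0∞ :=
  ⨅ (a : V) (b : V) (_ : p.coord a ≠ 0) (_ : q.coord b ≠ 0),
    ENNReal.ofReal (1 - p.coord a) + (G.edist a b : ℝ≥0∞) + ENNReal.ofReal (1 - q.coord b)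

/-- The path metric of the graph `G` with all edges of length one. -/
noncomputable instance : EDist (GraphSpace G) where
  edist p q := min (localDist p q) (vertexDist p q)

theorem onEdge_data {c : V → ℝ} {u v : V} (h : G.OnEdge c u v) :
    0 ≤ c u ∧ 0 ≤ c v ∧ (u = v → c u = 1) ∧ (u ≠ v → c u + c v = 1 ∧ G.Adj u v) ∧
      ∀ w, w ≠ u → w ≠ v → c w = 0 := by
  obtain ⟨h, a, b, ha, hb, hab, rfl⟩ := h
  by_cases huv : u = v
  · subst huv
    simp +contextual [hab, Set.indicator]
  · have hvu : v ≠ u := fun h => huv h.symm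
    have := h.resolve_left huv
    simp +contextual [hab, Set.indicator, huv, hvu, ha, hb, this]

theorem edist_le_local {p q : GraphSpace G} {u v : V} (hp : G.OnEdge p.coord u v)
    (hq : G.OnEdge q.coord u v) : edist p q ≤ ENNReal.ofReal |p.coord u - q.coord u| :=
  (min_le_left _ _).trans
    (iInf_le_of_le u (iInf_le_of_le v (iInf_le_of_le hp (iInf_le_of_le hq le_rfl))))

theorem edist_le_vertex {p q : GraphSpace G} {a b : V} (hp : p.coord a ≠ 0)
    (hq : q.coord b ≠ 0) : edist p q ≤
      ENNReal.ofReal (1 - p.coord a) + (G.edist a b : ℝ≥0∞) + ENNReal.ofReal (1 - q.coord b) :=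
  (min_le_right _ _).trans
    (iInf_le_of_le a (iInf_le_of_le b (iInf_le_of_le hp (iInf_le_of_le hq le_rfl))))

theorem le_edist_add {p q : GraphSpace G} {c s : ℝ≥0∞}
    (h₁ : ∀ u v, G.OnEdge p.coord u v → G.OnEdge q.coord u v →
      c ≤ ENNReal.ofReal |p.coord u - q.coord u| + s)
    (h₂ : ∀ a b, p.coord a ≠ 0 → q.coord b ≠ 0 →
      c ≤ ENNReal.ofReal (1 - p.coord a) + (G.edist a b : ℝ≥0∞) +
        ENNReal.ofReal (1 - q.coord b) + s) :
    c ≤ edist p q + s := by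
  rw [← tsub_le_iff_right]
  refine le_min ?_ ?_
  · refine le_iInf fun u => le_iInf fun v => le_iInf fun hp => le_iInf fun hq => ?_
    rw [tsub_le_iff_right]
    exact h₁ u v hp hq
  · refine le_iInf fun u => le_iInf fun v => le_iInf fun hp => le_iInf fun hq => ?_
    rw [tsub_le_iff_right]
    exact h₂ u v hp hq

theorem coord_mem (p : GraphSpace G) (a : V) : 0 ≤ p.coord a ∧ p.coord a ≤ 1 := by
  obtain ⟨u, v, h⟩ := p.exists_onEdge
  have := onEdge_data h
  by_cases h1 : a = u <;> by_cases h2 : a = v <;> grind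

theorem coord_eq_zero {p : GraphSpace G} {a w : V} (hp : p.coord a = 1) (hw : w ≠ a) :
    p.coord w = 0 := by
  obtain ⟨u, v, h⟩ := p.exists_onEdge
  obtain ⟨hu, hv, h1, h2, h3⟩ := onEdge_data h
  by_cases huv : u = v
  · subst huv
    have hau : a = u := by
      by_contra hau
      simp [h3 a hau hau] at hp
    exact h3 w (hau ▸ hw) (hau ▸ hw)
  · have h4 := (h2 huv).1
    by_cases hau : a = u
    · subst hau
      by_cases hwv : w = v
      · subst hwv
        linarith
      · exact h3 w hw hwv
    · by_cases hav : a = v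
      · subst hav
        by_cases hwu : w = u
        · subst hwu
          linarith
        · exact h3 w hwu hw
      · simp [h3 a hau hav] at hp

theorem eq_of_coord_eq_one {p q : GraphSpace G} {a : V} (hp : p.coord a = 1)
    (hq : q.coord a = 1) : p = q := by
  ext w
  by_cases hw : w = a
  · rw [hw, hp, hq]
  · rw [coord_eq_zero hp hw, coord_eq_zero hq hw]

theorem edist_comm' (p q : GraphSpace G) : edist p q = edist q p := by
  have key : ∀ p q : GraphSpace G, edist p q ≤ edist q p := by
    intro p q
    rw [← add_zero (edist q p)]
    refine le_edist_add (fun u v hp hq => ?_) (fun a b hp hq => ?_)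
    · rw [add_zero, abs_sub_comm]
      exact edist_le_local hq hp
    · rw [add_zero]
      refine (edist_le_vertex hq hp).trans (le_of_eq ?_)
      rw [SimpleGraph.edist_comm]
      ring
  exact le_antisymm (key p q) (key q p)

theorem toENNReal_edist_le_one {a b : V} (h : G.Adj a b) : (G.edist a b : ℝ≥0∞) ≤ 1 := by
  rw [SimpleGraph.edist_eq_one_iff_adj.2 h]
  simp

theorem toENNReal_edist_triangle (a b c : V) :
    (G.edist a c : ℝ≥0∞) ≤ (G.edist a b : ℝ≥0∞) + (G.edist b c : ℝ≥0∞) := by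
  rw [← ENat.toENNReal_add]
  exact ENat.toENNReal_le.2 G.edist_triangle

theorem onEdge_symm {c : V → ℝ} {u v : V} (h : G.OnEdge c u v) : G.OnEdge c v u :=
  ⟨h.1.imp Eq.symm SimpleGraph.Adj.symm, by rw [segment_symm]; exact h.2⟩

theorem exists_end {p q : GraphSpace G} {u v b : V} (hp : G.OnEdge p.coord u v)
    (hq : G.OnEdge q.coord u v) (hb : q.coord b ≠ 0) :
    ∃ a, p.coord a ≠ 0 ∧ ENNReal.ofReal (1 - p.coord a) + (G.edist a b : ℝ≥0∞) ≤
      ENNReal.ofReal |p.coord u - q.coord u| + ENNReal.ofReal (1 - q.coord b) := by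
  have dp := onEdge_data hp
  have dq := onEdge_data hq
  have hq1 := q.coord_mem b
  have hbuv : b = u ∨ b = v := by grind
  by_cases h : p.coord b = 0
  · have huv : u ≠ v := by grind
    have hadj := (dp.2.2.2.1 huv).2
    have hs : ∀ a, p.coord a = 1 → G.Adj a b → |p.coord u - q.coord u| = q.coord b →
        ∃ a, p.coord a ≠ 0 ∧ ENNReal.ofReal (1 - p.coord a) + (G.edist a b : ℝ≥0∞) ≤
      ENNReal.ofReal |p.coord u - q.coord u| + ENNReal.ofReal (1 - q.coord b) := by
      intro a ha hab hd
      refine ⟨a, by simp [ha], ?_⟩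
      rw [hd, ← ENNReal.ofReal_add hq1.1 (by linarith), ha]
      simpa using toENNReal_edist_le_one hab
    rcases hbuv with rfl | rfl
    · refine hs v (by grind) hadj.symm ?_
      rw [h, zero_sub, abs_neg, abs_of_nonneg hq1.1]
    · refine hs u (by grind) hadj ?_
      have h1 : p.coord u = 1 := by grind
      have h2 : q.coord b = 1 - q.coord u := by grind
      rw [h1, h2, abs_of_nonneg (by linarith)]
  · refine ⟨b, h, ?_⟩
    rw [← ENNReal.ofReal_add (abs_nonneg _) (by linarith)]
    simp only [SimpleGraph.edist_self, ENat.toENNReal_zero, add_zero]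
    apply ENNReal.ofReal_le_ofReal
    have : |p.coord u - q.coord u| = |p.coord b - q.coord b| := by
      rcases hbuv with rfl | rfl
      · rfl
      · by_cases huv : u = b
        · rw [huv]
        · rw [← abs_neg]
          congr 1
          grind
    rw [this]
    have := neg_abs_le (p.coord b - q.coord b)
    linarith

theorem edist_triangle' (p q r : GraphSpace G) : edist p r ≤ edist p q + edist q r := by
  have hLN : ∀ p q r : GraphSpace G, ∀ u v, G.OnEdge p.coord u v → G.OnEdge q.coord u v →
      ∀ b c, q.coord b ≠ 0 → r.coord c ≠ 0 → edist p r ≤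
        ENNReal.ofReal |p.coord u - q.coord u| + (ENNReal.ofReal (1 - q.coord b) +
          (G.edist b c : ℝ≥0∞) + ENNReal.ofReal (1 - r.coord c)) := by
    intro p q r u v hp hq b c hb hc
    obtain ⟨a, ha, hab⟩ := exists_end hp hq hb
    calc edist p r ≤ _ := edist_le_vertex ha hc
      _ ≤ ENNReal.ofReal (1 - p.coord a) + ((G.edist a b : ℝ≥0∞) + (G.edist b c : ℝ≥0∞)) +
          ENNReal.ofReal (1 - r.coord c) := by
        gcongr
        exact toENNReal_edist_triangle a b c
      _ = (ENNReal.ofReal (1 - p.coord a) + (G.edist a b : ℝ≥0∞)) + (G.edist b c : ℝ≥0∞) +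
          ENNReal.ofReal (1 - r.coord c) := by ring
      _ ≤ (ENNReal.ofReal |p.coord u - q.coord u| + ENNReal.ofReal (1 - q.coord b)) +
          (G.edist b c : ℝ≥0∞) + ENNReal.ofReal (1 - r.coord c) := by gcongr
      _ = _ := by ring
  refine le_edist_add (fun u v hp hq => ?_) (fun a b ha hb => ?_)
  · rw [add_comm]
    refine le_edist_add (fun u' v' hq' hr => ?_) (fun b c hb hc => ?_)
    · by_cases hw : ∃ w, q.coord w = 1
      · obtain ⟨w, hw⟩ := hw
        obtain ⟨c, hc, hcw⟩ := exists_end hr hq' (b := w) (by simp [hw])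
        refine (hLN p q r u v hp hq w c (by simp [hw]) hc).trans ?_
        rw [add_comm, abs_sub_comm (q.coord u')]
        gcongr
        simp only [hw, sub_self, ENNReal.ofReal_zero, zero_add, add_zero] at hcw ⊢
        rwa [SimpleGraph.edist_comm, add_comm]
      · have d1 := onEdge_data hq
        have d2 := onEdge_data hq'
        have d3 := onEdge_data hr
        have huv : (u = u' ∧ v = v') ∨ (u = v' ∧ v = u') := by grind
        have hr' : G.OnEdge r.coord u v := by
          rcases huv with ⟨rfl, rfl⟩ | ⟨rfl, rfl⟩
          · exact hr
          · exact onEdge_symm hr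
        have he : |q.coord u' - r.coord u'| = |q.coord u - r.coord u| := by
          rcases huv with ⟨rfl, rfl⟩ | ⟨rfl, rfl⟩
          · rfl
          · have huv : u ≠ v := by grind
            rw [← abs_neg]
            congr 1
            grind
        refine (edist_le_local hp hr').trans ?_
        rw [he, ← ENNReal.ofReal_add (abs_nonneg _) (abs_nonneg _), add_comm]
        exact ENNReal.ofReal_le_ofReal (abs_sub_le _ _ _)
    · rw [add_comm]
      exact hLN p q r u v hp hq b c hb hc
  · rw [add_comm]
    refine le_edist_add (fun u v hq hr => ?_) (fun b' c hb' hc => ?_)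
    · rw [edist_comm' p r, abs_sub_comm]
      refine (hLN r q p u v hr hq b a hb ha).trans (le_of_eq ?_)
      rw [SimpleGraph.edist_comm]
      ring
    · have hq := q.coord_mem b
      have hq' := q.coord_mem b'
      have hbb : (G.edist b b' : ℝ≥0∞) ≤
          ENNReal.ofReal (1 - q.coord b) + ENNReal.ofReal (1 - q.coord b') := by
        by_cases h : b = b'
        · simp [h]
        · obtain ⟨u, v, huv⟩ := q.exists_onEdge
          have d := onEdge_data huv
          have hadj : G.Adj b b' ∧ q.coord b + q.coord b' = 1 := by
            have h3 : (b = u ∧ b' = v) ∨ (b = v ∧ b' = u) := by grind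
            rcases h3 with ⟨rfl, rfl⟩ | ⟨rfl, rfl⟩
            · exact ⟨(d.2.2.2.1 h).2, (d.2.2.2.1 h).1⟩
            · have := d.2.2.2.1 (Ne.symm h)
              exact ⟨this.2.symm, by linarith⟩
          rw [← ENNReal.ofReal_add (by linarith) (by linarith)]
          refine (toENNReal_edist_le_one hadj.1).trans ?_
          rw [ENNReal.one_le_ofReal]
          linarith
      calc edist p r ≤ _ := edist_le_vertex ha hc
        _ ≤ ENNReal.ofReal (1 - p.coord a) + ((G.edist a b : ℝ≥0∞) +
            ((ENNReal.ofReal (1 - q.coord b) + ENNReal.ofReal (1 - q.coord b')) +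
              (G.edist b' c : ℝ≥0∞))) + ENNReal.ofReal (1 - r.coord c) := by
          gcongr
          refine (toENNReal_edist_triangle a b c).trans ?_
          gcongr
          refine (toENNReal_edist_triangle b b' c).trans ?_
          gcongr
        _ = _ := by ring

theorem edist_self' (p : GraphSpace G) : edist p p = 0 := by
  obtain ⟨u, v, h⟩ := p.exists_onEdge
  simpa using edist_le_local h h

theorem eq_of_edist_eq_zero' {p q : GraphSpace G} (h : edist p q = 0) : p = q := by
  by_contra hne
  obtain ⟨u, v, hp⟩ := p.exists_onEdge
  obtain ⟨u', v', hq⟩ := q.exists_onEdge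
  have dp := onEdge_data hp
  have dq := onEdge_data hq
  -- a positive lower bound for all the terms of the two infima
  set S : Finset ℝ := {|p.coord u - q.coord u|, |p.coord v - q.coord v|,
    |p.coord u' - q.coord u'|, |p.coord v' - q.coord v'|, 1 - p.coord u, 1 - p.coord v,
    1 - q.coord u', 1 - q.coord v', 1} with hS
  obtain ⟨m, hm0, hm⟩ : ∃ m : ℝ, 0 < m ∧ ∀ x ∈ S, 0 < x → m ≤ x := by
    have hne : (S.filter (0 < ·)).Nonempty := ⟨1, by simp [hS]⟩
    refine ⟨(S.filter (0 < ·)).min' hne, (Finset.mem_filter.1 (Finset.min'_mem _ hne)).2, ?_⟩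
    intro x hx hx0
    exact Finset.min'_le _ _ (Finset.mem_filter.2 ⟨hx, hx0⟩)
  have key : ENNReal.ofReal m ≤ edist p q + 0 := by
    refine le_edist_add (fun a b ha hb => ?_) (fun a b ha hb => ?_)
    · have da := onEdge_data ha
      have db := onEdge_data hb
      rw [add_zero]
      apply ENNReal.ofReal_le_ofReal
      have hpos : p.coord a ≠ q.coord a := by
        intro heq
        apply hne
        ext w
        by_cases w = a <;> by_cases w = b <;> grind
      refine hm _ ?_ (abs_pos.2 (sub_ne_zero.2 hpos))
      have : a = u ∨ a = v ∨ a = u' ∨ a = v' := by grind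
      rcases this with rfl | rfl | rfl | rfl <;> simp [hS]
    · rw [add_zero]
      by_cases hab : a = b
      · subst hab
        have hpa := p.coord_mem a
        have hqa := q.coord_mem a
        by_cases h1 : p.coord a = 1
        · have h2 : q.coord a ≠ 1 := fun h2 => hne (eq_of_coord_eq_one h1 h2)
          refine le_trans (ENNReal.ofReal_le_ofReal ?_) le_add_self
          refine hm _ ?_ (sub_pos.2 (lt_of_le_of_ne hqa.2 h2))
          have : a = u' ∨ a = v' := by grind
          rcases this with rfl | rfl <;> simp [hS]
        · rw [add_assoc]
          refine le_trans (ENNReal.ofReal_le_ofReal ?_) le_self_add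
          refine hm _ ?_ (sub_pos.2 (lt_of_le_of_ne hpa.2 h1))
          have : a = u ∨ a = v := by grind
          rcases this with rfl | rfl <;> simp [hS]
      · have h1 : (1 : ℝ≥0∞) ≤ (G.edist a b : ℝ≥0∞) := by
          have : 1 ≤ G.edist a b := by
            rw [Order.one_le_iff_ne_zero]
            simpa [SimpleGraph.edist_eq_zero_iff] using hab
          simpa using ENat.toENNReal_le.2 this
        have h2 : ENNReal.ofReal m ≤ 1 := by
          simpa using hm 1 (by simp [hS]) one_pos
        exact (h2.trans h1).trans (le_add_self.trans le_self_add)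
  rw [h, add_zero, nonpos_iff_eq_zero, ENNReal.ofReal_eq_zero] at key
  linarith

/-- The graph `G`, with edges of length one, as an extended metric space. -/
noncomputable instance : EMetricSpace (GraphSpace G) where
  edist_self := edist_self'
  edist_comm := edist_comm'
  edist_triangle := edist_triangle'
  eq_of_edist_eq_zero := eq_of_edist_eq_zero'

end GraphSpace

/-!
Let `H` be the complete graph on twenty vertices and `n = 13 * q ^ 2`. The graph `G_q` is a gadget
attached to a frame, which is `H` without three disjoint edges: the leaves of a complete binary tree
of height `n` form a top row of `2 ^ n` vertices, above a bottom row of the same size. Long edges,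
subdivided `4 * n` times, join consecutive columns, except from leaf to leaf; they also make up the
frame, and attach the ends of the rows to two of the three pairs of frame vertices whose edge is
missing, and the root to the third.

In a 3-fat model of `H` in the gadget, small separators force the twenty branch sets to contain one
frame vertex each. The missing edges must then be realised by two strands along the rows and a
connection through the root, at distance at least three from each other. The strands avoid the root,
so there is a gap between consecutive columns which neither of them bypasses in the tree. They
cannot both cross it at the bottom, so its ends include leaves of different strands; at a lowest
such gap, bypasses of the smaller gaps force the strands up the tree to a pair of siblings, which
are at distance only two.

For the other property, draw the gadget in a length space `X` by a `q`-quasi-isometry, so that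
vertices at distance at least `n` have images far apart. The leaves are at small distance from each
other because of the tree, so that two strands must not both use drawings of leaves that are close
in `X`. Join the drawings of neighbourhoods of consecutive leaves into runs, bridging distances less
than `ε = 2⁻ⁿ`, with as few cuts between runs as possible. Then different runs are at distance at
least `ε`, and a run stays within `2 ^ n * ε = 1` of what it joins. Two strands that swap their rows
at each cut, and use the run of a column in place of its leaf, form a `2⁻ⁿ`-fat model of `H` in `X`
together with the connection through the root.
-/

/-! ### Lengths of paths -/

section PathLength

variable {X : Type*} [EMetricSpace X] {x y z : X} {A B : Set X} {c : ℝ≥0∞}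

theorem edist_apply_le_pathLength (γ : Path x y) (s t : unitInterval) :
    edist (γ s) (γ t) ≤ pathLength γ :=
  eVariationOn.edist_le γ (Set.mem_univ s) (Set.mem_univ t)

theorem edist_le_pathLength (γ : Path x y) : edist x y ≤ pathLength γ := by
  simpa using edist_apply_le_pathLength γ 0 1

theorem eVariationOn_le_pathLength_of_eqOn_comp (γ : Path x y) {f : unitInterval → X}
    {φ : unitInterval → unitInterval} {s : Set unitInterval} (hf : Set.EqOn f (γ ∘ φ) s)
    (hφ : Monotone φ) : eVariationOn f s ≤ pathLength γ := by
  rw [eVariationOn.congr hf]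
  exact eVariationOn.comp_le_of_monotoneOn _ _ (hφ.monotoneOn s) fun _ _ => Set.mem_univ _

theorem pathLength_trans_le (γ : Path x y) (δ : Path y z) :
    pathLength (γ.trans δ) ≤ pathLength γ + pathLength δ := by
  let c : unitInterval := ⟨1 / 2, by norm_num, by norm_num⟩
  have hγ : eVariationOn (γ.trans δ) (Set.Iic c) ≤ pathLength γ := by
    refine eVariationOn_le_pathLength_of_eqOn_comp γ
      (φ := fun t => Set.projIcc 0 1 zero_le_one (2 * (t : ℝ))) (fun t ht => if_pos ht)
      fun s t hst => Set.monotone_projIcc _ ?_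
    gcongr
  have hδ : eVariationOn (γ.trans δ) (Set.Ici c) ≤ pathLength δ := by
    refine eVariationOn_le_pathLength_of_eqOn_comp δ
      (φ := fun t => Set.projIcc 0 1 zero_le_one (2 * (t : ℝ) - 1)) (fun t ht => ?_)
      fun s t hst => Set.monotone_projIcc _ ?_
    · rcases eq_or_lt_of_le (show (1 / 2 : ℝ) ≤ t from ht) with h | h
      · obtain rfl : c = t := Subtype.ext h
        simp [Path.trans_apply, c]
      · exact if_neg h.not_ge
    · gcongr
  calc pathLength (γ.trans δ)
      = eVariationOn (γ.trans δ) (Set.Iic c) + eVariationOn (γ.trans δ) (Set.Ici c) := by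
        rw [pathLength, ← Set.Iic_union_Ici (a := c)]
        exact eVariationOn.union _ isGreatest_Iic isLeast_Ici
    _ ≤ _ := add_le_add hγ hδ

theorem pathLength_le_of_lipschitzWith {γ : Path x y} {K : NNReal} (h : LipschitzWith K γ) :
    pathLength γ ≤ K := by
  have hone : eVariationOn (id : unitInterval → unitInterval) Set.univ ≤ 1 := by
    have hmono : MonotoneOn ((↑) : unitInterval → ℝ) Set.univ := fun _ _ _ _ h => h
    have := hmono.eVariationOn_eq (Set.mem_univ 0) (Set.mem_univ 1)
    rw [Set.univ_inter, show Set.Icc (0 : unitInterval) 1 = Set.univ from Set.Icc_bot_top] at this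
    exact this.le.trans (by simp)
  calc pathLength γ ≤ K * eVariationOn id Set.univ :=
        h.lipschitzOnWith.comp_eVariationOn_le (g := id) (Set.mapsTo_univ _ _)
    _ ≤ K * 1 := by gcongr
    _ = K := mul_one _

theorem pathLength_symm (γ : Path x y) : pathLength γ.symm = pathLength γ := by
  have h : ∀ {x y : X} (γ : Path x y), pathLength γ.symm ≤ pathLength γ := fun γ =>
    eVariationOn.comp_le_of_antitoneOn _ unitInterval.symm
      (fun _ _ _ _ h => unitInterval.symm_le_symm.2 h) fun _ _ => Set.mem_univ _
  exact (h γ).antisymm (by simpa using h γ.symm)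

theorem setDist_le_pathLength (hx : x ∈ A) (hy : y ∈ B) (γ : Path x y) :
    setDist A B ≤ pathLength γ :=
  iInf₂_le_of_le x hx (iInf₂_le_of_le y hy (iInf_le _ γ))

theorem le_setDist (h : ∀ x ∈ A, ∀ y ∈ B, c ≤ edist x y) : c ≤ setDist A B :=
  le_iInf₂ fun x hx => le_iInf₂ fun y hy => le_iInf fun γ =>
    (h x hx y hy).trans (edist_le_pathLength γ)

theorem exists_path_of_setDist_lt (h : setDist A B < c) :
    ∃ x ∈ A, ∃ y ∈ B, ∃ γ : Path x y, pathLength γ < c := by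
  simpa [setDist, iInf_lt_iff] using h

theorem setDist_comm (A B : Set X) : setDist A B = setDist B A := by
  have h : ∀ A B : Set X, setDist A B ≤ setDist B A := fun A B =>
    le_iInf₂ fun x hx => le_iInf₂ fun y hy => le_iInf fun γ =>
      (setDist_le_pathLength hy hx γ.symm).trans_eq (pathLength_symm γ)
  exact (h A B).antisymm (h B A)

theorem setDist_union_left (A A' B : Set X) :
    setDist (A ∪ A') B = min (setDist A B) (setDist A' B) :=
  iInf_union

theorem setDist_union_right (A B B' : Set X) :
    setDist A (B ∪ B') = min (setDist A B) (setDist A B') := by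
  simp only [setDist_comm A, setDist_union_left]

end PathLength

/-! ### Points of a graph -/

namespace GraphSpace

variable {V : Type*} {G : SimpleGraph V} {a b c u v : V} {p q : GraphSpace G}

section Coordinates

variable (p)

theorem exists_coord_ne_zero : ∃ a, p.coord a ≠ 0 := by
  obtain ⟨u, v, h⟩ := p.exists_onEdge
  grind +splitImp [onEdge_data h]

theorem adj_of_coord_ne_zero (hab : a ≠ b) (ha : p.coord a ≠ 0) (hb : p.coord b ≠ 0) :
    G.Adj a b := by
  obtain ⟨u, v, h⟩ := p.exists_onEdge
  grind +splitImp [onEdge_data h, G.adj_comm u v]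

theorem coord_add_coord_le (hab : a ≠ b) : p.coord a + p.coord b ≤ 1 := by
  obtain ⟨u, v, h⟩ := p.exists_onEdge
  grind +splitImp [onEdge_data h]

theorem eq_or_eq_of_coord_ne_zero (hab : a ≠ b) (ha : p.coord a ≠ 0) (hb : p.coord b ≠ 0)
    (hc : p.coord c ≠ 0) : c = a ∨ c = b := by
  obtain ⟨u, v, h⟩ := p.exists_onEdge
  grind +splitImp [onEdge_data h]

theorem exists_onEdge_of_coord_ne_zero (ha : p.coord a ≠ 0) : ∃ b, G.OnEdge p.coord a b := by
  obtain ⟨u, v, h⟩ := p.exists_onEdge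
  have : a = u ∨ a = v := by grind +splitImp [onEdge_data h]
  rcases this with rfl | rfl
  · exact ⟨v, h⟩
  · exact ⟨u, onEdge_symm h⟩

end Coordinates

theorem abs_coord_sub_le_of_onEdge (hp : G.OnEdge p.coord u v) (hq : G.OnEdge q.coord u v)
    (a : V) : |p.coord a - q.coord a| ≤ |p.coord u - q.coord u| := by
  grind +splitImp [onEdge_data hp, onEdge_data hq]

theorem abs_coord_sub_le (a b : V) :
    |p.coord a - q.coord a| ≤ (1 - p.coord b) + (1 - q.coord b) := by
  rw [abs_le]
  rcases eq_or_ne a b with rfl | hab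
  · constructor <;> linarith [(p.coord_mem a).2, (q.coord_mem a).2]
  · constructor <;> linarith [(p.coord_mem a).1, (q.coord_mem a).1,
      (p.coord_mem b).2, (q.coord_mem b).2, p.coord_add_coord_le hab, q.coord_add_coord_le hab]

theorem one_le_toENNReal_edist (h : a ≠ b) : (1 : ℝ≥0∞) ≤ G.edist a b := by
  have : 1 ≤ G.edist a b :=
    Order.one_le_iff_ne_zero.2 fun h' => h (SimpleGraph.edist_eq_zero_iff.1 h')
  simpa using ENat.toENNReal_le.2 this

theorem ofReal_abs_coord_sub_le_edist (p q : GraphSpace G) (a : V) :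
    ENNReal.ofReal |p.coord a - q.coord a| ≤ edist p q := by
  rw [← add_zero (edist p q)]
  refine le_edist_add (fun u v hp hq => ?_) (fun b c _ _ => ?_) <;> rw [add_zero]
  · exact ENNReal.ofReal_le_ofReal (abs_coord_sub_le_of_onEdge hp hq a)
  · by_cases hbc : b = c
    · subst hbc
      simp only [SimpleGraph.edist_self, ENat.toENNReal_zero, add_zero]
      rw [← ENNReal.ofReal_add (sub_nonneg.2 (p.coord_mem b).2) (sub_nonneg.2 (q.coord_mem b).2)]
      exact ENNReal.ofReal_le_ofReal (abs_coord_sub_le a b)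
    · have habs : |p.coord a - q.coord a| ≤ 1 := by grind [p.coord_mem a, q.coord_mem a]
      calc ENNReal.ofReal |p.coord a - q.coord a| ≤ 1 := ENNReal.ofReal_le_one.2 habs
        _ ≤ (G.edist b c : ℝ≥0∞) := one_le_toENNReal_edist hbc
        _ ≤ _ := le_add_self.trans le_self_add

theorem continuous_coord (a : V) : Continuous fun p : GraphSpace G => p.coord a := by
  have : LipschitzWith 1 fun p : GraphSpace G => p.coord a := fun p q => by
    simpa [edist_dist, Real.dist_eq] using ofReal_abs_coord_sub_le_edist p q a
  exact this.continuous

/-- The vertex `a` as a point of the graph. -/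
noncomputable def vert (G : SimpleGraph V) (a : V) : GraphSpace G :=
  ⟨Set.indicator {a} fun _ => 1, a, a, Or.inl rfl, left_mem_segment _ _ _⟩

@[simp] theorem vert_coord_self : (vert G a).coord a = 1 := by simp [vert]

theorem vert_coord_of_ne (h : b ≠ a) : (vert G a).coord b = 0 := by
  simp [vert, h]

theorem vert_coord_ne_zero : (vert G a).coord b ≠ 0 ↔ b = a := by
  simp [vert]

theorem onEdge_vert_left (h : a = b ∨ G.Adj a b) : G.OnEdge (vert G a).coord a b :=
  ⟨h, left_mem_segment _ _ _⟩

theorem onEdge_vert_right (h : a = b ∨ G.Adj a b) : G.OnEdge (vert G b).coord a b :=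
  ⟨h, right_mem_segment _ _ _⟩

theorem exists_coord_ne_zero_of_ne_vert (hp : p ≠ vert G a) : ∃ b, b ≠ a ∧ p.coord b ≠ 0 := by
  contrapose! hp
  obtain ⟨u, v, h⟩ := p.exists_onEdge
  have ha : p.coord a = 1 := by grind +splitImp [onEdge_data h]
  exact eq_of_coord_eq_one ha vert_coord_self

theorem edist_le_edist_vert (a b : V) : (G.edist a b : ℝ≥0∞) ≤ edist (vert G a) (vert G b) := by
  rw [← add_zero (edist (vert G a) (vert G b))]
  refine le_edist_add (fun u v hu hv => ?_) (fun x y hx hy => ?_)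
  · by_cases hab : a = b
    · simp [hab]
    have ha : (vert G a).coord a = 1 := vert_coord_self
    have hb : (vert G b).coord b = 1 := vert_coord_self
    have hadj : G.Adj a b := by
      grind +splitImp [onEdge_data hu, onEdge_data hv, G.adj_comm a b]
    have hle := abs_coord_sub_le_of_onEdge hu hv a
    rw [vert_coord_self, vert_coord_of_ne hab, sub_zero, abs_one] at hle
    rw [add_zero]
    exact (toENNReal_edist_le_one hadj).trans (ENNReal.one_le_ofReal.2 hle)
  · obtain rfl := vert_coord_ne_zero.1 hx
    obtain rfl := vert_coord_ne_zero.1 hy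
    simp

theorem edist_vert_le_one (h : G.Adj a b) : edist (vert G a) (vert G b) ≤ 1 := by
  refine (edist_le_local (onEdge_vert_left (Or.inr h)) (onEdge_vert_right (Or.inr h))).trans ?_
  simp [vert_coord_of_ne h.ne]

theorem exists_path_of_onEdge (hp : G.OnEdge p.coord u v) (hq : G.OnEdge q.coord u v) :
    ∃ γ : Path p q, pathLength γ ≤ 1 := by
  have hmem : ∀ t : unitInterval,
      G.OnEdge ((1 - (t : ℝ)) • p.coord + (t : ℝ) • q.coord) u v := fun t =>
    ⟨hp.1, convex_segment _ _ hp.2 hq.2 (sub_nonneg.2 t.2.2) t.2.1 (sub_add_cancel _ _)⟩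
  let f : unitInterval → GraphSpace G := fun t => ⟨_, u, v, hmem t⟩
  have hf : LipschitzWith 1 f := by
    intro s t
    refine (edist_le_local (hmem s) (hmem t)).trans ?_
    rw [ENNReal.coe_one, one_mul, Subtype.edist_eq, edist_dist, Real.dist_eq]
    refine ENNReal.ofReal_le_ofReal ?_
    calc |(f s).coord u - (f t).coord u|
        = |(s - t : ℝ) * (q.coord u - p.coord u)| := by
          congr 1
          simp only [f, Pi.add_apply, Pi.smul_apply, smul_eq_mul]
          ring
      _ = |(s - t : ℝ)| * |q.coord u - p.coord u| := abs_mul _ _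
      _ ≤ |(s - t : ℝ)| := mul_le_of_le_one_right (abs_nonneg _) (by
          grind [p.coord_mem u, q.coord_mem u])
  refine ⟨⟨⟨f, hf.continuous⟩, ?_, ?_⟩, pathLength_le_of_lipschitzWith hf⟩ <;> ext <;> simp [f]

theorem setDist_le_two {S S' : Set (GraphSpace G)} {z : GraphSpace G} (hp : p ∈ S) (hq : q ∈ S')
    (hpa : G.OnEdge p.coord a b) (hza : G.OnEdge z.coord a b) (hzu : G.OnEdge z.coord u v)
    (hqu : G.OnEdge q.coord u v) : setDist S S' ≤ 2 := by
  obtain ⟨γ, hγ⟩ := exists_path_of_onEdge hpa hza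
  obtain ⟨δ, hδ⟩ := exists_path_of_onEdge hzu hqu
  calc setDist S S' ≤ pathLength (γ.trans δ) := setDist_le_pathLength hp hq _
    _ ≤ pathLength γ + pathLength δ := pathLength_trans_le γ δ
    _ ≤ 1 + 1 := add_le_add hγ hδ
    _ = 2 := one_add_one_eq_two

end GraphSpace

/-! ### Vertices touched by a set of points -/

section Encloses

variable {V : Type*} {G : SimpleGraph V} {F C M : Set V}

theorem preconnected_induce_iff : (G.induce M).Preconnected ↔
    ∀ L : Set V, (∀ x ∈ M, ∀ y ∈ M, x ∈ L → G.Adj x y → y ∈ L) →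
      ∀ x ∈ M, x ∈ L → ∀ y ∈ M, y ∈ L := by
  constructor
  · intro hM L hL x hx hxL y hy
    obtain ⟨p⟩ := hM ⟨x, hx⟩ ⟨y, hy⟩
    have key : ∀ {u v : M}, (G.induce M).Walk u v → (u : V) ∈ L → (v : V) ∈ L := by
      intro u v p
      induction p with
      | nil => exact id
      | cons h _ ih => exact fun hu => ih (hL _ (Subtype.prop _) _ (Subtype.prop _) hu h)
    exact key p hxL
  · intro h x y
    obtain ⟨_, hy⟩ := h {v | ∃ hv : v ∈ M, (G.induce M).Reachable x ⟨v, hv⟩}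
      (fun u _ v hv ⟨hu, hxu⟩ huv =>
        ⟨hv, hxu.trans (SimpleGraph.Adj.reachable (G := G.induce M) huv)⟩)
      x x.2 ⟨x.2, .refl _⟩ y y.2
    exact hy

/-- The set `F` of vertices encloses `C`: every edge leaving `C` ends in `F`. This is how a
separation of the graph is encoded, and `F` need not be disjoint from `C`. -/
def Encloses (G : SimpleGraph V) (F C : Set V) : Prop :=
  ∀ x ∈ C, ∀ y, G.Adj x y → y ∈ C ∪ F

theorem Encloses.subset_of_preconnected (h : Encloses G F C) (hM : (G.induce M).Preconnected)
    (hMF : Disjoint M F) (hMC : (M ∩ C).Nonempty) : M ⊆ C := by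
  obtain ⟨x, hx, hxC⟩ := hMC
  refine preconnected_induce_iff.1 hM C (fun u _ v hv huC huv => ?_) x hx hxC
  exact (h u huC v huv).resolve_right (Set.disjoint_left.1 hMF hv)

end Encloses

namespace GraphSpace

variable {V : Type*} {G : SimpleGraph V} {S S' : Set (GraphSpace G)} {a b c x y : V}

/-- The vertices touched by a set of points: those whose open star it meets. -/
def touched (S : Set (GraphSpace G)) : Set V := {a | ∃ p ∈ S, p.coord a ≠ 0}

/-- The vertices contained in a set of points. -/
def verts (S : Set (GraphSpace G)) : Set V := {a | vert G a ∈ S}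

theorem verts_subset_touched (S : Set (GraphSpace G)) : verts S ⊆ touched S :=
  fun _ ha => ⟨_, ha, vert_coord_ne_zero.2 rfl⟩

theorem touched_nonempty (h : S.Nonempty) : (touched S).Nonempty := by
  obtain ⟨p, hp⟩ := h
  obtain ⟨a, ha⟩ := p.exists_coord_ne_zero
  exact ⟨a, p, hp, ha⟩

theorem touched_mono (h : S ⊆ S') : touched S ⊆ touched S' :=
  fun _ ⟨p, hp, ha⟩ => ⟨p, h hp, ha⟩

theorem touched_union (S S' : Set (GraphSpace G)) :
    touched (S ∪ S') = touched S ∪ touched S' := by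
  ext a
  simp only [touched, Set.mem_union, Set.mem_ofPred_eq, or_and_right, exists_or]

theorem touched_inter_nonempty (h : (S ∩ S').Nonempty) : (touched S ∩ touched S').Nonempty :=
  (touched_nonempty h).mono
    (Set.subset_inter (touched_mono Set.inter_subset_left) (touched_mono Set.inter_subset_right))

theorem disjoint_touched (h : 3 ≤ setDist S S') : Disjoint (touched S) (touched S') := by
  rw [Set.disjoint_left]
  rintro a ⟨p, hp, hpa⟩ ⟨q, hq, hqa⟩
  obtain ⟨b, hb⟩ := p.exists_onEdge_of_coord_ne_zero hpa
  obtain ⟨c, hc⟩ := q.exists_onEdge_of_coord_ne_zero hqa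
  have h₂ := setDist_le_two hp hq hb (onEdge_vert_left hb.1) (onEdge_vert_left hc.1) hc
  exact absurd (h.trans h₂) (by norm_num)

theorem notMem_verts_of_adj_of_adj (h : 3 ≤ setDist S S') (hab : G.Adj a b) (hbc : G.Adj b c)
    (ha : a ∈ verts S) : c ∉ verts S' := by
  intro hc
  have h₂ := setDist_le_two ha hc (onEdge_vert_left (Or.inr hab)) (onEdge_vert_right (Or.inr hab))
    (onEdge_vert_left (Or.inr hbc)) (onEdge_vert_right (Or.inr hbc))
  exact absurd (h.trans h₂) (by norm_num)

theorem isOpen_setOf_exists_mem_coord_ne_zero (A : Set V) :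
    IsOpen {p : GraphSpace G | ∃ a ∈ A, p.coord a ≠ 0} := by
  have : {p : GraphSpace G | ∃ a ∈ A, p.coord a ≠ 0} = ⋃ a ∈ A, {p | p.coord a ≠ 0} := by
    ext
    simp
  rw [this]
  exact isOpen_biUnion fun a _ => isOpen_ne_fun (continuous_coord a) continuous_const

theorem isOpen_setOf_exists_two_mem_coord_ne_zero (A : Set V) :
    IsOpen {p : GraphSpace G | ∃ a ∈ A, p.coord a ≠ 0 ∧ ∃ b ∈ A \ {a}, p.coord b ≠ 0} := by
  have : {p : GraphSpace G | ∃ a ∈ A, p.coord a ≠ 0 ∧ ∃ b ∈ A \ {a}, p.coord b ≠ 0} =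
      ⋃ a ∈ A, {p | p.coord a ≠ 0} ∩ {p | ∃ b ∈ A \ {a}, p.coord b ≠ 0} := by
    ext
    simp [and_left_comm]
  rw [this]
  exact isOpen_biUnion fun a _ => (isOpen_ne_fun (continuous_coord a) continuous_const).inter
    (isOpen_setOf_exists_mem_coord_ne_zero _)

-- The open stars of the vertices in `T ∩ L`, those of the vertices in `T \ L` and the open edges
-- with both ends outside `T` cover `S`; the first family meets none of the others within `S`.
theorem mem_of_isPreconnected_of_verts_subset (hS : IsPreconnected S) {T L : Set V}
    (hT : verts S ⊆ T)
    (hL : ∀ x ∈ touched S ∩ T, ∀ y ∈ touched S ∩ T, x ∈ L → G.Adj x y → y ∈ L)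
    (hx : x ∈ touched S ∩ T) (hxL : x ∈ L) (hy : y ∈ touched S ∩ T) : y ∈ L := by
  by_contra hyL
  obtain ⟨⟨p, hp, hpx⟩, hxT⟩ := hx
  obtain ⟨⟨q, hq, hqy⟩, hyT⟩ := hy
  have hcover : ∀ z ∈ S, (∃ a ∈ T, z.coord a ≠ 0) ∨
      ∃ a ∈ Tᶜ, z.coord a ≠ 0 ∧ ∃ b ∈ Tᶜ \ {a}, z.coord b ≠ 0 := by
    intro z hz
    by_contra! hcon
    obtain ⟨a, ha⟩ := z.exists_coord_ne_zero
    have haT : a ∉ T := fun h => ha (hcon.1 a h)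
    obtain ⟨b, hba, hb⟩ := exists_coord_ne_zero_of_ne_vert (a := a) (p := z)
      (by rintro rfl; exact haT (hT hz))
    exact hb (hcon.2 a haT ha b ⟨fun h => hb (hcon.1 b h), hba⟩)
  obtain ⟨z, hz, ⟨a, ⟨haT, haL⟩, hza⟩, ⟨b, ⟨hbT, hbL⟩, hzb⟩ | ⟨b, hbT, hzb, c, ⟨hcT, hcb⟩, hzc⟩⟩ :=
    hS _ _ (isOpen_setOf_exists_mem_coord_ne_zero (T ∩ L))
      ((isOpen_setOf_exists_mem_coord_ne_zero (T \ L)).union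
        (isOpen_setOf_exists_two_mem_coord_ne_zero Tᶜ))
      (fun z hz => (hcover z hz).elim
        (fun ⟨a, haT, ha⟩ => (em (a ∈ L)).imp (fun h => ⟨a, ⟨haT, h⟩, ha⟩)
          fun h => Or.inl ⟨a, ⟨haT, h⟩, ha⟩)
        fun h => Or.inr (Or.inr h))
      ⟨p, hp, x, ⟨hxT, hxL⟩, hpx⟩ ⟨q, hq, Or.inl ⟨y, ⟨hyT, hyL⟩, hqy⟩⟩
  · have hab : a ≠ b := by rintro rfl; exact hbL haL
    exact hbL (hL a ⟨⟨z, hz, hza⟩, haT⟩ b ⟨⟨z, hz, hzb⟩, hbT⟩ haL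
      (z.adj_of_coord_ne_zero hab hza hzb))
  · rcases z.eq_or_eq_of_coord_ne_zero (Ne.symm hcb) hzb hzc hza with rfl | rfl
    · exact hbT haT
    · exact hcT haT

theorem preconnected_induce_touched (hS : IsPreconnected S) :
    (G.induce (touched S)).Preconnected := by
  rw [preconnected_induce_iff]
  intro L hL x hx hxL y hy
  exact mem_of_isPreconnected_of_verts_subset hS (Set.subset_univ _)
    (by simpa only [Set.inter_univ] using hL) ⟨hx, trivial⟩ hxL ⟨hy, trivial⟩

theorem preconnected_induce_verts (hS : IsPreconnected S) : (G.induce (verts S)).Preconnected := by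
  rw [preconnected_induce_iff]
  intro L hL x hx hxL y hy
  exact mem_of_isPreconnected_of_verts_subset hS subset_rfl
    (fun x hx y hy => hL x hx.2 y hy.2) ⟨verts_subset_touched S hx, hx⟩ hxL
    ⟨verts_subset_touched S hy, hy⟩

theorem exists_mem_verts_of_encloses (hS : IsPreconnected S) {D F : Set V}
    (hDF : Encloses G F D) (hx : x ∈ touched S) (hxD : x ∈ D \ F) (hy : y ∈ touched S)
    (hyD : y ∉ D ∪ F) : ∃ a ∈ F, a ∈ verts S := by
  by_contra! hF
  refine hyD (Or.inl (mem_of_isPreconnected_of_verts_subset hS (T := Fᶜ) (L := D)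
    (fun a ha haF => hF a haF ha) ?_ ⟨hx, hxD.2⟩ hxD.1 ⟨hy, fun h => hyD (Or.inr h)⟩))
  rintro u ⟨-, -⟩ v ⟨-, hv⟩ huD huv
  exact (hDF u huD v huv).resolve_right hv

end GraphSpace

/-! ### Graphs with long edges -/

/-- The vertices of a graph with long edges: the base vertices `B` and, for each long edge in `E`,
`m` vertices subdividing it. -/
inductive LongVertex (B E : Type*) (m : ℕ)
  | base (b : B) : LongVertex B E m
  | mid (e : E) (k : ℕ) (hk : k < m) : LongVertex B E m

/-- A graph on `B` with edges of two kinds: the pairs related by `short`, and long edges, indexed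
by `E`, each of which is subdivided by `m` further vertices in `LongGraph.graph`. -/
structure LongGraph (B E : Type*) where
  short : B → B → Prop
  src : E → B
  tgt : E → B
  m : ℕ

namespace LongGraph

open LongVertex

variable {B E : Type*} (Γ : LongGraph B E) {C F L : Set B} {M : Set (LongVertex B E Γ.m)}

/-- The oriented edges of the subdivided graph: long edges run from their source to their
target. -/
inductive Step : LongVertex B E Γ.m → LongVertex B E Γ.m → Prop
  | short {x y : B} (h : Γ.short x y) : Step (base x) (base y)
  | start (e : E) (h : 0 < Γ.m) : Step (base (Γ.src e)) (mid e 0 h)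
  | next (e : E) (k : ℕ) (h : k + 1 < Γ.m) : Step (mid e k (Nat.lt_of_succ_lt h)) (mid e (k + 1) h)
  | finish (e : E) (k : ℕ) (h : k < Γ.m) (hk : k + 1 = Γ.m) : Step (mid e k h) (base (Γ.tgt e))

/-- The subdivided graph. -/
def graph : SimpleGraph (LongVertex B E Γ.m) := SimpleGraph.fromRel Γ.Step

/-- The graph on `B` in which the long edges are not subdivided. -/
def baseGraph : SimpleGraph B :=
  SimpleGraph.fromRel fun x y => Γ.short x y ∨ ∃ e, Γ.src e = x ∧ Γ.tgt e = y

variable {Γ}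

theorem adj_of_step {x y : LongVertex B E Γ.m} (h : Γ.Step x y) (hne : x ≠ y) :
    Γ.graph.Adj x y :=
  (SimpleGraph.fromRel_adj _ _ _).2 ⟨hne, Or.inl h⟩

theorem step_or_step_of_adj {x y : LongVertex B E Γ.m} (h : Γ.graph.Adj x y) :
    Γ.Step x y ∨ Γ.Step y x :=
  ((SimpleGraph.fromRel_adj _ _ _).1 h).2

variable (Γ)

theorem adj_mid (e : E) (k : ℕ) (h : k + 1 < Γ.m) :
    Γ.graph.Adj (mid e k (Nat.lt_of_succ_lt h)) (mid e (k + 1) h) :=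
  adj_of_step (.next e k h) (by simp)

theorem adj_src (e : E) (h : 0 < Γ.m) : Γ.graph.Adj (base (Γ.src e)) (mid e 0 h) :=
  adj_of_step (.start e h) (by simp)

theorem adj_tgt (e : E) (k : ℕ) (h : k < Γ.m) (hk : k + 1 = Γ.m) :
    Γ.graph.Adj (mid e k h) (base (Γ.tgt e)) :=
  adj_of_step (.finish e k h hk) (by simp)

/-- The vertex is in `L`, or it is joined within `M` to an end in `L` of its long edge. -/
def ReachedFrom (L : Set B) (M : Set (LongVertex B E Γ.m)) : LongVertex B E Γ.m → Prop
  | base b => b ∈ L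
  | mid e k _ => (base (Γ.src e) ∈ M ∧ Γ.src e ∈ L ∧ ∀ k' h', k' ≤ k → mid e k' h' ∈ M) ∨
      (base (Γ.tgt e) ∈ M ∧ Γ.tgt e ∈ L ∧ ∀ k' h', k ≤ k' → mid e k' h' ∈ M)

variable {Γ}

theorem reachedFrom_iff_of_step
    (hs : ∀ x y, Γ.short x y → base x ∈ M → base y ∈ M → (x ∈ L ↔ y ∈ L))
    (hl : ∀ e, base (Γ.src e) ∈ M → base (Γ.tgt e) ∈ M →
      (∀ k hk, mid e k hk ∈ M) → (Γ.src e ∈ L ↔ Γ.tgt e ∈ L))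
    {u v : LongVertex B E Γ.m} (h : Γ.Step u v) (hu : u ∈ M) (hv : v ∈ M) :
    Γ.ReachedFrom L M u ↔ Γ.ReachedFrom L M v := by
  cases h with
  | short h => exact hs _ _ h hu hv
  | start e h =>
    simp only [ReachedFrom]
    grind
  | next e k h =>
    simp only [ReachedFrom]
    grind
  | finish e k h hk =>
    simp only [ReachedFrom]
    grind

theorem mem_of_preconnected_induce (hM : (Γ.graph.induce M).Preconnected)
    (hs : ∀ x y, Γ.short x y → base x ∈ M → base y ∈ M → (x ∈ L ↔ y ∈ L))
    (hl : ∀ e, base (Γ.src e) ∈ M → base (Γ.tgt e) ∈ M →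
      (∀ k hk, mid e k hk ∈ M) → (Γ.src e ∈ L ↔ Γ.tgt e ∈ L))
    {x y : B} (hx : base x ∈ M) (hxL : x ∈ L) (hy : base y ∈ M) : y ∈ L := by
  refine preconnected_induce_iff.1 hM {v | Γ.ReachedFrom L M v} (fun u hu v hv h huv => ?_)
    (base x) hx hxL (base y) hy
  rcases step_or_step_of_adj huv with hst | hst
  · exact (reachedFrom_iff_of_step hs hl hst hu hv).1 h
  · exact (reachedFrom_iff_of_step hs hl hst hv hu).2 h

variable (Γ) in
/-- The set `C` of base vertices together with the interiors of the long edges with an end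
in `C`. -/
def hull (C : Set B) : Set (LongVertex B E Γ.m) :=
  {v | match v with
    | base b => b ∈ C
    | mid e _ _ => Γ.src e ∈ C ∨ Γ.tgt e ∈ C}

theorem encloses_baseGraph
    (hs : ∀ x y, Γ.short x y → (x ∈ C → y ∈ C ∪ F) ∧ (y ∈ C → x ∈ C ∪ F))
    (hl : ∀ e, (Γ.src e ∈ C → Γ.tgt e ∈ C ∪ F) ∧ (Γ.tgt e ∈ C → Γ.src e ∈ C ∪ F)) :
    Encloses Γ.baseGraph F C := by
  intro x hx y hxy
  rcases ((SimpleGraph.fromRel_adj _ _ _).1 hxy).2 with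
    (h | ⟨e, rfl, rfl⟩) | h | ⟨e, rfl, rfl⟩
  · exact (hs x y h).1 hx
  · exact (hl e).1 hx
  · exact (hs y x h).2 hx
  · exact (hl e).2 hx

theorem _root_.Encloses.hull (h : Encloses Γ.baseGraph F C) :
    Encloses Γ.graph (base '' F) (Γ.hull C) := by
  have hb : ∀ b, b ∈ C ∪ F → (base b : LongVertex B E Γ.m) ∈ Γ.hull C ∪ base '' F := fun b hb =>
    hb.imp id fun hb => ⟨b, hb, rfl⟩
  have hadj : ∀ x y, (Γ.short x y ∨ Γ.short y x ∨
      ∃ e, (Γ.src e = x ∧ Γ.tgt e = y) ∨ (Γ.src e = y ∧ Γ.tgt e = x)) → x ∈ C → y ∈ C ∪ F := by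
    intro x y hxy hx
    by_cases hne : x = y
    · exact Or.inl (hne ▸ hx)
    · refine h x hx y ((SimpleGraph.fromRel_adj _ _ _).2 ⟨hne, ?_⟩)
      grind
  intro x hx y hxy
  rcases step_or_step_of_adj hxy with hst | hst
  · cases hst with
    | short h' => exact hb _ (hadj _ _ (Or.inl h') hx)
    | start e h' => exact Or.inl (Or.inl hx)
    | next e k h' => exact Or.inl hx
    | finish e k h' hk =>
      exact hx.elim (fun hx => hb _ (hadj _ _ (Or.inr (Or.inr ⟨e, Or.inl ⟨rfl, rfl⟩⟩)) hx)) Or.inl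
  · cases hst with
    | short h' => exact hb _ (hadj _ _ (Or.inr (Or.inl h')) hx)
    | start e h' =>
      exact hx.elim Or.inl fun hx => hb _ (hadj _ _ (Or.inr (Or.inr ⟨e, Or.inr ⟨rfl, rfl⟩⟩)) hx)
    | next e k h' => exact Or.inl hx
    | finish e k h' hk => exact Or.inl (Or.inr hx)

end LongGraph

theorem le_edist_of_le_sub {V : Type*} {G : SimpleGraph V} {f : V → ℤ}
    (hf : ∀ x y, G.Adj x y → f x - f y ≤ 1) {x y : V} {d : ℕ} (h : (d : ℤ) ≤ f x - f y) :
    (d : ℕ∞) ≤ G.edist x y := by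
  refine le_iInf fun p => ?_
  have hlen : f x - f y ≤ p.length := by
    clear h
    induction p with
    | nil => simp
    | cons hadj p ih =>
      rw [SimpleGraph.Walk.length_cons]
      push_cast
      linarith [hf _ _ hadj]
  exact_mod_cast h.trans hlen

namespace LongGraph

open LongVertex

variable {B E : Type*} (Γ : LongGraph B E) (f : B → ℤ) (hi : Set E) (c : ℤ)

open Classical in
/-- An extension of the function `f` on the base vertices to the subdivided graph which changes by
at most one along the long edges if `0 ≤ f ≤ c ≤ m`. It stays as large as possible (at most `c`) on
the edges in `hi` and as small as possible (at least `0`) on the others. -/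
noncomputable def extend : LongVertex B E Γ.m → ℤ
  | base b => f b
  | mid e k _ =>
    if e ∈ hi then min c (min (f (Γ.src e) + (k + 1)) (f (Γ.tgt e) + (Γ.m - k)))
    else max 0 (max (f (Γ.src e) - (k + 1)) (f (Γ.tgt e) - (Γ.m - k)))

variable {Γ f hi c}

@[simp] theorem extend_base (b : B) : Γ.extend f hi c (base b) = f b := rfl

theorem extend_mid_of_mem {e : E} (he : e ∈ hi) (k : ℕ) (hk : k < Γ.m) :
    Γ.extend f hi c (mid e k hk) =
      min c (min (f (Γ.src e) + (k + 1)) (f (Γ.tgt e) + (Γ.m - k))) :=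
  if_pos he

theorem extend_mid_of_notMem {e : E} (he : e ∉ hi) (k : ℕ) (hk : k < Γ.m) :
    Γ.extend f hi c (mid e k hk) =
      max 0 (max (f (Γ.src e) - (k + 1)) (f (Γ.tgt e) - (Γ.m - k))) :=
  if_neg he

theorem abs_extend_sub_le_of_step (hf : ∀ b, 0 ≤ f b ∧ f b ≤ c) (hc : c ≤ Γ.m)
    (hs : ∀ x y, Γ.short x y → |f x - f y| ≤ 1) {x y : LongVertex B E Γ.m} (h : Γ.Step x y) :
    |Γ.extend f hi c x - Γ.extend f hi c y| ≤ 1 := by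
  cases h with
  | short h => exact hs _ _ h
  | start e h =>
    by_cases he : e ∈ hi
    · rw [extend_mid_of_mem he, extend_base]
      push_cast
      grind
    · rw [extend_mid_of_notMem he, extend_base]
      push_cast
      grind
  | next e k h =>
    by_cases he : e ∈ hi
    · rw [extend_mid_of_mem he, extend_mid_of_mem he]
      push_cast
      grind
    · rw [extend_mid_of_notMem he, extend_mid_of_notMem he]
      push_cast
      grind
  | finish e k h hk =>
    have hm : (Γ.m : ℤ) = k + 1 := by exact_mod_cast hk.symm
    by_cases he : e ∈ hi
    · rw [extend_mid_of_mem he, extend_base]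
      grind
    · rw [extend_mid_of_notMem he, extend_base]
      grind

theorem le_edist_of_le_extend_sub (hf : ∀ b, 0 ≤ f b ∧ f b ≤ c) (hc : c ≤ Γ.m)
    (hs : ∀ x y, Γ.short x y → |f x - f y| ≤ 1) {x y : LongVertex B E Γ.m} {d : ℕ}
    (h : (d : ℤ) ≤ Γ.extend f hi c x - Γ.extend f hi c y) : (d : ℕ∞) ≤ Γ.graph.edist x y := by
  refine le_edist_of_le_sub (fun u v huv => ?_) h
  rcases step_or_step_of_adj huv with hst | hst
  · exact (abs_le.1 (abs_extend_sub_le_of_step hf hc hs hst)).2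
  · linarith [(abs_le.1 (abs_extend_sub_le_of_step (hi := hi) hf hc hs hst)).1]

end LongGraph

/-! ### Models of complete graphs -/

theorem card_le_card_of_pairwiseDisjoint {ι V : Type*} {A : ι → Set V} {s : Finset ι}
    {F : Finset V} (hA : (s : Set ι).PairwiseDisjoint A) (hF : ∀ i ∈ s, (A i ∩ F).Nonempty) :
    s.card ≤ F.card := by
  choose g hgA hgF using hF
  rw [← Finset.card_attach]
  refine Finset.card_le_card_of_injOn (fun i => g i i.2) (fun i _ => hgF i i.2)
    fun i _ j _ (hij : g i i.2 = g j j.2) => ?_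
  by_contra hne
  exact Set.disjoint_left.1 (hA i.2 j.2 (Subtype.coe_injective.ne hne)) (hgA i i.2)
    (hij ▸ hgA j j.2)

/-- A model of the complete graph on `ι` in the graph `G`: disjoint connected sets `U i` of
vertices, and connected sets `P i j` meeting `U i` and `U j` but no other `U k`. Of the sets
`P i j`, only those that share an index are required to be disjoint. -/
structure CliqueModel {V : Type*} (G : SimpleGraph V) (ι : Type*) where
  U : ι → Set V
  P : ι → ι → Set V
  preconnected_U : ∀ i, (G.induce (U i)).Preconnected
  nonempty_U : ∀ i, (U i).Nonempty
  preconnected_P : ∀ i j, i ≠ j → (G.induce (P i j)).Preconnected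
  symm_P : ∀ i j, P i j = P j i
  inter_nonempty : ∀ i j, i ≠ j → (U i ∩ P i j).Nonempty
  disjoint_U : ∀ i j, i ≠ j → Disjoint (U i) (U j)
  disjoint_P_U : ∀ i j k, i ≠ j → k ≠ i → k ≠ j → Disjoint (P i j) (U k)
  disjoint_P : ∀ i i' j, i ≠ j → i' ≠ j → i ≠ i' → Disjoint (P i j) (P i' j)

namespace CliqueModel

variable {V ι : Type*} {G : SimpleGraph V} (𝓜 : CliqueModel G ι) {F : Finset V} {C : Set V}
  {i j : ι}

theorem exists_disjoint_U [Fintype ι] (hF : F.card < Fintype.card ι) :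
    ∃ i, Disjoint (𝓜.U i) F := by
  by_contra! h
  refine (card_le_card_of_pairwiseDisjoint (s := Finset.univ)
    (fun i _ j _ hij => 𝓜.disjoint_U i j hij) fun i _ => ?_).not_gt hF
  exact Set.not_disjoint_iff_nonempty_inter.1 (h i)

theorem P_inter_nonempty_of_encloses (hCF : Encloses G F C) (hi : Disjoint (𝓜.U i) F)
    (hiC : (𝓜.U i ∩ C).Nonempty) (hjC : Disjoint (𝓜.U j) C) : (𝓜.P i j ∩ F).Nonempty := by
  by_contra hcon
  have hij : i ≠ j := by
    rintro rfl
    exact Set.not_disjoint_iff_nonempty_inter.2 hiC hjC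
  have hUC : 𝓜.U i ⊆ C := hCF.subset_of_preconnected (𝓜.preconnected_U i) hi hiC
  obtain ⟨x, hx, hxP⟩ := 𝓜.inter_nonempty i j hij
  obtain ⟨y, hy, hyP⟩ := 𝓜.inter_nonempty j i hij.symm
  have hPC : 𝓜.P i j ⊆ C := hCF.subset_of_preconnected (𝓜.preconnected_P i j hij)
    (Set.disjoint_iff_inter_eq_empty.2 (Set.not_nonempty_iff_eq_empty.1 hcon)) ⟨x, hxP, hUC hx⟩
  exact Set.disjoint_left.1 hjC hy (hPC (𝓜.symm_P i j ▸ hyP))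

-- The branch sets inside `C` and those outside are joined by sets meeting `F`, so if there are
-- branch sets of both kinds then there are at most `|F|` of each, and at most `|F|` meet `F`.
theorem inter_nonempty_of_encloses [Fintype ι] (hCF : Encloses G F C)
    (ht : 3 * F.card < Fintype.card ι) (hi : Disjoint (𝓜.U i) F) (hiC : (𝓜.U i ∩ C).Nonempty)
    (hj : Disjoint (𝓜.U j) F) : (𝓜.U j ∩ C).Nonempty := by
  classical
  rw [← Set.not_disjoint_iff_nonempty_inter]
  intro hjC
  let meeting : Finset ι := {k | ¬ Disjoint (𝓜.U k) F}
  let inside : Finset ι := {k | Disjoint (𝓜.U k) F ∧ (𝓜.U k ∩ C).Nonempty}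
  let outside : Finset ι := {k | Disjoint (𝓜.U k) F ∧ Disjoint (𝓜.U k) C}
  have hmeeting : meeting.card ≤ F.card :=
    card_le_card_of_pairwiseDisjoint (fun k _ l _ hkl => 𝓜.disjoint_U k l hkl) fun k hk =>
      Set.not_disjoint_iff_nonempty_inter.1 (Finset.mem_filter.1 hk).2
  have hinside : inside.card ≤ F.card := by
    have hne : ∀ k ∈ inside, k ≠ j := by
      rintro k hk rfl
      exact Set.not_disjoint_iff_nonempty_inter.2 (Finset.mem_filter.1 hk).2.2 hjC
    refine card_le_card_of_pairwiseDisjoint (A := fun k => 𝓜.P k j)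
      (fun k hk l hl hkl => 𝓜.disjoint_P k l j (hne k hk) (hne l hl) hkl) fun k hk => ?_
    exact 𝓜.P_inter_nonempty_of_encloses hCF (Finset.mem_filter.1 hk).2.1
      (Finset.mem_filter.1 hk).2.2 hjC
  have houtside : outside.card ≤ F.card := by
    have hne : ∀ k ∈ outside, k ≠ i := by
      rintro k hk rfl
      exact Set.not_disjoint_iff_nonempty_inter.2 hiC (Finset.mem_filter.1 hk).2.2
    refine card_le_card_of_pairwiseDisjoint (A := fun k => 𝓜.P k i)
      (fun k hk l hl hkl => 𝓜.disjoint_P k l i (hne k hk) (hne l hl) hkl) fun k hk => ?_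
    rw [𝓜.symm_P]
    exact 𝓜.P_inter_nonempty_of_encloses hCF hi hiC (Finset.mem_filter.1 hk).2.2
  have hcover : Finset.univ ⊆ inside ∪ outside ∪ meeting := by
    intro k _
    simp only [inside, outside, meeting, Finset.mem_union, Finset.mem_filter, Finset.mem_univ,
      true_and, ← Set.not_disjoint_iff_nonempty_inter]
    tauto
  have hcard := Finset.card_le_card hcover
  rw [Finset.card_univ] at hcard
  linarith [Finset.card_union_le (inside ∪ outside) meeting, Finset.card_union_le inside outside]

end CliqueModel

namespace LongGraph

open LongVertex

variable {B E ι : Type*} {Γ : LongGraph B E} (𝓜 : CliqueModel Γ.graph ι) {C : Set B}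
  {F : Finset B} {i j : ι}

theorem disjoint_coe_image_base [DecidableEq (LongVertex B E Γ.m)]
    {M : Set (LongVertex B E Γ.m)} (h : ∀ b ∈ F, base b ∉ M) :
    Disjoint M (F.image base : Finset (LongVertex B E Γ.m)) := by
  rw [Finset.coe_image, Set.disjoint_right]
  rintro _ ⟨b, hb, rfl⟩
  exact h b hb

variable (Γ) in
/-- The first `p` of the vertices subdividing the long edge `e`. -/
def initialSegment (e : E) (p : ℕ) : Set (LongVertex B E Γ.m) := {v | ∃ k < p, ∃ hk, v = mid e k hk}

variable (Γ) in
/-- The vertex following the first `p` subdividing vertices of the long edge `e`, which is the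
target of `e` if there are no more than `p` of them. -/
def nextVertex (e : E) (p : ℕ) : LongVertex B E Γ.m :=
  if h : p < Γ.m then mid e p h else base (Γ.tgt e)

theorem nextVertex_of_lt {e : E} {p : ℕ} (h : p < Γ.m) : Γ.nextVertex e p = mid e p h :=
  dif_pos h

theorem nextVertex_of_le {e : E} {p : ℕ} (h : Γ.m ≤ p) :
    Γ.nextVertex e p = base (Γ.tgt e) :=
  dif_neg h.not_gt

theorem encloses_initialSegment (e : E) (p : ℕ) :
    Encloses Γ.graph {base (Γ.src e), Γ.nextVertex e p} (Γ.initialSegment e p) := by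
  rintro x ⟨k, hkp, hk, rfl⟩ y hxy
  rcases step_or_step_of_adj hxy with h | h
  · cases h with
    | next _ _ h =>
      rcases Nat.lt_or_ge (k + 1) p with h' | h'
      · exact Or.inl ⟨k + 1, h', h, rfl⟩
      · obtain rfl : p = k + 1 := by omega
        exact Or.inr (Or.inr (nextVertex_of_lt h).symm)
    | finish _ _ h hk' =>
      exact Or.inr (Or.inr (nextVertex_of_le (by omega)).symm)
  · cases h with
    | start => exact Or.inr (Or.inl rfl)
    | next _ k h => exact Or.inl ⟨k, by omega, by omega, rfl⟩

variable [Fintype ι]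

theorem inter_hull_nonempty_of_encloses (h : Encloses Γ.baseGraph F C)
    (ht : 3 * F.card < Fintype.card ι) (hi : ∀ b ∈ F, base b ∉ 𝓜.U i)
    (hiC : (𝓜.U i ∩ Γ.hull C).Nonempty) (hj : ∀ b ∈ F, base b ∉ 𝓜.U j) :
    (𝓜.U j ∩ Γ.hull C).Nonempty := by
  classical
  refine 𝓜.inter_nonempty_of_encloses (F := F.image base) ?_ (lt_of_le_of_lt ?_ ht)
    (disjoint_coe_image_base hi) hiC (disjoint_coe_image_base hj)
  · rw [Finset.coe_image]
    exact h.hull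
  · gcongr
    exact Finset.card_image_le

theorem exists_forall_base_notMem (hF : F.card < Fintype.card ι) :
    ∃ i, ∀ b ∈ F, base b ∉ 𝓜.U i := by
  classical
  obtain ⟨i, hi⟩ := 𝓜.exists_disjoint_U (F := F.image base) (Finset.card_image_le.trans_lt hF)
  exact ⟨i, fun b hb h => Set.disjoint_left.1 hi h (Finset.mem_image_of_mem _ hb)⟩

theorem disjoint_initialSegment (ht : 6 < Fintype.card ι) (e : E) (p : ℕ) {j : ι}
    (hsrc : base (Γ.src e) ∉ 𝓜.U j) (hnext : Γ.nextVertex e p ∉ 𝓜.U j) :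
    Disjoint (𝓜.U j) (Γ.initialSegment e p) := by
  classical
  induction p generalizing j with
  | zero =>
    rw [Set.disjoint_right]
    rintro _ ⟨k, hk, -⟩
    exact absurd hk k.not_lt_zero
  | succ p ih =>
    by_contra hcon
    let F : Finset (LongVertex B E Γ.m) := {base (Γ.src e), Γ.nextVertex e (p + 1)}
    have hF : F.card ≤ 2 := Finset.card_le_two
    obtain ⟨l, hl⟩ := 𝓜.exists_disjoint_U (F := insert (Γ.nextVertex e p) F)
      (by linarith [Finset.card_insert_le (Γ.nextVertex e p) F])
    rw [Finset.coe_insert, Set.disjoint_insert_right] at hl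
    obtain ⟨_, hxU, k, hkp, hk, rfl⟩ : (𝓜.U l ∩ Γ.initialSegment e (p + 1)).Nonempty := by
      refine 𝓜.inter_nonempty_of_encloses (F := F) ?_ (by linarith) ?_
        (Set.not_disjoint_iff_nonempty_inter.1 hcon) hl.2
      · simpa [F] using encloses_initialSegment e (p + 1)
      · simp [F, hsrc, hnext]
    have hsrc' : base (Γ.src e) ∉ 𝓜.U l := fun h =>
      Set.disjoint_left.1 hl.2 h (by simp [F])
    rcases Nat.lt_succ_iff_lt_or_eq.1 hkp with hkp | rfl
    · exact Set.disjoint_left.1 (ih hsrc' hl.1) hxU ⟨k, hkp, hk, rfl⟩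
    · refine hl.1 ?_
      rwa [nextVertex_of_lt hk]

theorem exists_base_mem (ht : 6 < Fintype.card ι) (i : ι) : ∃ b, base b ∈ 𝓜.U i := by
  obtain ⟨x, hx⟩ := 𝓜.nonempty_U i
  cases x with
  | base b => exact ⟨b, hx⟩
  | mid e k hk =>
    by_contra! hcon
    refine Set.disjoint_left.1 (disjoint_initialSegment 𝓜 ht e Γ.m (hcon _) ?_) hx ⟨k, hk, hk, rfl⟩
    rw [nextVertex_of_le le_rfl]
    exact hcon _

end LongGraph

/-! ### The gadget -/

/-- The base vertices of the gadget: a frame of twenty vertices, the nodes of a complete binary tree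
of height `n` (the `j`-th node of height `h`, so that the leaves have height zero), and a bottom row
of `2 ^ n` vertices. -/
inductive GadgetVertex (n : ℕ) : Type
  | frame (u : Fin 20) : GadgetVertex n
  | node (h j : ℕ) (hh : h ≤ n) (hj : j < 2 ^ (n - h)) : GadgetVertex n
  | bot (i : ℕ) (hi : i < 2 ^ n) : GadgetVertex n

/-- The three pairs of frame vertices that are not joined by an edge of the frame. -/
def FramePair (u v : Fin 20) : Prop := (u = 0 ∧ v = 1) ∨ (u = 2 ∧ v = 3) ∨ (u = 4 ∧ v = 5)

instance (u v : Fin 20) : Decidable (FramePair u v) := inferInstanceAs (Decidable (_ ∨ _))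

/-- The long edges of the gadget: those of the frame; those between consecutive columns (leaf to
bottom, bottom to leaf or bottom to bottom); those that attach the ends of the two rows and the root
of the tree to the frame. -/
inductive GadgetEdge (n : ℕ) : Type
  | fr (u v : Fin 20) (huv : u < v) (h : ¬ FramePair u v) : GadgetEdge n
  | gap (a b : Bool) (hab : (a && b) = false) (i : ℕ) (hi : i + 1 < 2 ^ n) : GadgetEdge n
  | start (x : Bool) : GadgetEdge n
  | finish (a x : Bool) : GadgetEdge n
  | apex (x : Bool) : GadgetEdge n

namespace Gadget

open LongVertex GadgetVertex GadgetEdge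

variable {n : ℕ}

/-- The `i`-th vertex of the top row (the leaves, for `true`) or of the bottom row. -/
def lev : (a : Bool) → (i : ℕ) → i < 2 ^ n → GadgetVertex n
  | true, i, h => node 0 i (Nat.zero_le n) h
  | false, i, h => bot i h

/-- The root of the tree. -/
def root : GadgetVertex n := node n 0 le_rfl (by simp)

/-- The frame vertex to which the left end of a row is attached. -/
def startFrame (x : Bool) : Fin 20 := if x then 0 else 2

/-- The frame vertices to which the right ends of the rows are attached. -/
def finishFrame (x : Bool) : Fin 20 := if x then 1 else 3

/-- The two frame vertices to which the root is attached. -/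
def apexFrame (x : Bool) : Fin 20 := if x then 4 else 5

theorem last_lt (n : ℕ) : 2 ^ n - 1 < 2 ^ n := Nat.sub_lt (by positivity) one_pos

/-- The source of a long edge. -/
def src : GadgetEdge n → GadgetVertex n
  | fr u _ _ _ => frame u
  | gap a _ _ i hi => lev a i (Nat.lt_of_succ_lt hi)
  | start x => frame (startFrame x)
  | finish a _ => lev a (2 ^ n - 1) (last_lt n)
  | apex _ => root

/-- The target of a long edge. -/
def tgt : GadgetEdge n → GadgetVertex n
  | fr _ v _ _ => frame v
  | gap _ b _ i hi => lev b (i + 1) hi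
  | start x => lev x 0 (by positivity)
  | finish _ x => frame (finishFrame x)
  | apex x => frame (apexFrame x)

/-- The edges of the tree, from a node to its parent. -/
inductive Tree : GadgetVertex n → GadgetVertex n → Prop
  | up (h j : ℕ) (hh : h ≤ n) (hj : j < 2 ^ (n - h)) (hh' : h + 1 ≤ n)
      (hj' : j / 2 < 2 ^ (n - (h + 1))) : Tree (node h j hh hj) (node (h + 1) (j / 2) hh' hj')

/-- The gadget: a complete binary tree whose leaves are the top row of a ladder, a bottom row, and a
frame that is a complete graph on twenty vertices without the three edges of `FramePair`. A route
through the rows replaces two of the missing edges, the tree replaces the third. -/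
def gadget (n : ℕ) : LongGraph (GadgetVertex n) (GadgetEdge n) where
  short := Tree
  src := src
  tgt := tgt
  m := 4 * n

@[simp] theorem gadget_src (e : GadgetEdge n) : (gadget n).src e = src e := rfl
@[simp] theorem gadget_tgt (e : GadgetEdge n) : (gadget n).tgt e = tgt e := rfl
theorem gadget_m : (gadget n).m = 4 * n := rfl

theorem frame_ne_lev {u : Fin 20} {a : Bool} {i : ℕ} {hi : i < 2 ^ n} : frame u ≠ lev a i hi := by
  cases a <;> simp [lev]

theorem frame_ne_root {u : Fin 20} : (frame u : GadgetVertex n) ≠ root := by simp [root]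

/-- The block of the node `(h, j)`: the nodes below it, and the bottom vertices of its columns. -/
def block (h j : ℕ) : Set (GadgetVertex n) :=
  {v | match v with
    | frame _ => False
    | node h' j' _ _ => h' ≤ h ∧ j' / 2 ^ (h - h') = j
    | bot i _ => i / 2 ^ h = j}

/-- The boundary of a block: its top node, and the ends of its two rows. -/
def blockBoundary (h j : ℕ) : Set (GadgetVertex n) :=
  {v | match v with
    | frame _ => False
    | node h' j' _ _ => (h' = h ∧ j' = j) ∨ (h' = 0 ∧ (j' = j * 2 ^ h ∨ j' + 1 = (j + 1) * 2 ^ h))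
    | bot i _ => i = j * 2 ^ h ∨ i + 1 = (j + 1) * 2 ^ h}

theorem div_two_pow_eq_iff {h i j : ℕ} :
    i / 2 ^ h = j ↔ j * 2 ^ h ≤ i ∧ i < (j + 1) * 2 ^ h := by
  rw [Nat.div_eq_iff (by positivity), Nat.le_sub_one_iff_lt (by positivity), Nat.add_mul, one_mul]

theorem lev_mem_block {h j i : ℕ} {a : Bool} {hi : i < 2 ^ n} :
    lev a i hi ∈ block h j ↔ j * 2 ^ h ≤ i ∧ i < (j + 1) * 2 ^ h := by
  rw [← div_two_pow_eq_iff]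
  cases a <;> simp [lev, block]

theorem lev_mem_blockBoundary {h j i : ℕ} {a : Bool} {hi : i < 2 ^ n}
    (hij : i = j * 2 ^ h ∨ i + 1 = (j + 1) * 2 ^ h) : lev a i hi ∈ blockBoundary h j := by
  cases a
  · exact hij
  · exact Or.inr ⟨rfl, hij⟩

theorem exists_finset_coe_eq_blockBoundary (h j : ℕ) :
    ∃ F : Finset (GadgetVertex n), F.card ≤ 5 ∧ (F : Set (GadgetVertex n)) = blockBoundary h j := by
  classical
  let code : GadgetVertex n → Fin 20 ⊕ (ℕ × ℕ) ⊕ ℕ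
    | frame u => .inl u
    | node h j _ _ => .inr (.inl (h, j))
    | bot i _ => .inr (.inr i)
  have hcode : Function.Injective code := by
    rintro (_ | _ | _) (_ | _ | _) h <;> simp_all [code]
  let T : Finset (Fin 20 ⊕ (ℕ × ℕ) ⊕ ℕ) := {.inr (.inl (h, j)), .inr (.inl (0, j * 2 ^ h)),
    .inr (.inl (0, (j + 1) * 2 ^ h - 1)), .inr (.inr (j * 2 ^ h)),
    .inr (.inr ((j + 1) * 2 ^ h - 1))}
  have hpos : 0 < (j + 1) * 2 ^ h := by positivity
  refine ⟨T.preimage code hcode.injOn, ?_, ?_⟩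
  · rw [Finset.card_preimage]
    exact (Finset.card_filter_le _ _).trans Finset.card_le_five
  · ext v
    cases v <;> simp [T, code, blockBoundary] <;> omega

theorem div_two_div_two_pow_sub {h' h j' : ℕ} (hh : h' + 1 ≤ h) :
    j' / 2 / 2 ^ (h - (h' + 1)) = j' / 2 ^ (h - h') := by
  have : h - h' = (h - (h' + 1)) + 1 := by omega
  rw [this, Nat.div_div_eq_div_mul, pow_succ']

theorem encloses_block {h j : ℕ} (hh : h ≤ n) (hj : j < 2 ^ (n - h)) :
    Encloses (gadget n).baseGraph (blockBoundary h j) (block h j \ blockBoundary h j) := by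
  have hlev : ∀ {a i hi}, lev a i hi ∈ (block h j \ blockBoundary h j : Set (GadgetVertex n)) →
      j * 2 ^ h < i ∧ i + 1 < (j + 1) * 2 ^ h := by
    intro a i hi ⟨hblock, hbdry⟩
    rw [lev_mem_block] at hblock
    by_contra hcon
    exact hbdry (lev_mem_blockBoundary (by omega))
  have hlast : (j + 1) * 2 ^ h ≤ 2 ^ n := by
    calc (j + 1) * 2 ^ h ≤ 2 ^ (n - h) * 2 ^ h := Nat.mul_le_mul_right _ hj
      _ = 2 ^ n := by rw [← pow_add, Nat.sub_add_cancel hh]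
  refine LongGraph.encloses_baseGraph ?_ ?_
  · rintro _ _ ⟨h', j', -, -, -, -⟩
    rw [Set.sdiff_union_self]
    refine ⟨fun ⟨⟨hle, hdiv⟩, htop⟩ => Or.inl ?_, fun ⟨⟨hle, hdiv⟩, _⟩ => Or.inl ?_⟩
    · have hne : h' ≠ h := by
        rintro rfl
        exact htop (Or.inl ⟨rfl, by simpa using hdiv⟩)
      exact ⟨by omega, by rwa [div_two_div_two_pow_sub (by omega)]⟩
    · exact ⟨by omega, by rwa [← div_two_div_two_pow_sub (by omega)]⟩
  · intro e
    rw [Set.sdiff_union_self]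
    cases e with
    | fr u v => exact ⟨fun hv => hv.1.elim, fun hv => hv.1.elim⟩
    | gap a b hab i hi =>
      constructor <;> intro hv <;> have := hlev hv <;> exact Or.inl (lev_mem_block.2 (by omega))
    | start x =>
      exact ⟨fun hv => hv.1.elim, fun hv => absurd (hlev hv).1 (Nat.not_lt_zero _)⟩
    | finish a x =>
      exact ⟨fun hv => by have := hlev hv; omega, fun hv => hv.1.elim⟩
    | apex x =>
      refine ⟨fun ⟨⟨hle, hdiv⟩, htop⟩ => ?_, fun hv => hv.1.elim⟩
      obtain rfl : n = h := le_antisymm hle hh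
      exact absurd (Or.inl ⟨rfl, by simpa using hdiv⟩) htop

theorem block_zero_subset (j : ℕ) : (block 0 j : Set (GadgetVertex n)) ⊆ blockBoundary 0 j := by
  intro v hv
  cases v with
  | frame u => exact hv.elim
  | node h' j' hh hj =>
    obtain ⟨hle, hdiv⟩ := hv
    obtain rfl : h' = 0 := by omega
    exact Or.inl ⟨rfl, by simpa using hdiv⟩
  | bot i hi =>
    have hdiv : i / 2 ^ 0 = j := hv
    exact Or.inl (by simpa using hdiv)

theorem block_succ_subset (h j : ℕ) : (block (h + 1) j : Set (GadgetVertex n)) ⊆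
    blockBoundary (h + 1) j ∪ block h (2 * j) ∪ block h (2 * j + 1) := by
  intro v hv
  cases v with
  | frame u => exact hv.elim
  | node h' j' hh hj =>
    obtain ⟨hle, hdiv⟩ := hv
    by_cases htop : h' = h + 1
    · subst htop
      exact Or.inl (Or.inl (Or.inl ⟨rfl, by simpa using hdiv⟩))
    · rw [show h + 1 - h' = (h - h') + 1 by omega, pow_succ, ← Nat.div_div_eq_div_mul] at hdiv
      have hchild : j' / 2 ^ (h - h') = 2 * j ∨ j' / 2 ^ (h - h') = 2 * j + 1 := by omega
      rcases hchild with hchild | hchild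
      · exact Or.inl (Or.inr ⟨by omega, hchild⟩)
      · exact Or.inr ⟨by omega, hchild⟩
  | bot i hi =>
    have hdiv : i / 2 ^ (h + 1) = j := hv
    rw [pow_succ, ← Nat.div_div_eq_div_mul] at hdiv
    have hchild : i / 2 ^ h = 2 * j ∨ i / 2 ^ h = 2 * j + 1 := by omega
    rcases hchild with hchild | hchild
    · exact Or.inl (Or.inr hchild)
    · exact Or.inr hchild

theorem mem_block_root {v : GadgetVertex n} (hv : ∀ u, v ≠ frame u) : v ∈ block n 0 := by
  cases v with
  | frame u => exact absurd rfl (hv u)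
  | node h' j' hh hj => exact ⟨hh, Nat.div_eq_of_lt hj⟩
  | bot i hi => exact Nat.div_eq_of_lt hi

theorem encloses_compl_frame : Encloses (gadget n).baseGraph (frame '' {u : Fin 20 | u < 6})
    {v | ∀ u, v ≠ frame u} := by
  have hstart : ∀ x, startFrame x < 6 := by decide
  have hfinish : ∀ x, finishFrame x < 6 := by decide
  have hapex : ∀ x, apexFrame x < 6 := by decide
  refine LongGraph.encloses_baseGraph ?_ ?_
  · rintro _ _ ⟨h', j', hh', hj', hh2, hj2⟩
    exact ⟨fun _ => Or.inl fun u => by simp, fun _ => Or.inl fun u => by simp⟩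
  · intro e
    cases e with
    | fr u v => exact ⟨fun h => absurd rfl (h u), fun h => absurd rfl (h v)⟩
    | gap a b hab i hi =>
      exact ⟨fun _ => Or.inl fun u => frame_ne_lev.symm, fun _ => Or.inl fun u => frame_ne_lev.symm⟩
    | start x =>
      exact ⟨fun _ => Or.inl fun u => frame_ne_lev.symm, fun _ => Or.inr ⟨_, hstart x, rfl⟩⟩
    | finish a x =>
      exact ⟨fun _ => Or.inr ⟨_, hfinish x, rfl⟩, fun _ => Or.inl fun u => frame_ne_lev.symm⟩
    | apex x =>
      exact ⟨fun _ => Or.inr ⟨_, hapex x, rfl⟩, fun _ => Or.inl fun u => frame_ne_root.symm⟩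

end Gadget

theorem LongGraph.exists_base_mem_of_encloses {B E ι : Type*} [Fintype ι] {Γ : LongGraph B E}
    (𝓜 : CliqueModel Γ.graph ι) (ht : 6 < Fintype.card ι) {C : Set B} {F D : Finset B}
    (h : Encloses Γ.baseGraph F C) (hF : 3 * F.card < Fintype.card ι)
    (hD : F.card + D.card < Fintype.card ι) {i : ι}
    (hi : ∀ b ∈ F, LongVertex.base b ∉ 𝓜.U i) (hiC : ∃ b ∈ C, LongVertex.base b ∈ 𝓜.U i) :
    ∃ k, (∀ b ∈ F, LongVertex.base b ∉ 𝓜.U k) ∧ (∀ b ∈ D, LongVertex.base b ∉ 𝓜.U k) ∧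
      ∃ b ∈ C, LongVertex.base b ∈ 𝓜.U k := by
  classical
  obtain ⟨k, hk⟩ := exists_forall_base_notMem 𝓜 ((Finset.card_union_le F D).trans_lt hD)
  have hkF : ∀ b ∈ F, LongVertex.base b ∉ 𝓜.U k := fun b hb => hk b (Finset.mem_union_left _ hb)
  obtain ⟨b, hb⟩ := exists_base_mem 𝓜 ht k
  obtain ⟨c, hc, hci⟩ := hiC
  have hdisj : Disjoint (𝓜.U k) (LongVertex.base '' F) := by
    rw [Set.disjoint_right]
    rintro _ ⟨b, hb, rfl⟩
    exact hkF b hb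
  have hsub := h.hull.subset_of_preconnected (𝓜.preconnected_U k) hdisj
    (inter_hull_nonempty_of_encloses 𝓜 h hF hi ⟨_, hci, hc⟩ hkF)
  exact ⟨k, hkF, fun b hb => hk b (Finset.mem_union_right _ hb), b, hsub hb, hb⟩

namespace Gadget

open LongVertex GadgetVertex GadgetEdge

variable {n : ℕ}

theorem base_notMem_of_mem_block {ι : Type*} [Fintype ι] (𝓜 : CliqueModel (gadget n).graph ι)
    (ht : 15 < Fintype.card ι) {h j : ℕ} (hh : h ≤ n) (hj : j < 2 ^ (n - h)) {i : ι}
    (hi : ∀ b ∈ blockBoundary h j, base b ∉ 𝓜.U i) : ∀ b ∈ block h j, base b ∉ 𝓜.U i := by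
  classical
  induction h generalizing j i with
  | zero => exact fun b hb => hi b (block_zero_subset j hb)
  | succ h ih =>
    intro b hb hbi
    have hpow : 2 ^ (n - h) = 2 * 2 ^ (n - (h + 1)) := by
      rw [← pow_succ', show n - h = n - (h + 1) + 1 by omega]
    obtain ⟨F, hFcard, hF⟩ := exists_finset_coe_eq_blockBoundary (n := n) (h + 1) j
    obtain ⟨F₁, hFcard₁, hF₁⟩ := exists_finset_coe_eq_blockBoundary (n := n) h (2 * j)
    obtain ⟨F₂, hFcard₂, hF₂⟩ := exists_finset_coe_eq_blockBoundary (n := n) h (2 * j + 1)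
    have hcard := Finset.card_union_le F₁ F₂
    simp only [← hF, Finset.mem_coe] at hi
    -- some branch set in the block avoids the boundaries of both halves as well
    obtain ⟨k, -, hkD, c, hc, hck⟩ := LongGraph.exists_base_mem_of_encloses 𝓜 (by omega)
      (C := block (h + 1) j \ blockBoundary (h + 1) j) (F := F) (D := F₁ ∪ F₂)
      (by rw [hF]; exact encloses_block hh hj) (by omega) (by omega) hi
      ⟨b, ⟨hb, fun hbF => hi b (Finset.mem_coe.1 (hF.symm ▸ hbF)) hbi⟩, hbi⟩
    simp only [← Finset.mem_coe, Finset.coe_union, hF₁, hF₂] at hkD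
    rcases block_succ_subset h j hc.1 with (hbdry | hleft) | hright
    · exact hc.2 hbdry
    · exact ih (by omega) (by omega) (fun b hb => hkD b (Or.inl hb)) c hleft hck
    · exact ih (by omega) (by omega) (fun b hb => hkD b (Or.inr hb)) c hright hck

theorem exists_frame_mem {ι : Type*} [Fintype ι] (𝓜 : CliqueModel (gadget n).graph ι)
    (ht : 18 < Fintype.card ι) (i : ι) : ∃ u, base (frame u) ∈ 𝓜.U i := by
  classical
  by_contra! hcon
  obtain ⟨F, hFcard, hF⟩ := exists_finset_coe_eq_blockBoundary (n := n) n 0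
  let D : Finset (GadgetVertex n) := ({u : Fin 20 | u < 6} : Finset (Fin 20)).image frame
  have hDcard : D.card ≤ 6 := Finset.card_image_le.trans (by decide)
  obtain ⟨b, hb⟩ := LongGraph.exists_base_mem 𝓜 (by omega) i
  obtain ⟨k, -, hkF, c, hc, hck⟩ := LongGraph.exists_base_mem_of_encloses 𝓜 (by omega)
    (C := {v | ∀ u, v ≠ frame u}) (F := D) (D := F)
    (by simpa [D] using encloses_compl_frame (n := n)) (by omega) (by omega) (i := i)
    (by simp [D, hcon]) ⟨b, fun u h => hcon u (h ▸ hb), hb⟩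
  refine base_notMem_of_mem_block 𝓜 (by omega) le_rfl (by positivity) (fun b hb => ?_) c
    (mem_block_root hc) hck
  exact hkF b (Finset.mem_coe.1 (hF.symm ▸ hb))

theorem exists_perm_forall_frame_mem (𝓜 : CliqueModel (gadget n).graph (Fin 20)) :
    ∃ σ : Equiv.Perm (Fin 20), ∀ u, base (frame u) ∈ 𝓜.U (σ u) := by
  choose f hf using exists_frame_mem 𝓜 (by simp)
  have hinj : Function.Injective f := by
    intro i j hij
    by_contra hne
    exact Set.disjoint_left.1 (𝓜.disjoint_U i j hne) (hf i) (hij ▸ hf j)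
  let σ := Equiv.ofBijective f (Finite.injective_iff_bijective.1 hinj)
  refine ⟨σ.symm, fun u => ?_⟩
  have h := hf (σ.symm u)
  rwa [show f (σ.symm u) = u from σ.apply_symm_apply u] at h

end Gadget

/-! ### From fat models to strands -/

namespace FatMinorModel

variable {ι X : Type*} [EMetricSpace X] {K : ℝ} (𝓕 : FatMinorModel (⊤ : SimpleGraph ι) K X)
  {i j k l : ι}

/-- The set of the edge `ij` of a model of a complete graph, empty if `i = j`. -/
def edgePart (i j : ι) : Set X := ⋃ h : i ≠ j, 𝓕.P ⟨s(i, j), by simpa using h⟩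

theorem edgePart_of_ne (h : i ≠ j) : 𝓕.edgePart i j = 𝓕.P ⟨s(i, j), by simpa using h⟩ :=
  iSup_pos h

theorem edgePart_comm (i j : ι) : 𝓕.edgePart i j = 𝓕.edgePart j i := by
  by_cases h : i = j
  · rw [h]
  · rw [𝓕.edgePart_of_ne h, 𝓕.edgePart_of_ne (Ne.symm h)]
    congr 2
    exact Sym2.eq_swap

theorem le_setDist_B_edgePart (h : i ≠ j) (hi : k ≠ i) (hj : k ≠ j) :
    ENNReal.ofReal K ≤ setDist (𝓕.B k) (𝓕.edgePart i j) := by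
  rw [𝓕.edgePart_of_ne h]
  exact 𝓕.le_setDist_B_P k _ (by simp [hi, hj])

theorem le_setDist_edgePart_edgePart (hij : i ≠ j) (hkl : k ≠ l) (hne : s(i, j) ≠ s(k, l)) :
    ENNReal.ofReal K ≤ setDist (𝓕.edgePart i j) (𝓕.edgePart k l) := by
  rw [𝓕.edgePart_of_ne hij, 𝓕.edgePart_of_ne hkl]
  exact 𝓕.le_setDist_P_P _ _ (by simpa using hne)

theorem inter_edgePart_nonempty (h : i ≠ j) : (𝓕.B i ∩ 𝓕.edgePart i j).Nonempty := by
  rw [𝓕.edgePart_of_ne h]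
  exact 𝓕.inter_nonempty _ _ (by simp)

theorem isPathConnected_edgePart (h : i ≠ j) : IsPathConnected (𝓕.edgePart i j) := by
  rw [𝓕.edgePart_of_ne h]
  exact 𝓕.isPathConnected_P _

/-- The union of two branch sets and of the set of the edge between them. -/
def strand (i j : ι) : Set X := 𝓕.B i ∪ 𝓕.edgePart i j ∪ 𝓕.B j

theorem isPreconnected_strand (h : i ≠ j) : IsPreconnected (𝓕.strand i j) := by
  have hBP : IsPathConnected (𝓕.B i ∪ 𝓕.edgePart i j) :=
    (𝓕.isPathConnected_B i).union (𝓕.isPathConnected_edgePart h) (𝓕.inter_edgePart_nonempty h)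
  obtain ⟨p, hpB, hpP⟩ := 𝓕.inter_edgePart_nonempty h.symm
  rw [𝓕.edgePart_comm] at hpP
  exact (hBP.union (𝓕.isPathConnected_B j) ⟨p, Or.inr hpP, hpB⟩).isConnected.isPreconnected

theorem le_setDist_strand_strand (hij : i ≠ j) (hkl : k ≠ l) (hik : i ≠ k) (hil : i ≠ l)
    (hjk : j ≠ k) (hjl : j ≠ l) : ENNReal.ofReal K ≤ setDist (𝓕.strand i j) (𝓕.strand k l) := by
  have hBP : ∀ a, a ≠ k → a ≠ l → ENNReal.ofReal K ≤ setDist (𝓕.B a) (𝓕.edgePart k l) :=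
    fun a => 𝓕.le_setDist_B_edgePart hkl
  have hPB : ∀ a, i ≠ a → j ≠ a → ENNReal.ofReal K ≤ setDist (𝓕.edgePart i j) (𝓕.B a) :=
    fun a hi hj => setDist_comm (𝓕.B a) _ ▸ 𝓕.le_setDist_B_edgePart hij hi.symm hj.symm
  have hPP : ENNReal.ofReal K ≤ setDist (𝓕.edgePart i j) (𝓕.edgePart k l) :=
    𝓕.le_setDist_edgePart_edgePart hij hkl (by simp [hik, hil])
  simp only [strand, setDist_union_left, setDist_union_right, le_min_iff]
  exact ⟨⟨⟨⟨𝓕.le_setDist_B_B i k hik, hPB k hik hjk⟩, 𝓕.le_setDist_B_B j k hjk⟩,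
    ⟨hBP i hik hil, hPP⟩, hBP j hjk hjl⟩,
    ⟨𝓕.le_setDist_B_B i l hil, hPB l hil hjl⟩, 𝓕.le_setDist_B_B j l hjl⟩

/-- The combinatorial model given by the vertices that the sets of a 3-fat model touch. -/
def toCliqueModel {V : Type*} {G : SimpleGraph V}
    (𝓕 : FatMinorModel (⊤ : SimpleGraph ι) 3 (GraphSpace G)) : CliqueModel G ι where
  U i := GraphSpace.touched (𝓕.B i)
  P i j := GraphSpace.touched (𝓕.edgePart i j)
  preconnected_U i :=
    GraphSpace.preconnected_induce_touched (𝓕.isPathConnected_B i).isConnected.isPreconnected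
  nonempty_U i := GraphSpace.touched_nonempty (𝓕.isPathConnected_B i).nonempty
  preconnected_P i j h := GraphSpace.preconnected_induce_touched
    (𝓕.isPathConnected_edgePart h).isConnected.isPreconnected
  symm_P i j := by rw [edgePart_comm]
  inter_nonempty i j h := GraphSpace.touched_inter_nonempty (𝓕.inter_edgePart_nonempty h)
  disjoint_U i j h := GraphSpace.disjoint_touched (by simpa using 𝓕.le_setDist_B_B i j h)
  disjoint_P_U i j k h hi hj :=
    (GraphSpace.disjoint_touched (by simpa using 𝓕.le_setDist_B_edgePart h hi hj)).symm
  disjoint_P i i' j h h' hne := GraphSpace.disjoint_touched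
    (by simpa using 𝓕.le_setDist_edgePart_edgePart h h' (by simp [hne, h]))

end FatMinorModel

theorem FramePair.lt {u v : Fin 20} (h : FramePair u v) : u < v := by
  rcases h with ⟨rfl, rfl⟩ | ⟨rfl, rfl⟩ | ⟨rfl, rfl⟩ <;> decide

namespace Gadget

open LongVertex GadgetVertex GadgetEdge GraphSpace

variable {n : ℕ}

theorem exists_strands (𝓕 : FatMinorModel (⊤ : SimpleGraph (Fin 20)) 3
    (GraphSpace (gadget n).graph)) : ∃ S : Fin 20 → Fin 20 → Set (GraphSpace (gadget n).graph),
    (∀ u v, u ≠ v → IsPreconnected (S u v)) ∧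
    (∀ u v u' v', u ≠ v → u' ≠ v' → u ≠ u' → u ≠ v' → v ≠ u' → v ≠ v' →
      3 ≤ setDist (S u v) (S u' v')) ∧
    ∀ u v w, u ≠ v → (base (frame w) ∈ touched (S u v) ↔ w = u ∨ w = v) := by
  obtain ⟨σ, hσ⟩ := exists_perm_forall_frame_mem 𝓕.toCliqueModel
  have hne : ∀ {u v}, u ≠ v → σ u ≠ σ v := σ.injective.ne
  refine ⟨fun u v => 𝓕.strand (σ u) (σ v), fun u v h => 𝓕.isPreconnected_strand (hne h),
    fun u v u' v' huv huv' huu hu hv hvv => ?_, fun u v w h => ?_⟩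
  · simpa using 𝓕.le_setDist_strand_strand (hne huv) (hne huv') (hne huu) (hne hu) (hne hv)
      (hne hvv)
  simp only [FatMinorModel.strand, touched_union]
  constructor
  · intro hw
    by_contra! hcon
    obtain ⟨hwu, hwv⟩ := hcon
    rcases hw with (hw | hw) | hw
    · exact Set.disjoint_left.1 (𝓕.toCliqueModel.disjoint_U _ _ (hne hwu)) (hσ w) hw
    · exact Set.disjoint_left.1
        (𝓕.toCliqueModel.disjoint_P_U _ _ _ (hne h) (hne hwu) (hne hwv)) hw (hσ w)
    · exact Set.disjoint_left.1 (𝓕.toCliqueModel.disjoint_U _ _ (hne hwv)) (hσ w) hw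
  · rintro (rfl | rfl)
    · exact Or.inl (Or.inl (hσ w))
    · exact Or.inr (hσ w)

/-- The vertices outside the frame that are joined to the frame vertex `u` by a long edge. -/
def ports (u : Fin 20) : Set (GadgetVertex n) :=
  {c | (∃ x, u = startFrame x ∧ c = lev x 0 (by positivity)) ∨
    (∃ a x, u = finishFrame x ∧ c = lev a (2 ^ n - 1) (last_lt n)) ∨
    ∃ x, u = apexFrame x ∧ c = root}

theorem frame_notMem_ports (u w : Fin 20) : frame w ∉ (ports u : Set (GadgetVertex n)) := by
  rintro (⟨x, -, h⟩ | ⟨a, x, -, h⟩ | ⟨x, -, h⟩)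
  · exact frame_ne_lev h
  · exact frame_ne_lev h
  · exact frame_ne_root h

theorem encloses_singleton_frame {u v : Fin 20} (huv : FramePair u v ∨ FramePair v u) :
    Encloses (gadget n).baseGraph (ports u ∪ frame '' {w | w ≠ u ∧ w ≠ v}) {frame u} := by
  refine LongGraph.encloses_baseGraph ?_ ?_
  · rintro _ _ ⟨-, -, -, -, -, -⟩
    exact ⟨fun h => by simp at h, fun h => by simp at h⟩
  · intro e
    cases e with
    | fr a b hab hnot =>
      constructor
      · intro (ha : frame a = frame u)
        obtain rfl : a = u := by simpa using ha
        refine Or.inr (Or.inr ⟨b, ⟨hab.ne', ?_⟩, rfl⟩)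
        rintro rfl
        exact huv.elim hnot fun h => h.lt.asymm hab
      · intro (hb : frame b = frame u)
        obtain rfl : b = u := by simpa using hb
        refine Or.inr (Or.inr ⟨a, ⟨hab.ne, ?_⟩, rfl⟩)
        rintro rfl
        exact huv.elim (fun h => h.lt.asymm hab) hnot
    | gap a b hab i hi =>
      exact ⟨fun h => absurd h.symm frame_ne_lev, fun h => absurd h.symm frame_ne_lev⟩
    | start x =>
      refine ⟨fun (h : frame (startFrame x) = frame u) => ?_, fun h => absurd h.symm frame_ne_lev⟩
      exact Or.inr (Or.inl (Or.inl ⟨x, by simpa using h.symm, rfl⟩))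
    | finish a x =>
      refine ⟨fun h => absurd h.symm frame_ne_lev, fun (h : frame (finishFrame x) = frame u) => ?_⟩
      exact Or.inr (Or.inl (Or.inr (Or.inl ⟨a, x, by simpa using h.symm, rfl⟩)))
    | apex x =>
      refine ⟨fun h => absurd h.symm frame_ne_root, fun (h : frame (apexFrame x) = frame u) => ?_⟩
      exact Or.inr (Or.inl (Or.inr (Or.inr ⟨x, by simpa using h.symm, rfl⟩)))

theorem exists_mem_ports {S : Set (GraphSpace (gadget n).graph)} (hS : IsPreconnected S)
    {u v : Fin 20} (huv : FramePair u v ∨ FramePair v u)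
    (hSf : ∀ w, base (frame w) ∈ touched S ↔ w = u ∨ w = v) :
    ∃ c ∈ ports u, base c ∈ verts S := by
  have hne : v ≠ u := huv.elim (fun h => h.lt.ne') fun h => h.lt.ne
  have hF : ∀ w, w = u ∨ w = v →
      (frame w : GadgetVertex n) ∉ ports u ∪ frame '' {w | w ≠ u ∧ w ≠ v} := by
    rintro w hw (h | ⟨w', ⟨hu, hv⟩, h⟩)
    · exact frame_notMem_ports u w h
    · obtain rfl : w' = w := by simpa using h
      exact hw.elim hu hv
  have hbase : ∀ w, w = u ∨ w = v →
      (base (frame w) : LongVertex (GadgetVertex n) (GadgetEdge n) (gadget n).m) ∉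
        base '' (ports u ∪ frame '' {w | w ≠ u ∧ w ≠ v}) := by
    rintro w hw ⟨c, hc, h⟩
    obtain rfl : c = frame w := by simpa using h
    exact hF w hw hc
  obtain ⟨_, ⟨c, hc, rfl⟩, hcS⟩ := exists_mem_verts_of_encloses hS
    (encloses_singleton_frame huv).hull ((hSf u).2 (Or.inl rfl)) ⟨rfl, hbase u (Or.inl rfl)⟩
    ((hSf v).2 (Or.inr rfl)) (by
      rintro (h | h)
      · exact hne (by simpa [LongGraph.hull] using h)
      · exact hbase v (Or.inr rfl) h)
  rcases hc with hc | ⟨w, ⟨hwu, hwv⟩, rfl⟩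
  · exact ⟨c, hc, hcS⟩
  · exact (((hSf w).1 (verts_subset_touched S hcS)).elim hwu hwv).elim

end Gadget

/-! ### Walks in the binary tree -/

namespace NodeTree

/-- A step along an edge of the infinite binary tree between members of `M`; the parent of the node
`(h, j)` is `(h + 1, j / 2)`. -/
def TreeStep (M : Set (ℕ × ℕ)) (a b : ℕ × ℕ) : Prop :=
  a ∈ M ∧ b ∈ M ∧ (b = (a.1 + 1, a.2 / 2) ∨ a = (b.1 + 1, b.2 / 2))

/-- Two nodes are joined in `M` if there is a tree walk in `M` between them. -/
def NodeJoined (M : Set (ℕ × ℕ)) : ℕ × ℕ → ℕ × ℕ → Prop := Relation.ReflTransGen (TreeStep M)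

theorem NodeJoined.symm {M : Set (ℕ × ℕ)} {a b : ℕ × ℕ} (h : NodeJoined M a b) :
    NodeJoined M b a := by
  induction h with
  | refl => exact .refl
  | tail _ hstep ih => exact .head ⟨hstep.2.1, hstep.1, hstep.2.2.symm⟩ ih

/-- The subtree below the node `(h, j)`. -/
def below (h j : ℕ) : Set (ℕ × ℕ) := {p | p.1 ≤ h ∧ p.2 / 2 ^ (h - p.1) = j}

theorem leaf_mem_below {h j i : ℕ} : (0, i) ∈ below h j ↔ j * 2 ^ h ≤ i ∧ i < (j + 1) * 2 ^ h := by
  simp [below, ← Gadget.div_two_pow_eq_iff]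

theorem parent_mem_below_iff {h j k i : ℕ} (hk : k + 1 ≤ h) :
    (k + 1, i / 2) ∈ below h j ↔ (k, i) ∈ below h j := by
  simp [below, hk, Nat.le_of_succ_le hk, Gadget.div_two_div_two_pow_sub hk]

theorem eq_of_mem_below_of_parent_notMem {h j : ℕ} {a : ℕ × ℕ} (ha : a ∈ below h j)
    (hpar : (a.1 + 1, a.2 / 2) ∉ below h j) : a = (h, j) := by
  obtain ⟨k, i⟩ := a
  obtain rfl : k = h := by
    by_contra hne
    exact hpar ((parent_mem_below_iff (Nat.lt_of_le_of_ne ha.1 hne)).2 ha)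
  exact Prod.ext rfl (by simpa using ha.2)

theorem NodeJoined.mem_of_exit {M : Set (ℕ × ℕ)} {a b : ℕ × ℕ} (hab : NodeJoined M a b) {h j : ℕ}
    (ha : a ∈ below h j) (hb : b ∉ below h j) : (h, j) ∈ M ∧ (h + 1, j / 2) ∈ M := by
  induction hab with
  | refl => exact absurd ha hb
  | @tail b c _ hbc ih =>
    by_cases hb' : b ∈ below h j
    · obtain ⟨hbM, hcM, rfl | rfl⟩ := hbc
      · obtain rfl := eq_of_mem_below_of_parent_notMem hb' hb
        exact ⟨hbM, hcM⟩
      · exact absurd ((parent_mem_below_iff hb'.1).1 hb') hb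
    · exact ih hb'

/-- The gap between the leaves `g` and `g + 1` is jumped by `M` if some leaves on both sides of it
are joined in `M`. -/
def Jumps (M : Set (ℕ × ℕ)) (g : ℕ) : Prop := ∃ p q, p ≤ g ∧ g < q ∧ NodeJoined M (0, p) (0, q)

theorem Jumps.mem_right_child {M : Set (ℕ × ℕ)} {i J : ℕ} (h : Jumps M ((2 * J + 1) * 2 ^ i - 1))
    (hright : ¬ Jumps M ((2 * J + 2) * 2 ^ i - 1)) : (i, 2 * J + 1) ∈ M ∧ (i + 1, J) ∈ M := by
  obtain ⟨p, q, hp, hq, hpq⟩ := h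
  have hpos : 0 < 2 ^ i ∧ 0 < (2 * J + 1) * 2 ^ i := ⟨by positivity, by positivity⟩
  have hend : (2 * J + 2) * 2 ^ i = (2 * J + 1) * 2 ^ i + 2 ^ i := by ring
  have hqend : q < (2 * J + 2) * 2 ^ i := by
    by_contra hcon
    exact hright ⟨p, q, by omega, by omega, hpq⟩
  have hmem := hpq.symm.mem_of_exit (h := i) (j := 2 * J + 1) (leaf_mem_below.2 ⟨by omega, hqend⟩)
    (by rw [leaf_mem_below]; omega)
  rwa [show (2 * J + 1) / 2 = J by omega] at hmem

theorem Jumps.mem_left_child {M : Set (ℕ × ℕ)} {i J : ℕ} (h : Jumps M ((2 * J + 1) * 2 ^ i - 1))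
    (hleft : ¬ Jumps M (2 * J * 2 ^ i - 1)) : (i, 2 * J) ∈ M ∧ (i + 1, J) ∈ M := by
  obtain ⟨p, q, hp, hq, hpq⟩ := h
  have hpos : 0 < 2 ^ i := by positivity
  have hend : (2 * J + 1) * 2 ^ i = 2 * J * 2 ^ i + 2 ^ i := by ring
  have hpend : 2 * J * 2 ^ i ≤ p := by
    by_contra hcon
    exact hleft ⟨p, q, by omega, by omega, hpq⟩
  have hmem := hpq.mem_of_exit (h := i) (j := 2 * J) (leaf_mem_below.2 ⟨hpend, by omega⟩)
    (by rw [leaf_mem_below]; omega)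
  rwa [show 2 * J / 2 = J by omega] at hmem

theorem not_jumps_middle {n : ℕ} {M : Set (ℕ × ℕ)} (hroot : (n + 1, 0) ∉ M) :
    ¬ Jumps M (2 ^ n - 1) := by
  rintro ⟨p, q, hp, hq, hpq⟩
  have hpos : 0 < 2 ^ n := by positivity
  exact hroot (hpq.mem_of_exit (h := n) (j := 0) (leaf_mem_below.2 (by omega))
    (by rw [leaf_mem_below]; omega)).2

theorem parents_mem_of_not_jumps {M : Bool → Set (ℕ × ℕ)} (hdisj : ∀ x, Disjoint (M x) (M !x))
    {i J : ℕ} (hjump : ∀ x, ¬ Jumps (M x) ((2 * J + 2) * 2 ^ i - 1))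
    (hleft : ∃ x, Jumps (M x) ((2 * J + 1) * 2 ^ i - 1))
    (hright : ∃ x, Jumps (M x) ((2 * (J + 1) + 1) * 2 ^ i - 1)) {x : Bool}
    (hx : (i, 2 * J + 1) ∈ M x) (hy : (i, 2 * J + 2) ∈ M !x) :
    (i + 1, J) ∈ M x ∧ (i + 1, J + 1) ∈ M !x := by
  constructor
  · obtain ⟨z, hz⟩ := hleft
    obtain ⟨hchild, hparent⟩ := hz.mem_right_child (hjump z)
    obtain rfl : z = x := by
      by_contra hne
      exact Set.disjoint_left.1 (hdisj x) hx (Bool.eq_not.2 hne ▸ hchild)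
    exact hparent
  · obtain ⟨z, hz⟩ := hright
    obtain ⟨hchild, hparent⟩ := hz.mem_left_child (hjump z)
    obtain rfl : z = !x := by
      by_contra hne
      exact Set.disjoint_left.1 (hdisj x) (Bool.ne_not.1 hne ▸ hchild) hy
    exact hparent

theorem spines_mem_of_not_jumps {n k c : ℕ} {M : Bool → Set (ℕ × ℕ)}
    (hdisj : ∀ x, Disjoint (M x) (M !x)) (hc : 0 < c) (hcn : c < 2 ^ (n - k)) (hkn : k ≤ n)
    (hjump : ∀ x, ¬ Jumps (M x) (c * 2 ^ k - 1))
    (hlower : ∀ i < k, ∀ J < 2 ^ (n - (i + 1)), ∃ x, Jumps (M x) ((2 * J + 1) * 2 ^ i - 1))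
    {x : Bool} (hx : (0, c * 2 ^ k - 1) ∈ M x) (hy : (0, c * 2 ^ k) ∈ M !x) :
    ∀ i ≤ k, (i, c * 2 ^ (k - i) - 1) ∈ M x ∧ (i, c * 2 ^ (k - i)) ∈ M !x := by
  intro i
  induction i with
  | zero => exact fun _ => ⟨hx, hy⟩
  | succ i ih =>
    intro hi
    obtain ⟨ihx, ihy⟩ := ih (by omega)
    obtain ⟨J, hJ⟩ : ∃ J, c * 2 ^ (k - (i + 1)) = J + 1 :=
      Nat.exists_eq_succ_of_ne_zero (by positivity)
    have hchild : c * 2 ^ (k - i) = 2 * J + 2 := by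
      rw [show k - i = k - (i + 1) + 1 by omega, pow_succ, ← mul_assoc, hJ]
      ring
    have hleaf : c * 2 ^ k = (2 * J + 2) * 2 ^ i := by
      rw [← hchild, mul_assoc, ← pow_add, Nat.sub_add_cancel (by omega)]
    have hJn : J + 1 < 2 ^ (n - (i + 1)) := by
      rw [← hJ, show n - (i + 1) = n - k + (k - (i + 1)) by omega, pow_add]
      exact Nat.mul_lt_mul_of_pos_right hcn (by positivity)
    rw [hleaf] at hjump
    rw [hchild] at ihx ihy
    rw [hJ]
    exact parents_mem_of_not_jumps hdisj hjump (hlower i (by omega) J (by omega))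
      (hlower i (by omega) (J + 1) hJn) ihx ihy

theorem exists_lowest_not_jumps {ι : Type*} {n : ℕ} (hn : 1 ≤ n) {M : ι → Set (ℕ × ℕ)}
    (hroot : ∀ x, (n, 0) ∉ M x) :
    ∃ k < n, (∃ j < 2 ^ (n - (k + 1)), ∀ x, ¬ Jumps (M x) ((2 * j + 1) * 2 ^ k - 1)) ∧
      ∀ i < k, ∀ J < 2 ^ (n - (i + 1)), ∃ x, Jumps (M x) ((2 * J + 1) * 2 ^ i - 1) := by
  classical
  have hex : ∃ k, k < n ∧ ∃ j < 2 ^ (n - (k + 1)),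
      ∀ x, ¬ Jumps (M x) ((2 * j + 1) * 2 ^ k - 1) := by
    obtain ⟨k, rfl⟩ := Nat.exists_eq_add_of_le' hn
    exact ⟨k, by omega, 0, by positivity, fun x => by simpa using not_jumps_middle (hroot x)⟩
  obtain ⟨hkn, hk⟩ := Nat.find_spec hex
  refine ⟨Nat.find hex, hkn, hk, fun i hi J hJ => ?_⟩
  by_contra! hcon
  exact Nat.find_min hex hi ⟨hi.trans hkn, J, hJ, hcon⟩

-- The ends of a lowest gap that neither set jumps would extend to whole spines of the two subtrees
-- next to the gap, and the tops of these subtrees are siblings.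
theorem exists_not_jumps {n : ℕ} (hn : 1 ≤ n) {M : Bool → Set (ℕ × ℕ)}
    (hdisj : ∀ x, Disjoint (M x) (M !x))
    (hsibling : ∀ x h j, h < n → (h, 2 * j) ∈ M x → (h, 2 * j + 1) ∉ M !x)
    (hroot : ∀ x, (n, 0) ∉ M x) :
    ∃ g, g + 1 < 2 ^ n ∧ (∀ x, ¬ Jumps (M x) g) ∧ ∀ x, (0, g) ∈ M x → (0, g + 1) ∉ M !x := by
  obtain ⟨k, hkn, ⟨j, hj, hjump⟩, hlower⟩ := exists_lowest_not_jumps hn hroot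
  have hjn : 2 * j + 1 < 2 ^ (n - k) := by
    rw [show n - k = n - (k + 1) + 1 by omega, pow_succ]
    omega
  have hgap : (2 * j + 1) * 2 ^ k - 1 + 1 = (2 * j + 1) * 2 ^ k :=
    Nat.sub_add_cancel (Nat.mul_pos (by omega) (by positivity))
  refine ⟨(2 * j + 1) * 2 ^ k - 1, ?_, hjump, fun x hx hy => ?_⟩
  · rw [hgap, ← Nat.sub_add_cancel hkn.le, pow_add]
    exact Nat.mul_lt_mul_of_pos_right (by simpa using hjn) (by positivity)
  · rw [hgap] at hy
    have htop := spines_mem_of_not_jumps hdisj (by omega) hjn hkn.le hjump hlower hx hy k le_rfl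
    simp only [Nat.sub_self, pow_zero, mul_one, Nat.add_sub_cancel] at htop
    exact hsibling x k j hkn htop.1 htop.2

end NodeTree

/-! ### The gadget has no fat model -/

namespace Gadget

open LongVertex GadgetVertex GadgetEdge GraphSpace NodeTree

variable {n : ℕ}

/-- The tree nodes in a set of vertices. -/
def nodes (M : Set (LongVertex (GadgetVertex n) (GadgetEdge n) (gadget n).m)) : Set (ℕ × ℕ) :=
  {p | ∃ hh hj, base (node p.1 p.2 hh hj) ∈ M}

/-- The part of the gadget to the left of the gap `g`, as seen from a set `M` of nodes: a node
counts as left if it is joined in `M` to a leaf on the left, and the frame vertices at the left ends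
of the rows are included. -/
def leftOf (M : Set (ℕ × ℕ)) (g : ℕ) : Set (GadgetVertex n) :=
  {v | match v with
    | frame u => ∃ x, u = startFrame x
    | node h j _ _ => ∃ p ≤ g, NodeJoined M (0, p) (h, j)
    | bot i _ => i ≤ g}

theorem lev_mem_leftOf {M : Set (ℕ × ℕ)} {g i : ℕ} (hjump : ¬ Jumps M g) {a : Bool}
    {hi : i < 2 ^ n} : lev a i hi ∈ leftOf M g ↔ i ≤ g := by
  cases a
  · exact Iff.rfl
  · refine ⟨fun ⟨p, hp, hpi⟩ => ?_, fun hig => ⟨i, hig, .refl⟩⟩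
    by_contra! hig
    exact hjump ⟨p, i, hp, hig, hpi⟩

-- If no edge crosses the gap within `M`, then `leftOf` separates the two ends of the row in `M`.
theorem exists_lev_mem_of_not_jumps
    {M : Set (LongVertex (GadgetVertex n) (GadgetEdge n) (gadget n).m)}
    (hM : ((gadget n).graph.induce M).Preconnected) {x : Bool}
    (hf : ∀ u, base (frame u) ∈ M → u = startFrame x ∨ u = finishFrame x)
    (hroot : base root ∉ M) (hstart : base (lev x 0 (by positivity)) ∈ M)
    {c : Bool} (hfinish : base (lev c (2 ^ n - 1) (last_lt n)) ∈ M)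
    {g : ℕ} (hg : g + 1 < 2 ^ n) (hjump : ¬ Jumps (nodes M) g) :
    ∃ a b, (a && b) = false ∧ base (lev a g (Nat.lt_of_succ_lt hg)) ∈ M ∧
      base (lev b (g + 1) hg) ∈ M := by
  by_contra! hcon
  have hlev {a i hi} : lev a i hi ∈ (leftOf (nodes M) g : Set (GadgetVertex n)) ↔ i ≤ g :=
    lev_mem_leftOf hjump
  have hlast : 2 ^ n - 1 ≤ g := hlev.1 <| LongGraph.mem_of_preconnected_induce hM
    (L := leftOf (nodes M) g) ?_ ?_ hstart (hlev.2 (Nat.zero_le g)) hfinish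
  · omega
  · rintro _ _ ⟨h, j, hh, hj, hh', hj'⟩ hchild hparent
    have hstep : TreeStep (nodes M) (h, j) (h + 1, j / 2) :=
      ⟨⟨hh, hj, hchild⟩, ⟨hh', hj', hparent⟩, Or.inl rfl⟩
    exact ⟨fun ⟨p, hp, hpj⟩ => ⟨p, hp, hpj.tail hstep⟩,
      fun ⟨p, hp, hpj⟩ => ⟨p, hp, hpj.trans (NodeJoined.symm (.single hstep))⟩⟩
  · intro e hsrc htgt _
    cases e with
    | fr u v huv hpair =>
      have hframe : ∀ x, ¬ finishFrame x < startFrame x ∧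
          FramePair (startFrame x) (finishFrame x) := by decide
      rcases hf u hsrc with rfl | rfl <;> rcases hf v htgt with rfl | rfl
      · exact absurd huv (lt_irrefl _)
      · exact absurd (hframe x).2 hpair
      · exact absurd huv (hframe x).1
      · exact absurd huv (lt_irrefl _)
    | gap a b hab i hi =>
      have hne : i ≠ g := by
        rintro rfl
        exact hcon a b hab hsrc htgt
      exact hlev.trans ((by omega : i ≤ g ↔ i + 1 ≤ g).trans hlev.symm)
    | start y => exact iff_of_true ⟨y, rfl⟩ (hlev.2 (Nat.zero_le g))
    | finish b y =>
      have hne : ∀ y z, finishFrame y ≠ startFrame z := by decide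
      exact iff_of_false (fun h => absurd (hlev.1 h) (by omega)) fun ⟨z, hz⟩ => hne y z hz
    | apex y => exact absurd hsrc hroot

theorem disjoint_nodes {M N : Set (LongVertex (GadgetVertex n) (GadgetEdge n) (gadget n).m)}
    (h : Disjoint M N) : Disjoint (nodes M) (nodes N) :=
  Set.disjoint_left.2 fun _ ⟨_, _, hM⟩ ⟨_, _, hN⟩ => Set.disjoint_left.1 h hM hN

theorem sibling_notMem_nodes_verts {S S' : Set (GraphSpace (gadget n).graph)}
    (hfar : 3 ≤ setDist S S') {h j : ℕ} (hh : h < n) (hS : (h, 2 * j) ∈ nodes (verts S)) :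
    (h, 2 * j + 1) ∉ nodes (verts S') := by
  rintro ⟨hh', hj', hS'⟩
  obtain ⟨_, hj, hS⟩ := hS
  have hpow : 2 ^ (n - h) = 2 * 2 ^ (n - (h + 1)) := by
    rw [← pow_succ', show n - h = n - (h + 1) + 1 by omega]
  have hadj (i : ℕ) (hi : i < 2 ^ (n - h)) (hij : i / 2 = j) :
      (gadget n).graph.Adj (base (node h i hh.le hi)) (base (node (h + 1) j hh (by omega))) := by
    subst hij
    exact LongGraph.adj_of_step (.short (.up h i hh.le hi hh (by omega))) (by simp)
  exact notMem_verts_of_adj_of_adj hfar (hadj _ hj (by omega)) (hadj _ hj' (by omega)).symm hS hS'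

theorem eq_of_mem_ports_startFrame {x : Bool} {c : GadgetVertex n}
    (hc : c ∈ ports (startFrame x)) : c = lev x 0 (by positivity) := by
  rcases hc with ⟨y, hxy, rfl⟩ | ⟨a, y, hxy, -⟩ | ⟨y, hxy, -⟩
  · obtain rfl : x = y := by revert x y; decide
    rfl
  · exact absurd hxy (by revert x y; decide)
  · exact absurd hxy (by revert x y; decide)

theorem exists_eq_of_mem_ports_finishFrame {x : Bool} {c : GadgetVertex n}
    (hc : c ∈ ports (finishFrame x)) : ∃ a, c = lev a (2 ^ n - 1) (last_lt n) := by
  rcases hc with ⟨y, hxy, -⟩ | ⟨a, y, -, rfl⟩ | ⟨y, hxy, -⟩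
  · exact absurd hxy (by revert x y; decide)
  · exact ⟨a, rfl⟩
  · exact absurd hxy (by revert x y; decide)

theorem eq_of_mem_ports_apexFrame {x : Bool} {c : GadgetVertex n}
    (hc : c ∈ ports (apexFrame x)) : c = root := by
  rcases hc with ⟨y, hxy, -⟩ | ⟨a, y, hxy, -⟩ | ⟨y, -, rfl⟩
  · exact absurd hxy (by revert x y; decide)
  · exact absurd hxy (by revert x y; decide)
  · rfl

-- Each of the four vertices at the gap lies in at most one of the two sets, and a set that uses
-- two bottom vertices would leave two leaves to the other one.
theorem exists_leaf_mem_nodes_of_gap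
    {M : Bool → Set (LongVertex (GadgetVertex n) (GadgetEdge n) (gadget n).m)}
    (hdisj : ∀ x, Disjoint (M x) (M !x)) {g : ℕ} (hg : g + 1 < 2 ^ n)
    (hgap : ∀ x, ∃ a b, (a && b) = false ∧ base (lev a g (Nat.lt_of_succ_lt hg)) ∈ M x ∧
      base (lev b (g + 1) hg) ∈ M x) :
    ∃ x, (0, g) ∈ nodes (M x) ∧ (0, g + 1) ∈ nodes (M !x) := by
  have hnode {i hi x} (h : base (lev true i hi) ∈ M x) : (0, i) ∈ nodes (M x) :=
    ⟨Nat.zero_le n, hi, h⟩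
  obtain ⟨a, b, hab, ha, hb⟩ := hgap true
  obtain ⟨a', b', hab', ha', hb'⟩ := hgap false
  have haa' : a ≠ a' := by
    rintro rfl
    exact Set.disjoint_left.1 (hdisj true) ha ha'
  have hbb' : b ≠ b' := by
    rintro rfl
    exact Set.disjoint_left.1 (hdisj true) hb hb'
  have hcross : ∀ a b a' b' : Bool, (a && b) = false → (a' && b') = false → a ≠ a' → b ≠ b' →
      (a = true ∧ b' = true) ∨ (a' = true ∧ b = true) := by decide
  rcases hcross a b a' b' hab hab' haa' hbb' with ⟨rfl, rfl⟩ | ⟨rfl, rfl⟩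
  · exact ⟨true, hnode ha, hnode hb'⟩
  · exact ⟨false, hnode ha', hnode hb⟩

theorem false_of_strands (hn : 1 ≤ n) {R : Bool → Set (GraphSpace (gadget n).graph)}
    {T : Set (GraphSpace (gadget n).graph)} (hR : ∀ x, IsPreconnected (R x))
    (hT : IsPreconnected T)
    (hRf : ∀ x u, base (frame u) ∈ touched (R x) ↔ u = startFrame x ∨ u = finishFrame x)
    (hTf : ∀ u, base (frame u) ∈ touched T ↔ u = apexFrame true ∨ u = apexFrame false)
    (hRR : ∀ x, 3 ≤ setDist (R x) (R !x)) (hRT : ∀ x, 3 ≤ setDist (R x) T) : False := by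
  have hverts {A B : Set (GraphSpace (gadget n).graph)} (h : 3 ≤ setDist A B) :
      Disjoint (verts A) (verts B) :=
    (disjoint_touched h).mono (verts_subset_touched A) (verts_subset_touched B)
  have hroot (x : Bool) : base root ∉ verts (R x) := by
    obtain ⟨c, hc, hcT⟩ := exists_mem_ports hT (Or.inl (by decide)) hTf
    obtain rfl := eq_of_mem_ports_apexFrame hc
    exact Set.disjoint_right.1 (hverts (hRT x)) hcT
  have hstart (x : Bool) : base (lev x 0 (by positivity)) ∈ verts (R x) := by
    obtain ⟨c, hc, hcR⟩ := exists_mem_ports (hR x) (Or.inl (by revert x; decide)) (hRf x)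
    obtain rfl := eq_of_mem_ports_startFrame hc
    exact hcR
  have hfinish (x : Bool) : ∃ a, base (lev a (2 ^ n - 1) (last_lt n)) ∈ verts (R x) := by
    obtain ⟨c, hc, hcR⟩ := exists_mem_ports (hR x) (Or.inr (by revert x; decide))
      fun w => (hRf x w).trans or_comm
    obtain ⟨a, rfl⟩ := exists_eq_of_mem_ports_finishFrame hc
    exact ⟨a, hcR⟩
  obtain ⟨g, hg, hjump, hleaf⟩ := exists_not_jumps hn (M := fun x => nodes (verts (R x)))
    (fun x => disjoint_nodes (hverts (hRR x)))
    (fun x h j hh => sibling_notMem_nodes_verts (hRR x) hh) (fun x ⟨_, _, h⟩ => hroot x h)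
  obtain ⟨x, hx, hy⟩ := exists_leaf_mem_nodes_of_gap (fun x => hverts (hRR x)) hg fun x =>
    exists_lev_mem_of_not_jumps (preconnected_induce_verts (hR x))
      (fun u hu => (hRf x u).1 (verts_subset_touched _ hu)) (hroot x) (hstart x)
      (hfinish x).choose_spec hg (hjump x)
  exact hleaf x hx hy

theorem not_hasFatMinor (hn : 1 ≤ n) :
    ¬ HasFatMinor (⊤ : SimpleGraph (Fin 20)) 3 (GraphSpace (gadget n).graph) := by
  rintro ⟨𝓕⟩
  obtain ⟨S, hS, hfar, hSf⟩ := exists_strands 𝓕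
  have hne : ∀ x, startFrame x ≠ finishFrame x := by decide
  have hne' : apexFrame true ≠ apexFrame false := by decide
  refine false_of_strands hn (R := fun x => S (startFrame x) (finishFrame x))
    (T := S (apexFrame true) (apexFrame false)) (fun x => hS _ _ (hne x)) (hS _ _ hne')
    (fun x u => hSf _ _ u (hne x)) (fun u => hSf _ _ u hne') (fun x => ?_) fun x => ?_
  · refine hfar _ _ _ _ (hne x) (hne !x) ?_ ?_ ?_ ?_ <;> revert x <;> decide
  · refine hfar _ _ _ _ (hne x) hne' ?_ ?_ ?_ ?_ <;> revert x <;> decide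

end Gadget

/-! ### Drawings of graphs in metric spaces -/

/-- A drawing of a graph in a metric space: a point for each vertex and, for each edge, a
path-connected set that contains the points of its ends and stays within distance `r` of them. -/
structure Drawing {V : Type*} (G : SimpleGraph V) (X : Type*) [EMetricSpace X] (r : ℝ≥0∞) where
  pt : V → X
  arc : V → V → Set X
  isPathConnected_arc : ∀ a b, G.Adj a b → IsPathConnected (arc a b)
  left_mem : ∀ a b, G.Adj a b → pt a ∈ arc a b
  right_mem : ∀ a b, G.Adj a b → pt b ∈ arc a b
  edist_le : ∀ a b, G.Adj a b → ∀ y ∈ arc a b, edist y (pt a) ≤ r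

/-- The distance of any two vertices from `S` and `S'` is at least `d`. -/
def FarApart {V : Type*} (G : SimpleGraph V) (d : ℕ∞) (S S' : Set V) : Prop :=
  ∀ a ∈ S, ∀ b ∈ S', d ≤ G.edist a b

theorem FarApart.symm {V : Type*} {G : SimpleGraph V} {d : ℕ∞} {S S' : Set V}
    (h : FarApart G d S S') : FarApart G d S' S :=
  fun a ha b hb => SimpleGraph.edist_comm (G := G) ▸ h b hb a ha

namespace Drawing

variable {V : Type*} {G : SimpleGraph V} {X : Type*} [EMetricSpace X] {r s s' : ℝ≥0∞}
  (D : Drawing G X r) {S S' : Set V} {Y Y' : Set X} {a b : V}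

/-- The drawing of the subgraph induced by a set of vertices. -/
def img (S : Set V) : Set X :=
  {y | ∃ a ∈ S, y = D.pt a ∨ ∃ b ∈ S, G.Adj a b ∧ y ∈ D.arc a b}

theorem pt_mem_img (h : a ∈ S) : D.pt a ∈ D.img S := ⟨a, h, Or.inl rfl⟩

theorem arc_subset_img (ha : a ∈ S) (hb : b ∈ S) (hab : G.Adj a b) : D.arc a b ⊆ D.img S :=
  fun _ hy => ⟨a, ha, Or.inr ⟨b, hb, hab, hy⟩⟩

theorem joinedIn_of_adj (ha : a ∈ S) (hb : b ∈ S) (hab : G.Adj a b) :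
    JoinedIn (D.img S) (D.pt a) (D.pt b) :=
  ((D.isPathConnected_arc a b hab).joinedIn _ (D.left_mem a b hab) _ (D.right_mem a b hab)).mono
    (D.arc_subset_img ha hb hab)

theorem exists_joinedIn {y : X} (hy : y ∈ D.img S) : ∃ a ∈ S, JoinedIn (D.img S) (D.pt a) y := by
  obtain ⟨a, ha, rfl | ⟨b, hb, hab, hy⟩⟩ := hy
  · exact ⟨a, ha, .refl (D.pt_mem_img ha)⟩
  · exact ⟨a, ha, ((D.isPathConnected_arc a b hab).joinedIn _ (D.left_mem a b hab) _ hy).mono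
      (D.arc_subset_img ha hb hab)⟩

theorem isPathConnected_img (ha : a ∈ S) (h : ∀ b ∈ S, JoinedIn (D.img S) (D.pt a) (D.pt b)) :
    IsPathConnected (D.img S) := by
  refine ⟨D.pt a, D.pt_mem_img ha, fun {y} hy => ?_⟩
  obtain ⟨b, hb, hby⟩ := D.exists_joinedIn hy
  exact (h b hb).trans hby

/-- Every point of `Y` is at distance at most `s` from the drawing of some vertex of `S`. -/
def Near (s : ℝ≥0∞) (Y : Set X) (S : Set V) : Prop := ∀ y ∈ Y, ∃ a ∈ S, edist y (D.pt a) ≤ s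

/-- Sets within distance `s` of the drawings of two sets of vertices at distance at least `d` have
distance at least `ε`. -/
def Separates (d : ℕ∞) (s ε : ℝ≥0∞) : Prop :=
  ∀ ⦃S S' : Set V⦄ ⦃Y Y' : Set X⦄, FarApart G d S S' → D.Near s Y S → D.Near s Y' S' →
    ε ≤ setDist Y Y'

theorem near_img (S : Set V) : D.Near r (D.img S) S := by
  rintro y ⟨a, ha, rfl | ⟨b, -, hab, hy⟩⟩
  · exact ⟨a, ha, by simp⟩
  · exact ⟨a, ha, D.edist_le a b hab y hy⟩

variable {D}

theorem Near.mono_left (h : D.Near s Y S) (hs : s ≤ s') : D.Near s' Y S := fun y hy => by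
  obtain ⟨a, ha, hya⟩ := h y hy
  exact ⟨a, ha, hya.trans hs⟩

theorem le_setDist_of_near {c : ℝ≥0∞} (hs : s ≠ ∞) (hs' : s' ≠ ∞) (hY : D.Near s Y S)
    (hY' : D.Near s' Y' S') (h : ∀ a ∈ S, ∀ b ∈ S', s + c + s' ≤ edist (D.pt a) (D.pt b)) :
    c ≤ setDist Y Y' := by
  refine le_setDist fun y hy y' hy' => ?_
  obtain ⟨a, ha, hya⟩ := hY y hy
  obtain ⟨b, hb, hyb⟩ := hY' y' hy'
  have hle : s + c + s' ≤ s + edist y y' + s' :=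
    calc s + c + s' ≤ edist (D.pt a) (D.pt b) := h a ha b hb
      _ ≤ edist (D.pt a) y + edist y y' + edist y' (D.pt b) := edist_triangle4 _ _ _ _
      _ ≤ s + edist y y' + s' := by
        gcongr
        rwa [edist_comm]
  rwa [ENNReal.add_le_add_iff_right hs', ENNReal.add_le_add_iff_left hs] at hle

theorem separates_of_le_edist {d : ℕ∞} {ε : ℝ≥0∞} (hs : s ≠ ∞)
    (h : ∀ a b, d ≤ G.edist a b → s + ε + s ≤ edist (D.pt a) (D.pt b)) : D.Separates d s ε :=
  fun _ _ _ _ hSS hY hY' =>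
    le_setDist_of_near hs hs hY hY' fun a ha b hb => h a b (hSS a ha b hb)

end Drawing

theorem isPathConnected_range_path {X : Type*} [TopologicalSpace X] {x y : X} (γ : Path x y) :
    IsPathConnected (Set.range γ) :=
  have : PathConnectedSpace unitInterval := isPathConnected_iff_pathConnectedSpace.1 <|
    (convex_Icc (0 : ℝ) 1).isPathConnected ⟨0, by simp⟩
  isPathConnected_range γ.continuous

theorem IsLengthSpace.exists_isPathConnected {X : Type*} [EMetricSpace X] (hX : IsLengthSpace X)
    {x y : X} (hxy : edist x y ≠ ∞) {ε : ℝ≥0∞} (hε : 0 < ε) :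
    ∃ Y, IsPathConnected Y ∧ x ∈ Y ∧ y ∈ Y ∧ ∀ z ∈ Y, edist z x ≤ edist x y + ε := by
  obtain ⟨γ, hγ⟩ := hX x y hxy ε hε
  refine ⟨Set.range γ, isPathConnected_range_path γ, ⟨0, γ.source⟩, ⟨1, γ.target⟩, ?_⟩
  rintro _ ⟨t, rfl⟩
  have ht := edist_apply_le_pathLength γ t 0
  rw [γ.source] at ht
  exact ht.trans hγ

namespace IsQuasiIsometry

variable {X Y : Type*} [EMetricSpace X] [EMetricSpace Y] {q : ℕ}

theorem le_edist_of_mul_add_le {φ : X → Y} (hφ : IsQuasiIsometry q φ) (hq : 1 ≤ q) {c : ℝ≥0∞}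
    {x y : X} (h : q * (c + q) ≤ edist x y) : c ≤ edist (φ x) (φ y) := by
  have hq' : (q : ℝ≥0∞) ≠ 0 := Nat.cast_ne_zero.2 (by omega)
  refine le_trans (ENNReal.le_sub_of_add_le_right (by simp) ?_) (hφ.1 x y).1
  calc c + q = (q : ℝ≥0∞)⁻¹ * (q * (c + q)) := by
        rw [← mul_assoc, ENNReal.inv_mul_cancel hq' (by simp), one_mul]
    _ ≤ (q : ℝ≥0∞)⁻¹ * edist x y := by gcongr

theorem exists_drawing {V : Type*} {G : SimpleGraph V} (hX : IsLengthSpace X) (hq : 1 ≤ q)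
    {φ : GraphSpace G → X} (hφ : IsQuasiIsometry q φ) : ∃ D : Drawing G X (3 * q),
      ∀ (c : ℝ≥0∞) (a b : V), (q * (c + q) : ℝ≥0∞) ≤ G.edist a b →
        c ≤ edist (D.pt a) (D.pt b) := by
  have hq' : (1 : ℝ≥0∞) ≤ q := Nat.one_le_cast.2 hq
  have hadj (a b : V) (hab : G.Adj a b) :
      edist (φ (GraphSpace.vert G a)) (φ (GraphSpace.vert G b)) ≤ 2 * q :=
    calc _ ≤ (q : ℝ≥0∞) * edist (GraphSpace.vert G a) (GraphSpace.vert G b) + q := (hφ.1 _ _).2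
      _ ≤ (q : ℝ≥0∞) * 1 + q := by
        gcongr
        exact GraphSpace.edist_vert_le_one hab
      _ = 2 * q := by ring
  have harc (a b : V) (hab : G.Adj a b) := hX.exists_isPathConnected
    (ne_top_of_le_ne_top (ENNReal.mul_ne_top (by simp) (by simp)) (hadj a b hab)) one_pos
  choose! Y hY hYa hYb hYr using harc
  refine ⟨⟨fun a => φ (GraphSpace.vert G a), Y, hY, hYa, hYb, fun a b hab y hy => ?_⟩,
    fun c a b h => hφ.le_edist_of_mul_add_le hq (h.trans (GraphSpace.edist_le_edist_vert a b))⟩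
  calc edist y (φ (GraphSpace.vert G a)) ≤ 2 * q + 1 :=
        (hYr a b hab y hy).trans (by gcongr; exact hadj a b hab)
    _ ≤ 2 * q + q := by gcongr
    _ = 3 * q := by ring

theorem exists_separates {V : Type*} {G : SimpleGraph V} (hX : IsLengthSpace X) (hq : 1 ≤ q)
    {φ : GraphSpace G → X} (hφ : IsQuasiIsometry q φ) {d : ℕ∞} {s ε : ℝ≥0∞} (hs : s ≠ ∞)
    (hd : q * (s + ε + s + q) ≤ (d : ℝ≥0∞)) : ∃ D : Drawing G X (3 * q), D.Separates d s ε := by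
  obtain ⟨D, hD⟩ := hφ.exists_drawing hX hq
  exact ⟨D, Drawing.separates_of_le_edist hs fun a b hab =>
    hD _ a b (hd.trans (ENat.toENNReal_le.2 hab))⟩

end IsQuasiIsometry

/-! ### Grouping a sequence of sets into runs -/

theorem count_mem_eq_of_forall_notMem {cut : Finset ℕ} {i j : ℕ} (hij : i ≤ j)
    (h : ∀ g, i ≤ g → g < j → g ∉ cut) : Nat.count (· ∈ cut) i = Nat.count (· ∈ cut) j := by
  induction j, hij using Nat.le_induction with
  | base => rfl
  | succ j hij ih =>
    rw [ih fun g hig hgj => h g hig (by omega), Nat.count_succ, if_neg (h j hij (by omega)),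
      add_zero]

/-- A run: a maximal interval of `{0, …, N - 1}` with no cut between consecutive elements, a cut
being placed after each element of `cut`. -/
structure IsRun (N : ℕ) (cut : Finset ℕ) (s t : ℕ) : Prop where
  le : s ≤ t
  lt : t < N
  left : s = 0 ∨ s - 1 ∈ cut
  right : t + 1 = N ∨ t ∈ cut
  uncut : ∀ g, s ≤ g → g < t → g ∉ cut

theorem exists_isRun {N : ℕ} (cut : Finset ℕ) {i : ℕ} (hi : i < N) :
    ∃ s t, IsRun N cut s t ∧ s ≤ i ∧ i ≤ t := by
  have hs : ∃ s, s ≤ i ∧ ∀ g, s ≤ g → g < i → g ∉ cut := ⟨i, le_rfl, fun g _ _ => by omega⟩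
  have ht : ∃ t, i ≤ t ∧ (t + 1 = N ∨ t ∈ cut) := ⟨N - 1, by omega, Or.inl (by omega)⟩
  have hs_min := fun m => Nat.find_min hs (m := m)
  have ht_min := fun m => Nat.find_min ht (m := m)
  have hs_spec := Nat.find_spec hs
  have ht_spec := Nat.find_spec ht
  have ht_le : Nat.find ht ≤ N - 1 := Nat.find_min' ht ⟨by omega, Or.inl (by omega)⟩
  refine ⟨Nat.find hs, Nat.find ht, ⟨by omega, by omega, ?_, ht_spec.2, ?_⟩, hs_spec.1, ht_spec.1⟩
  · by_contra! hcon
    refine hs_min (Nat.find hs - 1) (by omega) ⟨by omega, fun g hg hgi => ?_⟩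
    grind
  · grind

namespace IsRun

variable {N : ℕ} {cut : Finset ℕ} {s t s' t' a b i : ℕ}

theorem count_eq (h : IsRun N cut s t) (hsi : s ≤ i) (hit : i ≤ t) :
    Nat.count (· ∈ cut) i = Nat.count (· ∈ cut) s :=
  (count_mem_eq_of_forall_notMem hsi fun g hsg hgi => h.uncut g hsg (by omega)).symm

theorem eq_of_mem (h : IsRun N cut s t) (h' : IsRun N cut s' t') (hsi : s ≤ i) (hit : i ≤ t)
    (hsi' : s' ≤ i) (hit' : i ≤ t') : s = s' ∧ t = t' := by
  grind [IsRun]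

theorem of_sdiff_Ico (h : IsRun N cut s t) (h' : IsRun N cut s' t') (hts : t < s')
    (hab : IsRun N (cut \ Finset.Ico t s') a b) : IsRun N cut a b ∨ a = s ∧ b = t' := by
  obtain ⟨hab_le, hbN, ha, hb, hg⟩ := hab
  have hst := h.le
  have hs't' := h'.le
  have ht'N := h'.lt
  simp only [Finset.mem_sdiff, Finset.mem_Ico] at ha hb hg
  rcases lt_or_ge b t with hbt | htb
  · exact Or.inl ⟨hab_le, hbN, by grind, by grind, fun g hag hgb hgc => by grind⟩
  rcases lt_or_ge s' a with hsa | has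
  · exact Or.inl ⟨hab_le, hbN, by grind, by grind, fun g hag hgb hgc => by grind⟩
  have hat : a ≤ t := by grind
  have hsb : s' ≤ b := by grind
  right
  constructor
  · rcases lt_trichotomy a s with has | has | has
    · exact absurd ⟨h.left.resolve_left (by omega), by omega⟩ (hg (s - 1) (by omega) (by omega))
    · exact has
    · exact absurd (ha.resolve_left (by omega)).1 (h.uncut _ (by omega) (by omega))
  · rcases lt_trichotomy b t' with hbt | hbt | hbt
    · exact absurd (hb.resolve_left (by omega)).1 (h'.uncut _ (by omega) (by omega))
    · exact hbt
    · exact absurd ⟨h'.right.resolve_left (by omega), by omega⟩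
        (hg t' (by omega) (by omega))

end IsRun

section Bridged

variable {X : Type*} [EMetricSpace X] {I : ℕ → Set X} {ε : ℝ≥0∞} {s t s' t' : ℕ} {A A' : Set X}

/-- The sets `I s` and `I t` lie in the path-connected set `A`, which stays close to the sets `I j`
with `s ≤ j ≤ t`. -/
structure Bridged (I : ℕ → Set X) (ε : ℝ≥0∞) (s t : ℕ) (A : Set X) : Prop where
  isPathConnected : IsPathConnected A
  left_subset : I s ⊆ A
  right_subset : I t ⊆ A
  exists_edist_le : ∀ y ∈ A, ∃ j, s ≤ j ∧ j ≤ t ∧ ∃ z ∈ I j, edist y z ≤ (t - s : ℕ) * ε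

theorem Bridged.refl (h : IsPathConnected (I s)) : Bridged I ε s s (I s) :=
  ⟨h, subset_rfl, subset_rfl, fun y hy => ⟨s, le_rfl, le_rfl, y, hy, by simp⟩⟩

theorem Bridged.exists_of_setDist_lt (h : Bridged I ε s t A) (h' : Bridged I ε s' t' A')
    (hst : s ≤ t) (hts' : t < s') (hst' : s' ≤ t') (hlt : setDist A A' < ε) :
    ∃ A'', Bridged I ε s t' A'' := by
  obtain ⟨x, hx, y, hy, γ, hγ⟩ := exists_path_of_setDist_lt hlt
  refine ⟨A ∪ Set.range γ ∪ A', ?_, fun z hz => Or.inl (Or.inl (h.left_subset hz)),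
    fun z hz => Or.inr (h'.right_subset hz), ?_⟩
  · exact (h.isPathConnected.union (isPathConnected_range_path γ) ⟨x, hx, 0, γ.source⟩).union
      h'.isPathConnected ⟨y, Or.inr ⟨1, γ.target⟩, hy⟩
  have hmono (m : ℕ) (hm : m ≤ t' - s) : (m * ε : ℝ≥0∞) ≤ (t' - s : ℕ) * ε := by gcongr
  rintro z ((hz | ⟨u, rfl⟩) | hz)
  · obtain ⟨j, hsj, hjt, w, hw, hzw⟩ := h.exists_edist_le z hz
    exact ⟨j, hsj, by omega, w, hw, hzw.trans (hmono _ (by omega))⟩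
  · obtain ⟨j, hsj, hjt, w, hw, hxw⟩ := h.exists_edist_le x hx
    have hux : edist (γ u) x ≤ ε := by
      simpa only [γ.source] using (edist_apply_le_pathLength γ u 0).trans hγ.le
    refine ⟨j, hsj, by omega, w, hw, ?_⟩
    calc edist (γ u) w ≤ edist (γ u) x + edist x w := edist_triangle _ _ _
      _ ≤ ε + (t - s : ℕ) * ε := add_le_add hux hxw
      _ = ((t - s + 1 : ℕ) : ℝ≥0∞) * ε := by push_cast; ring
      _ ≤ (t' - s : ℕ) * ε := hmono _ (by omega)
  · obtain ⟨j, hsj, hjt, w, hw, hzw⟩ := h'.exists_edist_le z hz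
    exact ⟨j, by omega, hjt, w, hw, hzw.trans (hmono _ (by omega))⟩

-- A set of cuts that is minimal subject to all runs being bridged: two runs at distance less than
-- `ε` could be bridged together, which would make the cuts between them superfluous.
theorem exists_bridged_runs {N : ℕ} (hI : ∀ i < N, IsPathConnected (I i)) (ε : ℝ≥0∞) :
    ∃ (cut : Finset ℕ) (A : ℕ → ℕ → Set X), (∀ s t, IsRun N cut s t → Bridged I ε s t (A s t)) ∧
      ∀ s t s' t', IsRun N cut s t → IsRun N cut s' t' → t < s' →
        ε ≤ setDist (A s t) (A s' t') := by
  have hrange : ∀ s t, IsRun N (Finset.range N) s t → ∃ A, Bridged I ε s t A := by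
    intro s t h
    obtain rfl : s = t := h.le.antisymm <| by
      by_contra! hlt
      exact h.uncut s le_rfl hlt (Finset.mem_range.2 (hlt.trans h.lt))
    exact ⟨I s, .refl (hI s h.lt)⟩
  obtain ⟨cut, -, hcut, hmin⟩ := exists_minimal_le_of_wellFoundedLT
    (fun cut => ∀ s t, IsRun N cut s t → ∃ A, Bridged I ε s t A) _ hrange
  choose! A hA using hcut
  refine ⟨cut, A, hA, fun s t s' t' h h' hts' => ?_⟩
  by_contra! hlt
  have ht : t ∈ cut := h.right.resolve_left (by have := h'.le; have := h'.lt; omega)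
  refine (Finset.mem_sdiff.1 <| hmin (y := cut \ Finset.Ico t s') (fun a b hab => ?_)
    Finset.sdiff_subset ht).2 (Finset.mem_Ico.2 ⟨le_rfl, hts'⟩)
  obtain hab | ⟨rfl, rfl⟩ := h.of_sdiff_Ico h' hts' hab
  · exact ⟨A a b, hA a b hab⟩
  · exact (hA a t h).exists_of_setDist_lt (hA s' b h') h.le hts' h'.le hlt

theorem exists_runs {N : ℕ} (hI : ∀ i < N, IsPathConnected (I i)) (ε : ℝ≥0∞) :
    ∃ (cut : Finset ℕ) (A : ℕ → Set X),
      (∀ i, i + 1 < N → i ∉ cut → A i = A (i + 1)) ∧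
      (∀ i < N, IsPathConnected (A i)) ∧
      (∀ i < N, (i = 0 ∨ i - 1 ∈ cut ∨ i + 1 = N ∨ i ∈ cut) → I i ⊆ A i) ∧
      (∀ i j, i < j → j < N → Nat.count (· ∈ cut) i ≠ Nat.count (· ∈ cut) j →
        ε ≤ setDist (A i) (A j)) ∧
      ∀ i < N, ∀ y ∈ A i, ∃ j < N, Nat.count (· ∈ cut) j = Nat.count (· ∈ cut) i ∧
        ∃ z ∈ I j, edist y z ≤ N * ε := by
  obtain ⟨cut, A, hA, hAA⟩ := exists_bridged_runs hI ε
  choose! s t hrun hs ht using fun i (hi : i < N) => exists_isRun cut hi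
  refine ⟨cut, fun i => A (s i) (t i), fun i hi hic => ?_,
    fun i hi => (hA _ _ (hrun i hi)).isPathConnected, fun i hi hend => ?_,
    fun i j hij hj hne => ?_, fun i hi y hy => ?_⟩
  · have hit : i + 1 ≤ t i := by
      have := (hrun i (by omega)).right
      grind
    obtain ⟨hss, htt⟩ := (hrun i (by omega)).eq_of_mem (hrun (i + 1) hi)
      ((hs i (by omega)).trans i.le_succ) hit (hs _ hi) (ht _ hi)
    simp only [hss, htt]
  · obtain his | hit : i = s i ∨ i = t i := by
      have := (hrun i hi).uncut
      have := (hrun i hi).lt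
      grind
    · exact (congrArg I his).trans_subset (hA _ _ (hrun i hi)).left_subset
    · exact (congrArg I hit).trans_subset (hA _ _ (hrun i hi)).right_subset
  · have hi : i < N := hij.trans hj
    refine hAA _ _ _ _ (hrun i hi) (hrun j hj) (not_le.1 fun hle => hne ?_)
    rw [(hrun i hi).count_eq (hs i hi) (ht i hi), (hrun j hj).count_eq (hs j hj) (ht j hj)]
    have := (hrun i hi).eq_of_mem (hrun j hj) (i := max (s i) (s j))
    have := (hrun i hi).le
    have := (hrun j hj).le
    grind
  · obtain ⟨j, hsj, hjt, z, hz, hyz⟩ := (hA _ _ (hrun i hi)).exists_edist_le y hy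
    have htN := (hrun i hi).lt
    refine ⟨j, by omega, ?_, z, hz, hyz.trans (by gcongr; omega)⟩
    rw [(hrun i hi).count_eq hsj hjt, (hrun i hi).count_eq (hs i hi) (ht i hi)]

end Bridged

/-! ### Far sets of vertices in graphs with long edges -/

namespace LongGraph

open LongVertex

variable {B E : Type*} (Γ : LongGraph B E) {n : ℕ}

/-- The star of radius `n` around a base vertex. -/
def star (n : ℕ) (v : B) : Set (LongVertex B E Γ.m) :=
  {x | match x with
    | base b => b = v
    | mid e k _ => (Γ.src e = v ∧ k < n) ∨ (Γ.tgt e = v ∧ Γ.m ≤ k + n)}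

/-- The part of a long edge outside the stars of radius `n - 1` around its ends. -/
def middle (n : ℕ) (e : E) : Set (LongVertex B E Γ.m) :=
  {x | match x with
    | base _ => False
    | mid e' k _ => e' = e ∧ n ≤ k + 1 ∧ k + n ≤ Γ.m}

variable {Γ} {f : B → ℤ} {hi : Set E} {c : ℤ} {S S' : Set (LongVertex B E Γ.m)}

theorem farApart_of_extend (hf : ∀ b, 0 ≤ f b ∧ f b ≤ c) (hc : c ≤ Γ.m)
    (hs : ∀ x y, Γ.short x y → |f x - f y| ≤ 1) (hS : ∀ a ∈ S, (n : ℤ) ≤ Γ.extend f hi c a)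
    (hS' : ∀ a ∈ S', Γ.extend f hi c a ≤ 0) : FarApart Γ.graph n S S' := fun a ha b hb =>
  le_edist_of_le_extend_sub hf hc hs (by linarith [hS a ha, hS' b hb])

theorem extend_mid_nonpos {e : E} (he : e ∉ hi) {k : ℕ} {hk : k < Γ.m}
    (hsrc : f (Γ.src e) ≤ k + 1) (htgt : f (Γ.tgt e) + k ≤ Γ.m) :
    Γ.extend f hi c (mid e k hk) ≤ 0 := by
  rw [extend_mid_of_notMem he]
  exact max_le le_rfl (max_le (by linarith) (by linarith))

theorem le_extend_mid {d : ℤ} {e : E} (he : e ∈ hi) {k : ℕ} {hk : k < Γ.m} (hc : d ≤ c)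
    (hsrc : d ≤ f (Γ.src e) + (k + 1)) (htgt : d + k ≤ f (Γ.tgt e) + Γ.m) :
    d ≤ Γ.extend f hi c (mid e k hk) := by
  rw [extend_mid_of_mem he]
  exact le_min hc (le_min hsrc (by linarith))

theorem extend_nonpos_of_mem_star {v : B} (hm : 3 * n ≤ Γ.m) (hv : f v ≤ 0)
    (hf : ∀ b, f b ≤ 2 * n) (hhi : ∀ e, Γ.src e = v ∨ Γ.tgt e = v → e ∉ hi) :
    ∀ a ∈ Γ.star n v, Γ.extend f hi c a ≤ 0
  | base _, rfl => hv
  | mid e k hk, .inl ⟨hsrc, hkn⟩ =>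
    extend_mid_nonpos (hhi e (.inl hsrc)) (by rw [hsrc]; omega)
      (by have := hf (Γ.tgt e); omega)
  | mid e k hk, .inr ⟨htgt, hkn⟩ =>
    extend_mid_nonpos (hhi e (.inr htgt)) (by have := hf (Γ.src e); omega)
      (by rw [htgt]; omega)

theorem le_extend_of_mem_star {v : B} (hv : f v = 2 * n) :
    ∀ a ∈ Γ.star n v, (n : ℤ) ≤ Γ.extend f ∅ c a := by
  rintro (b | ⟨e, k, hk⟩) ha
  · obtain rfl : b = v := ha
    rw [extend_base, hv]
    linarith
  rw [extend_mid_of_notMem (Set.notMem_empty e)]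
  obtain ⟨hsrc, hkn⟩ | ⟨htgt, hkn⟩ := ha
  · rw [hsrc, hv]
    exact le_max_of_le_right (le_max_of_le_left (by omega))
  · rw [htgt, hv]
    exact le_max_of_le_right (le_max_of_le_right (by omega))

theorem farApart_star_star (hm : 3 * n ≤ Γ.m) {u v : B} (huv : u ≠ v)
    (hu : ∀ x y, Γ.short x y → x ≠ u ∧ y ≠ u) : FarApart Γ.graph n (Γ.star n u) (Γ.star n v) := by
  classical
  let f (b : B) : ℤ := if b = u then 2 * n else 0
  have hf (b : B) : 0 ≤ f b ∧ f b ≤ 2 * n := by grind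
  exact farApart_of_extend hf (by omega) (fun x y hxy => by simp [f, hu x y hxy])
    (le_extend_of_mem_star (if_pos rfl))
    (extend_nonpos_of_mem_star hm (by simp [f, huv.symm]) (fun b => (hf b).2) (by simp))

theorem farApart_middle (hm : n ≤ Γ.m) {e : E} (hS : ∀ k hk, mid e k hk ∉ S) :
    FarApart Γ.graph n (Γ.middle n e) S := by
  refine farApart_of_extend (f := fun _ => 0) (hi := {e}) (c := n) (fun _ => ⟨le_rfl, by simp⟩)
    (by omega) (fun x y _ => by simp) ?_ ?_
  · rintro (b | ⟨e', k, hk⟩) ha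
    · exact ha.elim
    · obtain ⟨rfl, hnk, hkm⟩ := ha
      exact le_extend_mid (Set.mem_singleton _) le_rfl (by omega) (by omega)
  · rintro (b | ⟨e', k, hk⟩) ha
    · exact le_rfl
    · refine extend_mid_nonpos ?_ (by omega) (by omega)
      rintro rfl
      exact hS k hk ha

theorem mid_notMem_star {e : E} {v : B} (hsrc : Γ.src e ≠ v) (htgt : Γ.tgt e ≠ v) (k : ℕ)
    (hk : k < Γ.m) : mid e k hk ∉ Γ.star n v := by
  rintro (⟨h, -⟩ | ⟨h, -⟩)
  · exact hsrc h
  · exact htgt h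

end LongGraph

namespace Drawing

open LongVertex LongGraph

variable {B E : Type*} {Γ : LongGraph B E} {n k k' : ℕ} {X : Type*} [EMetricSpace X] {r : ℝ≥0∞}
  (D : Drawing Γ.graph X r) {S : Set (LongVertex B E Γ.m)} {e : E}

theorem joinedIn_mid (hk : k < Γ.m) (hk' : k' < Γ.m) (hkk' : k ≤ k')
    (hS : ∀ j hj, k ≤ j → j ≤ k' → mid e j hj ∈ S) :
    JoinedIn (D.img S) (D.pt (mid e k hk)) (D.pt (mid e k' hk')) := by
  induction k', hkk' using Nat.le_induction with
  | base => exact .refl (D.pt_mem_img (hS k hk le_rfl le_rfl))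
  | succ k' hkk' ih =>
    exact (ih (by omega) fun j hj hkj hjk' => hS j hj hkj (by omega)).trans <|
      D.joinedIn_of_adj (hS k' (by omega) hkk' (by omega)) (hS (k' + 1) hk' (by omega) le_rfl)
        (Γ.adj_mid e k' hk')

theorem joinedIn_src (hk : k < Γ.m) (hs : base (Γ.src e) ∈ S)
    (hS : ∀ j hj, j ≤ k → mid e j hj ∈ S) :
    JoinedIn (D.img S) (D.pt (base (Γ.src e))) (D.pt (mid e k hk)) :=
  (D.joinedIn_of_adj hs (hS 0 (by omega) (by omega)) (Γ.adj_src e (by omega))).trans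
    (D.joinedIn_mid _ hk (by omega) fun j hj _ h => hS j hj h)

theorem joinedIn_tgt (hk : k < Γ.m) (ht : base (Γ.tgt e) ∈ S)
    (hS : ∀ j hj, k ≤ j → mid e j hj ∈ S) :
    JoinedIn (D.img S) (D.pt (base (Γ.tgt e))) (D.pt (mid e k hk)) :=
  ((D.joinedIn_mid hk (by omega : Γ.m - 1 < Γ.m) (by omega) fun j hj h _ => hS j hj h).trans
    (D.joinedIn_of_adj (hS _ (by omega) (by omega)) ht
      (Γ.adj_tgt e (Γ.m - 1) (by omega) (by omega)))).symm

theorem joinedIn_of_ordConnected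
    (hS : ∀ i j k hi hj hk, i ≤ j → j ≤ k → mid e i hi ∈ S → mid e k hk ∈ S → mid e j hj ∈ S)
    {hk : k < Γ.m} {hk' : k' < Γ.m} (h : mid e k hk ∈ S) (h' : mid e k' hk' ∈ S) :
    JoinedIn (D.img S) (D.pt (mid e k hk)) (D.pt (mid e k' hk')) := by
  rcases le_total k k' with hkk | hkk
  · exact D.joinedIn_mid hk hk' hkk fun j hj hkj hjk => hS k j k' hk hj hk' hkj hjk h h'
  · exact (D.joinedIn_mid hk' hk hkk fun j hj hkj hjk => hS k' j k hk' hj hk hkj hjk h' h).symm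

theorem isPathConnected_img_star (v : B) : IsPathConnected (D.img (Γ.star n v)) := by
  refine D.isPathConnected_img (a := base v) rfl ?_
  rintro (b | ⟨e, k, hk⟩) hb
  · obtain rfl : b = v := hb
    exact .refl (D.pt_mem_img rfl)
  obtain ⟨rfl, hkn⟩ | ⟨rfl, hkn⟩ := hb
  · exact D.joinedIn_src hk rfl fun j _ hjk => Or.inl ⟨rfl, by omega⟩
  · exact D.joinedIn_tgt hk rfl fun j _ hjk => Or.inr ⟨rfl, by omega⟩

theorem isPathConnected_img_middle (hm : 2 * n ≤ Γ.m) (hn : 1 ≤ n) (e : E) :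
    IsPathConnected (D.img (Γ.middle n e)) := by
  have hmem : mid e (n - 1) (by omega) ∈ Γ.middle n e := ⟨rfl, by omega, by omega⟩
  refine D.isPathConnected_img hmem ?_
  rintro (b | ⟨e', k, hk⟩) hb
  · exact hb.elim
  obtain rfl : e' = e := hb.1
  refine D.joinedIn_of_ordConnected ?_ hmem hb
  rintro i j k hi hj hk hij hjk ⟨-, hni, -⟩ ⟨-, -, hkm⟩
  exact ⟨rfl, by omega, by omega⟩

end Drawing

/-! ### Strands in the gadget -/

namespace Gadget

open LongVertex GadgetVertex GadgetEdge

variable {n : ℕ}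

/-- The long edges used by the strand of colour `x` that runs at level `lv i` in column `i`. -/
def IsStrandEdge (lv : ℕ → Bool) (x : Bool) : GadgetEdge n → Prop
  | gap a b _ i _ => a = lv i ∧ b = lv (i + 1)
  | start y => y = x
  | finish a y => a = lv (2 ^ n - 1) ∧ y = x
  | _ => False

/-- The bottom vertices. -/
def IsBot : GadgetVertex n → Prop
  | bot _ _ => True
  | _ => False

/-- The part outside the tree and away from the leaves and the frame of the strand of colour `x`
that runs at level `lv i` in column `i`. -/
def strandSet (lv : ℕ → Bool) (x : Bool) :
    Set (LongVertex (GadgetVertex n) (GadgetEdge n) (gadget n).m) :=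
  {v | match v with
    | base (frame _) => False
    | base (node _ _ _ _) => False
    | base (bot i _) => lv i = false
    | mid e k _ => IsStrandEdge lv x e ∧ (IsBot (src e) ∨ n ≤ k + 1) ∧
        (IsBot (tgt e) ∨ k + n ≤ 4 * n)}

/-- The root and the parts away from the frame of the two long edges at the root. -/
def apexSet : Set (LongVertex (GadgetVertex n) (GadgetEdge n) (gadget n).m) :=
  {v | match v with
    | base b => b = root
    | mid e k _ => (∃ x, e = apex x) ∧ k + n ≤ 4 * n}

/-- The function that is `n` on the bottom vertices of a strand and zero elsewhere. -/
def botHeight (lv : ℕ → Bool) : GadgetVertex n → ℤ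
  | bot i _ => if lv i then 0 else n
  | _ => 0

section lev

variable {lv : ℕ → Bool} {a b : Bool} {i j : ℕ} {hi : i < 2 ^ n} {hj : j < 2 ^ n}

theorem isBot_lev : IsBot (lev a i hi) ↔ a = false := by
  cases a <;> simp [lev, IsBot]

theorem botHeight_lev : botHeight lv (lev a i hi) = if a || lv i then 0 else (n : ℤ) := by
  cases a <;> simp [lev, botHeight]

theorem lev_inj (h : lev a i hi = lev b j hj) : a = b ∧ i = j := by
  cases a <;> cases b <;> simp_all [lev]

theorem root_ne_lev (hn : 1 ≤ n) : root ≠ lev a i hi := by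
  cases a
  · simp [lev, root]
  · simp only [lev, root, ne_eq, node.injEq, not_and]
    omega

end lev

theorem Tree.ne_frame {x y : GadgetVertex n} (h : Tree x y) (u : Fin 20) :
    x ≠ frame u ∧ y ≠ frame u := by
  cases h; simp

section strandSet

variable {lv : ℕ → Bool} {x : Bool} {S : Set (LongVertex (GadgetVertex n) (GadgetEdge n) (4 * n))}

theorem botHeight_bounds (lv : ℕ → Bool) (b : GadgetVertex n) :
    0 ≤ botHeight lv b ∧ botHeight lv b ≤ n := by
  cases b <;> grind [botHeight]

theorem botHeight_src {e : GadgetEdge n} (he : IsStrandEdge lv x e) (h : IsBot (src e)) :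
    botHeight lv (src e) = n := by
  match e, he with
  | gap _ _ _ i _, ⟨rfl, rfl⟩ => simp [src, botHeight_lev, isBot_lev.1 h]
  | start _, _ => exact h.elim
  | finish _ _, ⟨rfl, rfl⟩ => simp [src, botHeight_lev, isBot_lev.1 h]

theorem botHeight_tgt (h0 : lv 0 = x) {e : GadgetEdge n} (he : IsStrandEdge lv x e)
    (h : IsBot (tgt e)) : botHeight lv (tgt e) = n := by
  match e, he with
  | gap _ _ _ i _, ⟨rfl, rfl⟩ => simp [tgt, botHeight_lev, isBot_lev.1 h]
  | start _, rfl => simp [tgt, botHeight_lev, h0, isBot_lev.1 h]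
  | finish _ _, _ => exact h.elim

theorem farApart_strandSet (h0 : lv 0 = x)
    (hS : ∀ a ∈ S, (gadget n).extend (botHeight lv) {e | IsStrandEdge lv x e} n a ≤ 0) :
    FarApart (gadget n).graph n (strandSet lv x) S := by
  refine LongGraph.farApart_of_extend (botHeight_bounds lv) (by rw [gadget_m]; omega) ?_ ?_ hS
  · rintro _ _ ⟨⟩
    simp [botHeight]
  rintro ((_ | _ | ⟨i, hi⟩) | ⟨e, k, hk⟩) ha
  · exact ha.elim
  · exact ha.elim
  · simp [botHeight, show lv i = false from ha]
  · obtain ⟨he, hsrc, htgt⟩ := ha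
    have hsrc_nonneg := (botHeight_bounds lv (src e)).1
    have htgt_nonneg := (botHeight_bounds lv (tgt e)).1
    refine LongGraph.le_extend_mid (hi := {e | IsStrandEdge lv x e}) he le_rfl ?_ ?_
    · rw [gadget_src]
      rcases hsrc with hbot | hk
      · rw [botHeight_src he hbot]; omega
      · omega
    · rw [gadget_m] at hk
      rw [gadget_tgt, gadget_m]
      rcases htgt with hbot | hk'
      · rw [botHeight_tgt h0 he hbot]; omega
      · omega

theorem farApart_strandSet_star (h0 : lv 0 = x) {b : GadgetVertex n} (hb : botHeight lv b ≤ 0)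
    (h : ∀ e, IsStrandEdge lv x e → src e ≠ b ∧ tgt e ≠ b) :
    FarApart (gadget n).graph n (strandSet lv x) ((gadget n).star n b) :=
  farApart_strandSet h0 <| LongGraph.extend_nonpos_of_mem_star (n := n) (by rw [gadget_m]; omega) hb
    (fun b => (botHeight_bounds lv b).2.trans (by omega))
    fun e he hex => he.elim (h e hex).1 (h e hex).2

theorem farApart_strandSet_star_frame (h0 : lv 0 = x) {u : Fin 20} (hs : u ≠ startFrame x)
    (hf : u ≠ finishFrame x) :
    FarApart (gadget n).graph n (strandSet lv x) ((gadget n).star n (frame u)) := by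
  refine farApart_strandSet_star h0 le_rfl ?_
  exact fun
    | gap _ _ _ _ _, _ => ⟨frame_ne_lev.symm, frame_ne_lev.symm⟩
    | start _, rfl => ⟨by simpa [src] using hs.symm, frame_ne_lev.symm⟩
    | finish _ _, ⟨_, rfl⟩ => ⟨frame_ne_lev.symm, by simpa [tgt] using hf.symm⟩

theorem farApart_strandSet_star_leaf (h0 : lv 0 = x) {i : ℕ} {hi : i < 2 ^ n}
    (hl : lv i = false) :
    FarApart (gadget n).graph n (strandSet lv x) ((gadget n).star n (lev true i hi)) := by
  refine farApart_strandSet_star h0 (by simp [botHeight_lev]) ?_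
  exact fun
    | gap _ _ _ j _, ⟨rfl, rfl⟩ => ⟨fun h => by grind [lev_inj h], fun h => by grind [lev_inj h]⟩
    | start _, rfl => ⟨frame_ne_lev, fun h => by grind [lev_inj h]⟩
    | finish _ _, ⟨rfl, _⟩ => ⟨fun h => by grind [lev_inj h], frame_ne_lev⟩

theorem botHeight_src_not {e : GadgetEdge n} (he : IsStrandEdge (fun i => !lv i) x e) :
    botHeight lv (src e) = 0 := by
  match e, he with
  | gap _ _ _ _ _, ⟨rfl, _⟩ => simp [src, botHeight_lev]
  | start _, _ => rfl
  | finish _ _, ⟨rfl, _⟩ => simp [src, botHeight_lev]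

theorem botHeight_tgt_not (h0 : (!lv 0) = x) {e : GadgetEdge n}
    (he : IsStrandEdge (fun i => !lv i) x e) : botHeight lv (tgt e) = 0 := by
  match e, he with
  | gap _ _ _ _ _, ⟨_, rfl⟩ => simp [tgt, botHeight_lev]
  | start _, rfl => simp [tgt, botHeight_lev, ← h0]
  | finish _ _, _ => rfl

theorem IsStrandEdge.not {e : GadgetEdge n} (he : IsStrandEdge (fun i => !lv i) (!x) e) :
    ¬ IsStrandEdge lv x e := by
  cases e <;> grind [IsStrandEdge]

theorem farApart_strandSet_strandSet (h0 : lv 0 = x) :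
    FarApart (gadget n).graph n (strandSet lv x) (strandSet (fun i => !lv i) !x) := by
  refine farApart_strandSet h0 ?_
  rintro ((_ | _ | ⟨i, hi⟩) | ⟨e, k, hk⟩) ha
  · exact le_rfl
  · exact le_rfl
  · have hl : (!lv i) = false := ha
    exact (if_pos (by simpa using hl)).le
  · obtain ⟨he, -, -⟩ := ha
    have hkm := gadget_m (n := n)
    refine LongGraph.extend_mid_nonpos (hi := {e | IsStrandEdge lv x e}) he.not ?_ ?_
    · rw [gadget_src, botHeight_src_not he]; omega
    · rw [gadget_tgt, botHeight_tgt_not (by rw [h0]) he]; omega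

theorem farApart_strandSet_apexSet (h0 : lv 0 = x) :
    FarApart (gadget n).graph n (strandSet lv x) apexSet := by
  refine farApart_strandSet h0 ?_
  rintro (b | ⟨e, k, hk⟩) ha
  · obtain rfl : b = root := ha
    exact le_rfl
  · obtain ⟨⟨y, rfl⟩, -⟩ := ha
    refine LongGraph.extend_mid_nonpos id ?_ ?_
    · simp [src, root, botHeight]; omega
    · simp only [gadget_tgt, tgt, botHeight, gadget_m]; omega

end strandSet

theorem farApart_star_leaf_star_frame {i : ℕ} {hi : i < 2 ^ n} (u : Fin 20) :
    FarApart (gadget n).graph n ((gadget n).star n (lev true i hi))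
      ((gadget n).star n (frame u)) := by
  let f : GadgetVertex n → ℤ
    | node _ _ _ _ => 2 * n
    | _ => 0
  have hf (b : GadgetVertex n) : 0 ≤ f b ∧ f b ≤ 2 * n := by cases b <;> simp [f]
  refine LongGraph.farApart_of_extend hf (by rw [gadget_m]; omega) ?_
    (LongGraph.le_extend_of_mem_star rfl)
    (LongGraph.extend_nonpos_of_mem_star (by rw [gadget_m]; omega) le_rfl (fun b => (hf b).2)
      (by simp))
  rintro _ _ ⟨⟩
  simp [f]

theorem farApart_star_leaf_apexSet (hn : 1 ≤ n) {i : ℕ} {hi : i < 2 ^ n} :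
    FarApart (gadget n).graph n ((gadget n).star n (lev true i hi)) apexSet := by
  let f : GadgetVertex n → ℤ
    | frame _ => 0
    | node h _ _ _ => n - h
    | bot _ _ => n
  have hf (b : GadgetVertex n) : 0 ≤ f b ∧ f b ≤ n := by cases b <;> simp only [f] <;> omega
  have hleaf : f (lev true i hi) = n := by simp [f, lev]
  refine LongGraph.farApart_of_extend (hi := {e | ∀ x, e ≠ apex x}) hf
    (by rw [gadget_m]; omega) ?_ ?_ ?_
  · rintro _ _ ⟨⟩
    simp [f]
  · rintro (b | ⟨e, k, hk⟩) ha
    · obtain rfl : b = lev true i hi := ha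
      exact hleaf.ge
    have hsrc_nonneg := (hf (src e)).1
    have htgt_nonneg := (hf (tgt e)).1
    rw [gadget_m] at hk
    obtain ⟨hsrc, hkn⟩ | ⟨htgt, hkn⟩ := ha
    · refine LongGraph.le_extend_mid ?_ le_rfl (by rw [hsrc, hleaf]; omega)
        (by rw [gadget_tgt, gadget_m]; omega)
      rintro y rfl
      exact root_ne_lev hn hsrc
    · rw [gadget_m] at hkn
      refine LongGraph.le_extend_mid ?_ le_rfl (by rw [gadget_src]; omega)
        (by rw [htgt, hleaf, gadget_m]; omega)
      rintro y rfl
      exact frame_ne_lev htgt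
  · rintro (b | ⟨e, k, hk⟩) ha
    · obtain rfl : b = root := ha
      simp [f, root]
    · obtain ⟨⟨y, rfl⟩, -⟩ := ha
      refine LongGraph.extend_mid_nonpos (by simp) ?_ ?_
      · simp [src, root, f]; omega
      · simp only [gadget_tgt, tgt, f]; omega

theorem farApart_apexSet_star_frame {u : Fin 20} (hu : ∀ x, u ≠ apexFrame x) :
    FarApart (gadget n).graph n apexSet ((gadget n).star n (frame u)) := by
  let f : GadgetVertex n → ℤ
    | node h _ _ _ => h
    | _ => 0
  have hf (b : GadgetVertex n) : 0 ≤ f b ∧ f b ≤ n := by cases b <;> simp only [f] <;> omega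
  refine LongGraph.farApart_of_extend (hi := {e | ∃ x, e = apex x}) hf
    (by rw [gadget_m]; omega) ?_ ?_
    (LongGraph.extend_nonpos_of_mem_star (by rw [gadget_m]; omega) le_rfl
      (fun b => (hf b).2.trans (by omega)) ?_)
  · rintro _ _ ⟨⟩
    simp [f]
  · rintro (b | ⟨e, k, hk⟩) ha
    · obtain rfl : b = root := ha
      simp [f, root]
    · obtain ⟨⟨y, rfl⟩, hkn⟩ := ha
      have hy : apex y ∈ {e : GadgetEdge n | ∃ x, e = apex x} := ⟨y, rfl⟩
      refine LongGraph.le_extend_mid hy le_rfl ?_ ?_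
      · simp [src, root, f]; omega
      · simp only [gadget_tgt, tgt, f, gadget_m]; omega
  · rintro _ (hsrc | htgt) ⟨y, rfl⟩
    · exact frame_ne_root hsrc.symm
    · exact hu y (by simpa [tgt] using htgt.symm)

end Gadget

/-! ### Strands in a drawing of the gadget -/

namespace Gadget

open LongVertex GadgetVertex GadgetEdge

variable {n : ℕ} {X : Type*} [EMetricSpace X] {r : ℝ≥0∞} (D : Drawing (gadget n).graph X r)
  (lv : ℕ → Bool) (x : Bool) (A : ℕ → Set X)

/-- The part of a strand in the columns in which it runs at the top level. -/
def topImg (n : ℕ) (lv : ℕ → Bool) (A : ℕ → Set X) : Set X :=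
  {y | ∃ i < 2 ^ n, lv i = true ∧ y ∈ A i}

/-- A strand in a drawing: the drawing of its part outside the tree, and the sets `A i` of the
columns in which it runs at the top level. -/
def strandImg : Set X := D.img (strandSet lv x) ∪ topImg n lv A

/-- The part of a strand in a column. -/
def column (i : ℕ) (hi : i < 2 ^ n) : Set X :=
  {y | (lv i = true ∧ y ∈ A i) ∨ (lv i = false ∧ y = D.pt (base (bot i hi)))}

/-- The sets `A i` can serve as the top level of a strand that runs at level `lv i` in column `i`,
and of the strand that runs at the opposite levels: next to a change of level, and in the first and
the last column, they contain the drawings of the stars around the leaves. -/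
structure Carries (ε : ℝ≥0∞) : Prop where
  isPathConnected : ∀ i < 2 ^ n, IsPathConnected (A i)
  eq_succ : ∀ i, i + 1 < 2 ^ n → lv i = lv (i + 1) → A i = A (i + 1)
  img_star_subset : ∀ i hi, (i = 0 ∨ lv (i - 1) ≠ lv i ∨ i + 1 = 2 ^ n ∨ lv i ≠ lv (i + 1)) →
    D.img ((gadget n).star n (lev true i hi)) ⊆ A i
  le_setDist : ∀ i < 2 ^ n, ∀ j < 2 ^ n, lv i ≠ lv j → ε ≤ setDist (A i) (A j)
  exists_edist_le : ∀ i < 2 ^ n, ∀ y ∈ A i, ∃ j hj, lv j = lv i ∧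
    ∃ z ∈ D.img ((gadget n).star n (lev true j hj)), edist y z ≤ 2 ^ n * ε

variable {D lv x A} {ε : ℝ≥0∞} {e : GadgetEdge n} {i k k' : ℕ} {hi : i < 2 ^ n}
  {hk : k < (gadget n).m} {hk' : k' < (gadget n).m} {y : X}

theorem IsStrandEdge.exists_end (h0 : lv 0 = x) (he : IsStrandEdge lv x e) :
    ∃ i hi, src e = lev (lv i) i hi ∨ tgt e = lev (lv i) i hi := by
  match e, he with
  | gap _ _ _ i hi, ⟨rfl, _⟩ => exact ⟨i, by omega, .inl rfl⟩
  | start _, rfl => exact ⟨0, by positivity, .inr (by rw [h0]; rfl)⟩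
  | finish _ _, ⟨rfl, _⟩ => exact ⟨2 ^ n - 1, last_lt n, .inl rfl⟩

theorem isStrandEdge_start : IsStrandEdge (n := n) lv x (start x) := rfl

theorem isStrandEdge_finish : IsStrandEdge (n := n) lv x (finish (lv (2 ^ n - 1)) x) := ⟨rfl, rfl⟩

theorem lt_gadget_m (hn : 1 ≤ n) : n < (gadget n).m := by
  rw [gadget_m]
  omega

theorem mid_mem_strandSet (he : IsStrandEdge lv x e) (hnk : n ≤ k + 1) (hkn : k + n ≤ 4 * n) :
    mid e k hk ∈ strandSet lv x :=
  ⟨he, .inr hnk, .inr hkn⟩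

theorem joinedIn_strandSet (h : mid e k hk ∈ strandSet lv x) (h' : mid e k' hk' ∈ strandSet lv x) :
    JoinedIn (strandImg D lv x A) (D.pt (mid e k hk)) (D.pt (mid e k' hk')) := by
  refine (D.joinedIn_of_ordConnected ?_ h h').mono Set.subset_union_left
  rintro i j k hi hj hk hij hjk ⟨he, hsrc, -⟩ ⟨-, -, htgt⟩
  exact ⟨he, hsrc.imp_right fun h => by omega, htgt.imp_right fun h => by omega⟩

namespace Carries

theorem column_nonempty (hc : Carries D lv A ε) : (column D lv A i hi).Nonempty := by
  cases h : lv i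
  · exact ⟨_, .inr ⟨h, rfl⟩⟩
  · obtain ⟨y, hy⟩ := (hc.isPathConnected i hi).nonempty
    exact ⟨y, .inl ⟨h, hy⟩⟩

theorem img_star_subset_of_end (hc : Carries D lv A ε) (he : IsStrandEdge lv x e)
    (h : src e = lev (lv i) i hi ∨ tgt e = lev (lv i) i hi) (hl : lv i = true) :
    D.img ((gadget n).star n (lev true i hi)) ⊆ A i := by
  refine hc.img_star_subset i hi ?_
  match e, he, h with
  | gap _ _ hab j _, he, .inl h =>
    obtain ⟨⟨rfl, rfl⟩, -, rfl⟩ := And.intro he (lev_inj h)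
    exact .inr <| .inr <| .inr (by grind)
  | gap _ _ hab j _, he, .inr h =>
    obtain ⟨⟨rfl, rfl⟩, -, rfl⟩ := And.intro he (lev_inj h)
    exact .inr <| .inl (by grind)
  | start _, _, .inl h => exact (frame_ne_lev h).elim
  | start _, _, .inr h => exact .inl (lev_inj h).2.symm
  | finish _ _, _, .inl h =>
    have := (lev_inj h).2
    exact .inr <| .inr <| .inl (by omega)
  | finish _ _, _, .inr h => exact (frame_ne_lev h).elim

theorem joinedIn_column_of_mem_star (hc : Carries D lv A ε)
    (hS : mid e k hk ∈ strandSet lv x)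
    (hstar : mid e k hk ∈ (gadget n).star n (lev (lv i) i hi)) (hy : y ∈ column D lv A i hi) :
    JoinedIn (strandImg D lv x A) (D.pt (mid e k hk)) y := by
  have hm := gadget_m (n := n)
  have he := hS.1
  rcases hy with ⟨hl, hy⟩ | ⟨hl, rfl⟩
  · have hI := hc.img_star_subset_of_end he (hstar.imp And.left And.left) hl
    rw [hl] at hstar
    exact ((hc.isPathConnected i hi).joinedIn _ (hI (D.pt_mem_img hstar)) _ hy).mono
      fun z hz => .inr ⟨i, hi, hl, hz⟩
  · rw [hl] at hstar
    refine (JoinedIn.symm ?_).mono Set.subset_union_left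
    have hbot : base (bot i hi) ∈ strandSet lv x := hl
    obtain ⟨hend, hkn⟩ | ⟨hend, hkn⟩ := hstar
    · have hsrc : (gadget n).src e = bot i hi := hend
      rw [← hsrc] at hbot ⊢
      exact D.joinedIn_src hk hbot fun j _ hjk =>
        ⟨he, .inl (by rw [← gadget_src, hsrc]; trivial), .inr (by omega)⟩
    · have htgt : (gadget n).tgt e = bot i hi := hend
      rw [← htgt] at hbot ⊢
      exact D.joinedIn_tgt hk hbot fun j _ hkj =>
        ⟨he, .inr (by omega), .inl (by rw [← gadget_tgt, htgt]; trivial)⟩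

theorem joinedIn_column (hn : 1 ≤ n) (hc : Carries D lv A ε) (hS : mid e k hk ∈ strandSet lv x)
    (h : src e = lev (lv i) i hi ∨ tgt e = lev (lv i) i hi) (hy : y ∈ column D lv A i hi) :
    JoinedIn (strandImg D lv x A) (D.pt (mid e k hk)) y := by
  have hm := gadget_m (n := n)
  have hmem (j : ℕ) (hj : j < (gadget n).m) (hnj : n ≤ j + 1) (hjn : j + n ≤ 4 * n) :
      mid e j hj ∈ strandSet lv x := mid_mem_strandSet hS.1 hnj hjn
  rcases h with hsrc | htgt
  · have hS' := hmem (n - 1) (by omega) (by omega) (by omega)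
    exact (joinedIn_strandSet hS hS').trans <|
      hc.joinedIn_column_of_mem_star hS' (.inl ⟨hsrc, by omega⟩) hy
  · have hS' := hmem (3 * n) (by omega) (by omega) (by omega)
    exact (joinedIn_strandSet hS hS').trans <|
      hc.joinedIn_column_of_mem_star hS' (.inr ⟨htgt, by omega⟩) hy

theorem exists_joinedIn_column_succ (hn : 1 ≤ n) (hc : Carries D lv A ε) {j : ℕ}
    (hj : j + 1 < 2 ^ n) (hy : y ∈ column D lv A (j + 1) hj) :
    ∃ z ∈ column D lv A j (Nat.lt_of_succ_lt hj), JoinedIn (strandImg D lv x A) z y := by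
  by_cases hl : (lv j && lv (j + 1)) = false
  · obtain ⟨z, hz⟩ := hc.column_nonempty (hi := Nat.lt_of_succ_lt hj)
    have hS : mid (gap (lv j) (lv (j + 1)) hl j hj) n (lt_gadget_m hn) ∈ strandSet lv x :=
      mid_mem_strandSet ⟨rfl, rfl⟩ (by omega) (by omega)
    exact ⟨z, hz, (hc.joinedIn_column hn hS (.inl rfl) hz).symm.trans
      (hc.joinedIn_column hn hS (.inr rfl) hy)⟩
  · obtain ⟨hl, hl'⟩ : lv j = true ∧ lv (j + 1) = true := by simpa using hl
    have hyA : y ∈ A (j + 1) := by simpa [column, hl'] using hy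
    rw [← hc.eq_succ j hj (by rw [hl, hl'])] at hyA
    exact ⟨y, .inl ⟨hl, hyA⟩, .refl (.inr ⟨j, by omega, hl, hyA⟩)⟩

theorem joinedIn_start (hn : 1 ≤ n) (hc : Carries D lv A ε) (h0 : lv 0 = x)
    (hy : y ∈ column D lv A i hi) :
    JoinedIn (strandImg D lv x A) (D.pt (mid (start x) n (lt_gadget_m hn))) y := by
  induction i generalizing y with
  | zero =>
    exact hc.joinedIn_column hn (mid_mem_strandSet isStrandEdge_start (by omega) (by omega))
      (.inr (by rw [h0]; rfl)) hy
  | succ i ih =>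
    obtain ⟨z, hz, hzy⟩ := hc.exists_joinedIn_column_succ hn hi hy
    exact (ih hz).trans hzy

theorem isPathConnected_strandImg (hn : 1 ≤ n) (hc : Carries D lv A ε) (h0 : lv 0 = x) :
    IsPathConnected (strandImg D lv x A) := by
  refine ⟨D.pt (mid (start x) n (lt_gadget_m hn)),
    .inl (D.pt_mem_img (mid_mem_strandSet isStrandEdge_start (by omega) (by omega))),
    fun {y} hy => ?_⟩
  rcases hy with hy | ⟨i, hi, hl, hy⟩
  · obtain ⟨a, ha, hay⟩ := D.exists_joinedIn hy
    refine .trans ?_ (hay.mono Set.subset_union_left)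
    match a, ha with
    | base (bot i hi), ha => exact hc.joinedIn_start hn h0 (.inr ⟨ha, rfl⟩)
    | mid e k hk, ha =>
      obtain ⟨i, hi, hend⟩ := ha.1.exists_end h0
      obtain ⟨z, hz⟩ := hc.column_nonempty (i := i) (hi := hi)
      exact (hc.joinedIn_start hn h0 hz).trans (hc.joinedIn_column hn ha hend hz).symm
  · exact hc.joinedIn_start hn h0 (hi := hi) (.inl ⟨hl, hy⟩)

end Carries

variable (D) in
theorem isPathConnected_img_apexSet : IsPathConnected (D.img apexSet) := by
  refine D.isPathConnected_img (a := base root) rfl ?_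
  rintro (b | ⟨e, k, hk⟩) hb
  · obtain rfl : b = root := hb
    exact .refl (D.pt_mem_img rfl)
  · obtain ⟨⟨y, rfl⟩, hkn⟩ := hb
    exact D.joinedIn_src (e := apex y) hk rfl fun j _ hjk => ⟨⟨y, rfl⟩, by omega⟩

end Gadget

/-! ### The fat model in a drawing of the gadget -/

namespace Gadget

open LongVertex GadgetVertex GadgetEdge

/-- The edges of the complete graph on the frame: the two strands, the pair joined through the root,
and the edges of the frame. -/
inductive Route : Type
  | strand (x : Bool) : Route
  | apex : Route
  | frame (u v : Fin 20) (huv : u < v) (h : ¬ FramePair u v) : Route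

/-- The first end of a route. -/
def Route.fst : Route → Fin 20
  | strand x => startFrame x
  | apex => apexFrame true
  | frame u _ _ _ => u

/-- The second end of a route. -/
def Route.snd : Route → Fin 20
  | strand x => finishFrame x
  | apex => apexFrame false
  | frame _ v _ _ => v

theorem exists_route_of_lt {u v : Fin 20} (huv : u < v) :
    ∃ ρ : Route, s(u, v) = s(ρ.fst, ρ.snd) := by
  by_cases h : FramePair u v
  · rcases h with ⟨rfl, rfl⟩ | ⟨rfl, rfl⟩ | ⟨rfl, rfl⟩
    · exact ⟨.strand true, rfl⟩
    · exact ⟨.strand false, rfl⟩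
    · exact ⟨.apex, rfl⟩
  · exact ⟨.frame u v huv h, rfl⟩

theorem exists_route (e : (⊤ : SimpleGraph (Fin 20)).edgeSet) :
    ∃ ρ : Route, e.1 = s(ρ.fst, ρ.snd) := by
  obtain ⟨⟨u, v⟩, he⟩ := e
  have huv : u ≠ v := by simpa using he
  rcases huv.lt_or_gt with h | h
  · exact exists_route_of_lt h
  · obtain ⟨ρ, hρ⟩ := exists_route_of_lt h
    exact ⟨ρ, Sym2.eq_swap.trans hρ⟩

variable {n : ℕ} {X : Type*} [EMetricSpace X] {r ε : ℝ≥0∞} {D : Drawing (gadget n).graph X r}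
  {lv : ℕ → Bool} {x : Bool} {A : ℕ → Set X}

theorem hasFatMinor_of_routes {K : ℝ} (B : Fin 20 → Set X) (P : Route → Set X)
    (hB : ∀ u, IsPathConnected (B u)) (hP : ∀ ρ, IsPathConnected (P ρ))
    (hfst : ∀ ρ : Route, (B ρ.fst ∩ P ρ).Nonempty) (hsnd : ∀ ρ : Route, (B ρ.snd ∩ P ρ).Nonempty)
    (hBB : ∀ u v, u ≠ v → ENNReal.ofReal K ≤ setDist (B u) (B v))
    (hBP : ∀ u, ∀ ρ : Route, u ≠ ρ.fst → u ≠ ρ.snd → ENNReal.ofReal K ≤ setDist (B u) (P ρ))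
    (hPP : ∀ ρ ρ', ρ ≠ ρ' → ENNReal.ofReal K ≤ setDist (P ρ) (P ρ')) :
    HasFatMinor (⊤ : SimpleGraph (Fin 20)) K X := by
  choose ρ hρ using exists_route
  refine ⟨⟨B, fun e => P (ρ e), hB, fun e => hP _, fun v e hv => ?_, hBB, fun e f hef => ?_,
    fun v e hv => ?_⟩⟩
  · rw [hρ, Sym2.mem_iff] at hv
    rcases hv with rfl | rfl
    · exact hfst _
    · exact hsnd _
  · refine hPP _ _ fun h => hef (Subtype.ext ?_)
    rw [hρ e, hρ f, h]
  · rw [hρ, Sym2.mem_iff, not_or] at hv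
    exact hBP v _ hv.1 hv.2

theorem bodd_count_mem_succ_eq_iff {cut : Finset ℕ} {i : ℕ} :
    (Nat.count (· ∈ cut) i).bodd = (Nat.count (· ∈ cut) (i + 1)).bodd ↔ i ∉ cut := by
  by_cases h : i ∈ cut <;> simp [Nat.count_succ, h]

variable (D ε) in
theorem exists_carries : ∃ lv A, lv 0 = false ∧ Carries D lv A ε := by
  obtain ⟨cut, A, hAeq, hA, hI, hAA, hnear⟩ := exists_runs (N := 2 ^ n)
    (I := fun i => {y | ∃ hi, y ∈ D.img ((gadget n).star n (lev true i hi))})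
    (fun i hi => by simpa [hi] using D.isPathConnected_img_star (lev true i hi)) ε
  refine ⟨fun i => (Nat.count (· ∈ cut) i).bodd, A, by simp, hA, fun i hi hlv =>
    hAeq i hi (bodd_count_mem_succ_eq_iff.1 hlv), fun i hi hend y hy => hI i hi ?_ ⟨hi, hy⟩,
    fun i hi j hj hlv => ?_, fun i hi y hy => ?_⟩
  · refine (em (i = 0)).imp_right fun hi0 => ?_
    obtain ⟨i, rfl⟩ := Nat.exists_eq_succ_of_ne_zero hi0
    simpa [bodd_count_mem_succ_eq_iff] using hend
  · have hne : Nat.count (· ∈ cut) i ≠ Nat.count (· ∈ cut) j := fun h => hlv (by rw [h])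
    rcases lt_trichotomy i j with hij | rfl | hij
    · exact hAA i j hij hj hne
    · exact absurd rfl hne
    · rw [setDist_comm]
      exact hAA j i hij hi hne.symm
  · obtain ⟨j, -, hji, z, ⟨hj, hz⟩, hyz⟩ := hnear i hi y hy
    exact ⟨j, hj, by rw [hji], z, hz, by exact_mod_cast hyz⟩

/-- The stars around the leaves of the columns in which the level is the top one. -/
def topSet (lv : ℕ → Bool) : Set (LongVertex (GadgetVertex n) (GadgetEdge n) (gadget n).m) :=
  {v | ∃ j hj, lv j = true ∧ v ∈ (gadget n).star n (lev true j hj)}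

/-- The sets of the model that correspond to the edges of the complete graph, where the strand of
colour `x` runs at level `x ^^ lv i` in column `i`. -/
def routeImg (D : Drawing (gadget n).graph X r) (lv : ℕ → Bool) (A : ℕ → Set X) : Route → Set X
  | .strand x => strandImg D (fun i => x ^^ lv i) x A
  | .apex => D.img apexSet
  | .frame u v huv h => D.img ((gadget n).middle n (fr u v huv h))

theorem mid_fr_notMem_strandSet {u v : Fin 20} {huv : u < v} {h : ¬ FramePair u v} (k : ℕ)
    (hk : k < (gadget n).m) : mid (fr u v huv h) k hk ∉ strandSet lv x := And.left

theorem mid_fr_notMem_apexSet {u v : Fin 20} {huv : u < v} {h : ¬ FramePair u v} (k : ℕ)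
    (hk : k < (gadget n).m) : mid (fr u v huv h) k hk ∉ apexSet (n := n) := by
  rintro ⟨⟨x, hx⟩, -⟩
  cases hx

theorem Carries.xor (hc : Carries D lv A ε) (x : Bool) : Carries D (fun i => x ^^ lv i) A ε where
  isPathConnected := hc.isPathConnected
  eq_succ := by simpa using hc.eq_succ
  img_star_subset := by simpa using hc.img_star_subset
  le_setDist := by simpa using hc.le_setDist
  exists_edist_le := by simpa using hc.exists_edist_le

theorem Carries.not (hc : Carries D lv A ε) : Carries D (fun i => !lv i) A ε := by
  simpa using hc.xor true

theorem Carries.near_topImg (hc : Carries D lv A ε) :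
    D.Near (r + 2 ^ n * ε) (topImg n lv A) (topSet lv) := by
  rintro y ⟨i, hi, hl, hy⟩
  obtain ⟨j, hj, hji, z, hz, hyz⟩ := hc.exists_edist_le i hi y hy
  obtain ⟨a, ha, hza⟩ := D.near_img _ z hz
  refine ⟨a, ⟨j, hj, by rw [hji, hl], ha⟩, ?_⟩
  calc edist y (D.pt a) ≤ edist y z + edist z (D.pt a) := edist_triangle _ _ _
    _ ≤ 2 ^ n * ε + r := add_le_add hyz hza
    _ = r + 2 ^ n * ε := add_comm _ _

theorem isPathConnected_routeImg (hn : 1 ≤ n) (hc : Carries D lv A ε) (h0 : lv 0 = false) :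
    ∀ ρ, IsPathConnected (routeImg D lv A ρ)
  | .strand x => (hc.xor x).isPathConnected_strandImg hn (by simp [h0])
  | .apex => isPathConnected_img_apexSet D
  | .frame _ _ _ _ => D.isPathConnected_img_middle (by rw [gadget_m]; omega) hn _

theorem img_star_fst_inter_routeImg_nonempty (hn : 1 ≤ n) : ∀ ρ : Route,
    (D.img ((gadget n).star n (frame ρ.fst)) ∩ routeImg D lv A ρ).Nonempty
  | .strand x => ⟨D.pt (mid (start x) (n - 1) (by rw [gadget_m]; omega)),
      D.pt_mem_img (.inl ⟨rfl, by omega⟩),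
      .inl (D.pt_mem_img (mid_mem_strandSet isStrandEdge_start (by omega) (by omega)))⟩
  | .apex => ⟨D.pt (mid (apex true) (3 * n) (by rw [gadget_m]; omega)),
      D.pt_mem_img (.inr ⟨rfl, by rw [gadget_m]; omega⟩), D.pt_mem_img ⟨⟨true, rfl⟩, by omega⟩⟩
  | .frame u v huv h => ⟨D.pt (mid (fr u v huv h) (n - 1) (by rw [gadget_m]; omega)),
      D.pt_mem_img (.inl ⟨rfl, by omega⟩), D.pt_mem_img ⟨rfl, by omega, by rw [gadget_m]; omega⟩⟩

theorem img_star_snd_inter_routeImg_nonempty (hn : 1 ≤ n) : ∀ ρ : Route,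
    (D.img ((gadget n).star n (frame ρ.snd)) ∩ routeImg D lv A ρ).Nonempty
  | .strand x =>
    ⟨D.pt (mid (finish (x ^^ lv (2 ^ n - 1)) x) (3 * n) (by rw [gadget_m]; omega)),
      D.pt_mem_img (.inr ⟨rfl, by rw [gadget_m]; omega⟩),
      .inl (D.pt_mem_img (mid_mem_strandSet isStrandEdge_finish (by omega) (by omega)))⟩
  | .apex => ⟨D.pt (mid (apex false) (3 * n) (by rw [gadget_m]; omega)),
      D.pt_mem_img (.inr ⟨rfl, by rw [gadget_m]; omega⟩), D.pt_mem_img ⟨⟨false, rfl⟩, by omega⟩⟩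
  | .frame u v huv h => ⟨D.pt (mid (fr u v huv h) (3 * n) (by rw [gadget_m]; omega)),
      D.pt_mem_img (.inr ⟨rfl, by rw [gadget_m]; omega⟩),
      D.pt_mem_img ⟨rfl, by omega, by rw [gadget_m]; omega⟩⟩

section Separates

variable {S : Set (LongVertex (GadgetVertex n) (GadgetEdge n) (gadget n).m)} {Y : Set X}

theorem near_img_add (S) : D.Near (r + 2 ^ n * ε) (D.img S) S :=
  (D.near_img S).mono_left le_self_add

theorem le_setDist_img (hD : D.Separates n (r + 2 ^ n * ε) ε) {S'}
    (h : FarApart (gadget n).graph n S S') : ε ≤ setDist (D.img S) (D.img S') :=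
  hD h (near_img_add S) (near_img_add S')

theorem le_setDist_strandImg_img (hc : Carries D lv A ε) (hD : D.Separates n (r + 2 ^ n * ε) ε)
    (hstrand : FarApart (gadget n).graph n (strandSet lv x) S)
    (hstar : ∀ j hj, FarApart (gadget n).graph n ((gadget n).star n (lev true j hj)) S) :
    ε ≤ setDist (strandImg D lv x A) (D.img S) := by
  rw [strandImg, setDist_union_left]
  refine le_min (le_setDist_img hD hstrand) (hD ?_ hc.near_topImg (near_img_add S))
  rintro a ⟨j, hj, -, ha⟩
  exact hstar j hj a ha

theorem le_setDist_topImg_topImg (hc : Carries D lv A ε) :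
    ε ≤ setDist (topImg n lv A) (topImg n (fun i => !lv i) A) := by
  refine le_iInf₂ fun y ⟨i, hi, hil, hy⟩ => le_iInf₂ fun z ⟨j, hj, hjl, hz⟩ => le_iInf fun γ => ?_
  refine (hc.le_setDist i hi j hj ?_).trans (setDist_le_pathLength hy hz γ)
  grind

theorem le_setDist_img_strandSet_topImg (hc : Carries D lv A ε)
    (hD : D.Separates n (r + 2 ^ n * ε) ε) (h0 : lv 0 = x) :
    ε ≤ setDist (D.img (strandSet lv x)) (topImg n (fun i => !lv i) A) := by
  refine hD ?_ (near_img_add _) hc.not.near_topImg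
  rintro a ha b ⟨j, hj, hl, hb⟩
  exact farApart_strandSet_star_leaf h0 (by simpa using hl) a ha b hb

theorem le_setDist_strandImg_strandImg (hc : Carries D lv A ε)
    (hD : D.Separates n (r + 2 ^ n * ε) ε) (h0 : lv 0 = x) :
    ε ≤ setDist (strandImg D lv x A) (strandImg D (fun i => !lv i) (!x) A) := by
  simp only [strandImg, setDist_union_left, setDist_union_right, le_min_iff]
  refine ⟨⟨le_setDist_img hD (farApart_strandSet_strandSet h0), ?_⟩,
    le_setDist_img_strandSet_topImg hc hD h0, le_setDist_topImg_topImg hc⟩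
  rw [setDist_comm]
  simpa using le_setDist_img_strandSet_topImg hc.not hD (x := !x) (by simp [h0])

theorem le_setDist_img_star_routeImg (hc : Carries D lv A ε)
    (hD : D.Separates n (r + 2 ^ n * ε) ε) (h0 : lv 0 = false) (w : Fin 20) :
    ∀ ρ : Route, w ≠ ρ.fst → w ≠ ρ.snd →
      ε ≤ setDist (D.img ((gadget n).star n (frame w))) (routeImg D lv A ρ)
  | .strand x, hfst, hsnd => by
    rw [setDist_comm]
    exact le_setDist_strandImg_img (hc.xor x) hD
      (farApart_strandSet_star_frame (by simp [h0]) hfst hsnd) fun _ _ =>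
        farApart_star_leaf_star_frame w
  | .apex, hfst, hsnd =>
    le_setDist_img hD (farApart_apexSet_star_frame (Bool.forall_bool.2 ⟨hsnd, hfst⟩)).symm
  | .frame u v huv h, hfst, hsnd =>
    le_setDist_img hD <| FarApart.symm <| LongGraph.farApart_middle (by rw [gadget_m]; omega) <|
      LongGraph.mid_notMem_star (by simpa [src, Route.fst] using hfst.symm)
        (by simpa [tgt, Route.snd] using hsnd.symm)

theorem le_setDist_strandImg_img_middle (hc : Carries D lv A ε)
    (hD : D.Separates n (r + 2 ^ n * ε) ε) {u v : Fin 20} (huv : u < v) (h : ¬ FramePair u v) :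
    ε ≤ setDist (strandImg D lv x A) (D.img ((gadget n).middle n (fr u v huv h))) :=
  le_setDist_strandImg_img hc hD
    (LongGraph.farApart_middle (by rw [gadget_m]; omega) mid_fr_notMem_strandSet).symm
    fun _ _ => (LongGraph.farApart_middle (by rw [gadget_m]; omega)
      (LongGraph.mid_notMem_star frame_ne_lev frame_ne_lev)).symm

theorem le_setDist_routeImg_routeImg (hn : 1 ≤ n) (hc : Carries D lv A ε)
    (hD : D.Separates n (r + 2 ^ n * ε) ε) (h0 : lv 0 = false) (ρ ρ' : Route) (hne : ρ ≠ ρ') :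
    ε ≤ setDist (routeImg D lv A ρ) (routeImg D lv A ρ') := by
  have hm : n ≤ (gadget n).m := by rw [gadget_m]; omega
  have hx (x : Bool) : (x ^^ lv 0) = x := by simp [h0]
  have hapex (x : Bool) : ε ≤ setDist (strandImg D (fun i => x ^^ lv i) x A) (D.img apexSet) :=
    le_setDist_strandImg_img (hc.xor x) hD (farApart_strandSet_apexSet (hx x)) fun _ _ =>
      farApart_star_leaf_apexSet hn
  have hmiddle (u v huv h) : ε ≤ setDist (D.img ((gadget n).middle n (fr u v huv h)))
      (D.img apexSet) := le_setDist_img hD (LongGraph.farApart_middle hm mid_fr_notMem_apexSet)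
  match ρ, ρ' with
  | .strand x, .strand x' =>
    obtain rfl : x' = !x := by
      rw [Bool.eq_not]
      rintro rfl
      exact hne rfl
    simpa [routeImg] using le_setDist_strandImg_strandImg (hc.xor x) hD (hx x)
  | .strand x, .apex => exact hapex x
  | .apex, .strand x => exact (hapex x).trans_eq (setDist_comm _ _)
  | .strand x, .frame u v huv h => exact le_setDist_strandImg_img_middle (hc.xor x) hD huv h
  | .frame u v huv h, .strand x =>
    exact (le_setDist_strandImg_img_middle (hc.xor x) hD huv h).trans_eq (setDist_comm _ _)
  | .apex, .apex => exact absurd rfl hne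
  | .apex, .frame u v huv h => exact (hmiddle u v huv h).trans_eq (setDist_comm _ _)
  | .frame u v huv h, .apex => exact hmiddle u v huv h
  | .frame u v huv h, .frame u' v' huv' h' =>
    refine le_setDist_img hD (LongGraph.farApart_middle hm ?_)
    rintro k hk ⟨he, -⟩
    obtain ⟨rfl, rfl⟩ : u = u' ∧ v = v' := by simpa using he
    exact hne rfl

end Separates

theorem hasFatMinor_of_separates (hn : 1 ≤ n) (D : Drawing (gadget n).graph X r) {K : ℝ}
    (hD : D.Separates n (r + 2 ^ n * ENNReal.ofReal K) (ENNReal.ofReal K)) :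
    HasFatMinor (⊤ : SimpleGraph (Fin 20)) K X := by
  obtain ⟨lv, A, h0, hc⟩ := exists_carries (ENNReal.ofReal K) D
  exact hasFatMinor_of_routes (fun u => D.img ((gadget n).star n (frame u))) (routeImg D lv A)
    (fun u => D.isPathConnected_img_star _) (isPathConnected_routeImg hn hc h0)
    (img_star_fst_inter_routeImg_nonempty hn) (img_star_snd_inter_routeImg_nonempty hn)
    (fun u v huv => le_setDist_img hD <| LongGraph.farApart_star_star (by rw [gadget_m]; omega)
      (by simpa using huv) fun _ _ hxy => hxy.ne_frame u)
    (le_setDist_img_star_routeImg hc hD h0) (le_setDist_routeImg_routeImg hn hc hD h0)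

end Gadget

theorem ofReal_two_zpow_neg (n : ℕ) : ENNReal.ofReal (2 ^ (-(n : ℤ))) = (2 ^ n)⁻¹ := by
  rw [zpow_neg, zpow_natCast, ENNReal.ofReal_inv_of_pos (by positivity),
    ENNReal.ofReal_pow zero_le_two, ENNReal.ofReal_ofNat]

theorem mul_add_le_thirteen_mul_sq {q : ℕ} (hq : 1 ≤ q) {ε : ℝ≥0∞} (hε : ε ≤ 1) :
    q * (3 * q + 1 + ε + (3 * q + 1) + q) ≤ (13 * q ^ 2 : ℝ≥0∞) := by
  have hq' : (1 : ℝ≥0∞) ≤ q := Nat.one_le_cast.2 hq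
  calc q * (3 * q + 1 + ε + (3 * q + 1) + q)
      ≤ (q : ℝ≥0∞) * (3 * q + q + q + (3 * q + q) + q) := by
        gcongr
        exact hε.trans hq'
    _ = 10 * q ^ 2 := by ring
    _ ≤ 13 * q ^ 2 := by
        gcongr
        norm_num

theorem theorem2 :
    ∃ (W : Type) (_ : Finite W) (H : SimpleGraph W), ∀ q : ℕ, 1 ≤ q →
      ∃ (V : Type) (G : SimpleGraph V), ¬ HasFatMinor H 3 (GraphSpace G) ∧
        ∀ (X : Type*) [EMetricSpace X], IsLengthSpace X →
          ¬ HasFatMinor H ((2 : ℝ) ^ (-(13 * (q : ℤ) ^ 2))) X →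
            ¬ QuasiIsometric q (GraphSpace G) X := by
  refine ⟨Fin 20, inferInstance, ⊤, fun q hq => ?_⟩
  set n := 13 * q ^ 2 with hn
  have hn1 : 1 ≤ n := by nlinarith
  refine ⟨_, (Gadget.gadget n).graph, Gadget.not_hasFatMinor hn1, ?_⟩
  rintro X _ hX hH ⟨φ, hφ⟩
  have hK : ENNReal.ofReal ((2 : ℝ) ^ (-(13 * (q : ℤ) ^ 2))) = (2 ^ n)⁻¹ := by
    simpa [hn] using ofReal_two_zpow_neg n
  have hmul : (2 : ℝ≥0∞) ^ n * (2 ^ n)⁻¹ = 1 := ENNReal.mul_inv_cancel (by simp) (by simp)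
  obtain ⟨D, hD⟩ := hφ.exists_separates hX hq (d := n) (s := 3 * q + 1) (ε := (2 ^ n)⁻¹)
    (by finiteness) (by
      simpa [hn] using
        mul_add_le_thirteen_mul_sq hq (ENNReal.inv_le_one.2 (one_le_pow₀ one_le_two)))
  refine hH (Gadget.hasFatMinor_of_separates hn1 D ?_)
  rwa [hK, hmul]
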